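/- Let $T>0$, $\nu\in\mathbb{R}$, $\zeta,P\in C^2([0,T])$ and $f,p\in C^0([0,T];H^2(\mathbb{R}))$. Let $u_0\in H^2(\mathbb{R})$ and $u_1\in L^2(\mathbb{R})\cap L^\infty(\mathbb{R})$. Let $\theta\in C_c^\infty(\mathbb{R})$ be an even probability density, put $\theta^\epsilon(x)=\frac1\epsilon\theta(\frac{x}{\epsilon})$ for $\epsilon>0$, and let $\star$ denote convolution in $x$. For every $\epsilon>0$ let $$u^\epsilon\in C^0([0,T];H^4(\mathbb{R}))\cap C^1([0,T];H^2(\mathbb{R}))\cap C^2([0,T];L^2(\mathbb{R}))$$ be a solution of the mollified Gao beam problem $$u^\epsilon_{tt}+\partial_t\bigl(\theta^\epsilon(\cdot-\zeta(t))\,u^\epsilon_t\bigr)+u^\epsilon_{xxxx}-\bigl[\bigl((u^\epsilon\star(\theta^\epsilon)')^2-\nu p\bigr)\,(u^\epsilon\star(\theta^\epsilon)'')\bigr]\star\theta^\epsilon+h^\epsilon=0\quad\text{on }[0,T]\times\mathbb{R},$$ $$h^\epsilon=-\bigl(f+\theta^\epsilon(\cdot-\zeta(t))P(t)\bigr),\qquad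 u^\epsilon(0,\cdot)=u_0\star\theta^\epsilon,\qquad u^\epsilon_t(0,\cdot)=u_1\star\theta^\epsilon.$$ Then every sequence of positive numbers tending to $0$ has a subsequence $(\epsilon_k)_{k\in\mathbb{N}}$ for which there is a function $u\in L^2(0,T;H^2(\mathbb{R}))$, with weak time derivative $u_t\in L^2(0,T;L^2(\mathbb{R}))$, such that, as $k\to+\infty$: (i) $u^{\epsilon_k}\rightharpoonup u$, $u^{\epsilon_k}_t\rightharpoonup u_t$ and $u^{\epsilon_k}_{xx}\rightharpoonup u_{xx}$ weakly in $L^2(0,T;L^2(\mathbb{R}))$; (ii) for every compact set $K\subset\mathbb{R}$ and every $\alpha\in\,]0,2]$, $u^{\epsilon_k}\to u$ strongly in $C^0([0,T];H^{2-\alpha}(K))$, and $u^{\epsilon_k}_x\to u_x$ strongly in $L^\infty([0,T]\times K)$, where $H^s(K)$ is the space of restrictions to $K$ of functions in $H^s(\mathbb{R})$ with the quotient norm; (iii) for all real $a<b$, $u^{\epsilon_k}_x\star\theta^{\epsilon_k}\to u_x$ and $(u^{\epsilon_k}_x\star\theta^{\epsilon_k})^3\to u_x^3$ strongly in $L^2([0,T]\times[a,b])$.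 -/

import Mathlib

open MeasureTheory Set Filter Topology
open scoped ENNReal ContDiff

noncomputable section

/-- The real Hilbert space `L²(ℝ)`. -/
abbrev LTwo : Type := Lp ℝ 2 (volume : Measure ℝ)

/-- `g` is the weak (distributional) derivative of order `j` of `f` on `ℝ`. -/
def IsWeakDeriv (j : ℕ) (f g : LTwo) : Prop :=
  ∀ φ : ℝ → ℝ, ContDiff ℝ ∞ φ → HasCompactSupport φ →
    ∫ x, f x * iteratedDeriv j φ x = (-1) ^ j * ∫ x, g x * φ x

theorem integrable_mul_of_test (f : LTwo) {ψ : ℝ → ℝ} (hψ : Continuous ψ)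
    (hc : HasCompactSupport ψ) : Integrable (fun x => f x * ψ x) :=
  MemLp.integrable_mul (p := 2) (q := 2) (Lp.memLp f) (hψ.memLp_of_hasCompactSupport hc)

theorem hasCompactSupport_iterated_deriv {φ : ℝ → ℝ} (hc : HasCompactSupport φ) (j : ℕ) :
    HasCompactSupport (iteratedDeriv j φ) := by
  induction j with
  | zero => simpa using hc
  | succ j ih => rw [iteratedDeriv_succ]; exact ih.deriv

theorem IsWeakDeriv.add {j : ℕ} {f g f' g' : LTwo} (h : IsWeakDeriv j f g)
    (h' : IsWeakDeriv j f' g') : IsWeakDeriv j (f + f') (g + g') := by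
  intro φ hφ hc
  have hj : Continuous (iteratedDeriv j φ) := hφ.continuous_iteratedDeriv j (by exact_mod_cast le_top)
  have hcj := hasCompactSupport_iterated_deriv hc j
  have e1 : ∫ x, (f + f') x * iteratedDeriv j φ x
      = ∫ x, (f x * iteratedDeriv j φ x + f' x * iteratedDeriv j φ x) := by
    refine integral_congr_ae ?_
    filter_upwards [Lp.coeFn_add f f'] with x hx
    rw [hx, Pi.add_apply, add_mul]
  have e2 : ∫ x, (g + g') x * φ x = ∫ x, (g x * φ x + g' x * φ x) := by
    refine integral_congr_ae ?_
    filter_upwards [Lp.coeFn_add g g'] with x hx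
    rw [hx, Pi.add_apply, add_mul]
  rw [e1, e2, integral_add (integrable_mul_of_test f hj hcj) (integrable_mul_of_test f' hj hcj),
    integral_add (integrable_mul_of_test g hφ.continuous hc)
      (integrable_mul_of_test g' hφ.continuous hc), h φ hφ hc, h' φ hφ hc, mul_add]

theorem IsWeakDeriv.smul {j : ℕ} {f g : LTwo} (c : ℝ) (h : IsWeakDeriv j f g) :
    IsWeakDeriv j (c • f) (c • g) := by
  intro φ hφ hc
  have e1 : ∫ x, (c • f) x * iteratedDeriv j φ x = ∫ x, c * (f x * iteratedDeriv j φ x) := by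
    refine integral_congr_ae ?_
    filter_upwards [Lp.coeFn_smul c f] with x hx
    rw [hx, Pi.smul_apply, smul_eq_mul, mul_assoc]
  have e2 : ∫ x, (c • g) x * φ x = ∫ x, c * (g x * φ x) := by
    refine integral_congr_ae ?_
    filter_upwards [Lp.coeFn_smul c g] with x hx
    rw [hx, Pi.smul_apply, smul_eq_mul, mul_assoc]
  rw [e1, e2, integral_const_mul, integral_const_mul, h φ hφ hc]
  ring

theorem IsWeakDeriv.zero (j : ℕ) : IsWeakDeriv j 0 0 := by
  intro φ _ _
  have e : ∀ ψ : ℝ → ℝ, ∫ x, (0 : LTwo) x * ψ x = 0 := by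
    intro ψ
    refine integral_eq_zero_of_ae ?_
    filter_upwards [Lp.coeFn_zero ℝ 2 (volume : Measure ℝ)] with x hx
    rw [hx]; simp
  rw [e, e, mul_zero]

/-- The Sobolev space `H^m(ℝ)`, `m ∈ ℕ`: an element is an `L²` function together with its (unique)
weak derivatives of orders `1, …, m`, all in `L²`. The norm inherited from the product is
`(∑_{j ≤ m} ‖∂ₓʲ u‖²_{L²})^{1/2}`. -/
def SobolevH (m : ℕ) : Submodule ℝ (PiLp 2 (fun _ : Fin (m + 1) => LTwo)) where
  carrier := {F | ∀ j : Fin (m + 1), IsWeakDeriv j (F 0) (F j)}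
  add_mem' := fun ha hb j => (ha j).add (hb j)
  zero_mem' := fun j => IsWeakDeriv.zero j
  smul_mem' := fun c _ ha j => (ha j).smul c

/-- `dx j u` is the weak derivative `∂ₓʲ u ∈ L²(ℝ)` of `u ∈ H^m(ℝ)`, `j ≤ m`; `dx 0 u` is `u`. -/
def dx {m : ℕ} (j : Fin (m + 1)) (u : SobolevH m) : LTwo := (u : PiLp 2 (fun _ => LTwo)) j

/-- An `L²` function, seen as complex valued. -/
def toComplexLTwo (f : LTwo) : Lp ℂ 2 (volume : Measure ℝ) := Complex.ofRealCLM.compLp f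

/-- The norm of `H^s(ℝ)`, `s ≥ 0`, through the Fourier transform: the `L²` norm of
`(1 + ξ²)^{s/2} f̂(ξ)`. It is `⊤` exactly when `f ∈ L²(ℝ)` is not in `H^s(ℝ)`. -/
def hsENorm (s : ℝ) (f : LTwo) : ℝ≥0∞ :=
  eLpNorm (fun ξ : ℝ => (1 + ξ ^ 2) ^ (s / 2) •
    (FourierTransform.fourier (toComplexLTwo f) : Lp ℂ 2 (volume : Measure ℝ)) ξ) 2 volume

/-- The (quotient) norm of `H^s(K)`, the space of restrictions to `K` of elements of `H^s(ℝ)`,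
`s ≥ 0`: the infimum of the norms in `H^s(ℝ)` of the functions that agree with `f` on `K`. -/
def hsENormOn (s : ℝ) (K : Set ℝ) (f : LTwo) : ℝ≥0∞ :=
  ⨅ (g : LTwo) (_ : g =ᵐ[volume.restrict K] f), hsENorm s g

/-- `w ∈ C⁰([0,T]; H^s(K))`. -/
def ContinuousInHs (T s : ℝ) (K : Set ℝ) (w : ℝ → LTwo) : Prop :=
  ∀ t ∈ Icc 0 T, hsENormOn s K (w t) < ⊤ ∧
    Tendsto (fun r => hsENormOn s K (w r - w t)) (𝓝[Icc 0 T] t) (𝓝 0)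

/-- Strong convergence `w k → w'` in `C⁰([0,T]; H^s(K))`. -/
def TendstoInCHs (T s : ℝ) (K : Set ℝ) (w : ℕ → ℝ → LTwo) (w' : ℝ → LTwo) : Prop :=
  (∀ k, ContinuousInHs T s K (w k)) ∧ ContinuousInHs T s K w' ∧
    Tendsto (fun k => ⨆ t ∈ Icc 0 T, hsENormOn s K (w k t - w' t)) atTop (𝓝 0)

/-- The norm of `L^∞([0,T] × K)`, as the supremum over all `t ∈ [0,T]` of the norm of `w(t, ·)` in
`L^∞(K)` (by Fubini's theorem, at least the essential supremum over `[0,T] × K`). -/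
def linftyENorm (T : ℝ) (K : Set ℝ) (w : ℝ → LTwo) : ℝ≥0∞ :=
  ⨆ t ∈ Icc 0 T, eLpNorm (w t) ⊤ (volume.restrict K)

/-- Strong convergence `w k → w'` in `L^∞([0,T] × K)`. -/
def TendstoInLinfty (T : ℝ) (K : Set ℝ) (w : ℕ → ℝ → LTwo) (w' : ℝ → LTwo) : Prop :=
  (∀ k, linftyENorm T K (w k) < ⊤) ∧ linftyENorm T K w' < ⊤ ∧
    Tendsto (fun k => linftyENorm T K (fun t => w k t - w' t)) atTop (𝓝 0)

/-- The square of the norm of `L²([0,T] × [a,b])`, as an iterated integral. -/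
def sqNormOn (T a b : ℝ) (w : ℝ → ℝ → ℝ) : ℝ≥0∞ :=
  ∫⁻ t in Icc 0 T, ∫⁻ x in Icc a b, ‖w t x‖ₑ ^ 2

/-- Strong convergence `w k → w'` in `L²([0,T] × [a,b])`. -/
def TendstoInLTwoOn (T a b : ℝ) (w : ℕ → ℝ → ℝ → ℝ) (w' : ℝ → ℝ → ℝ) : Prop :=
  (∀ k, sqNormOn T a b (w k) < ⊤) ∧ sqNormOn T a b w' < ⊤ ∧
    Tendsto (fun k => sqNormOn T a b (fun t x => w k t x - w' t x)) atTop (𝓝 0)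

/-- Weak convergence `w k ⇀ w'` in the Hilbert space `L²(0,T; L²(ℝ))`. -/
def TendstoWeakly (T : ℝ) (w : ℕ → ℝ → LTwo) (w' : ℝ → LTwo) : Prop :=
  (∀ k, MemLp (w k) 2 (volume.restrict (Icc 0 T))) ∧ MemLp w' 2 (volume.restrict (Icc 0 T)) ∧
    ∀ g : ℝ → LTwo, MemLp g 2 (volume.restrict (Icc 0 T)) →
      Tendsto (fun k => ∫ t in Icc 0 T, inner ℝ (w k t) (g t)) atTop
        (𝓝 (∫ t in Icc 0 T, inner ℝ (w' t) (g t)))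

/-- `w'` is the weak time derivative on `(0,T)` of the `L²(ℝ)`-valued function `w`. -/
def IsWeakTimeDeriv (T : ℝ) (w w' : ℝ → LTwo) : Prop :=
  ∀ φ : ℝ → ℝ, ContDiff ℝ ∞ φ → HasCompactSupport φ → tsupport φ ⊆ Ioo 0 T →
    ∫ t in Icc 0 T, deriv φ t • w t = -∫ t in Icc 0 T, φ t • w' t

/-- The space `E₀(T) = C⁰([0,T]; H⁴(ℝ)) ∩ C¹([0,T]; H²(ℝ)) ∩ C²([0,T]; L²(ℝ))`. -/
def MemEZero (T : ℝ) (U : ℝ → SobolevH 4) : Prop :=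
  ContinuousOn U (Icc 0 T) ∧
  (∃ V : ℝ → SobolevH 2, ContDiffOn ℝ 1 V (Icc 0 T) ∧ ∀ t ∈ Icc 0 T, dx 0 (V t) = dx 0 (U t)) ∧
  ContDiffOn ℝ 2 (fun t => dx 0 (U t)) (Icc 0 T)

/-- The time derivative `∂ₜʲ u ∈ L²(ℝ)` at time `t ∈ [0,T]` of a curve `u` (one-sided at `0`
and `T`). -/
def dt (T : ℝ) (j : ℕ) {m : ℕ} (U : ℝ → SobolevH m) (t : ℝ) : LTwo :=
  iteratedDerivWithin j (fun s => dx 0 (U s)) (Icc 0 T) t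

/-- `θ` is an even probability density in `C_c^∞(ℝ)`. -/
structure IsEvenBump (θ : ℝ → ℝ) : Prop where
  smooth : ContDiff ℝ ∞ θ
  compact : HasCompactSupport θ
  nonneg : ∀ x, 0 ≤ θ x
  even : ∀ x, θ (-x) = θ x
  integral_eq_one : ∫ x, θ x = 1

/-- `θ^ε(x) = ε⁻¹ θ(x / ε)`. -/
def mollifier (θ : ℝ → ℝ) (ε x : ℝ) : ℝ := 1 / ε * θ (x / ε)

/-- The convolution `(f ⋆ g)(x) = ∫ f(y) g(x - y) dy` of real functions on `ℝ`. -/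
def conv (f g : ℝ → ℝ) : ℝ → ℝ :=
  convolution f g (ContinuousLinearMap.mul ℝ ℝ) volume

/-- The mollified nonlinear term `[((u ⋆ θ^ε′)² - ν p) (u ⋆ θ^ε″)] ⋆ θ^ε`. -/
def nonlinearTerm (θ : ℝ → ℝ) (ε ν : ℝ) (p u : ℝ → ℝ) : ℝ → ℝ :=
  conv (fun y => (conv u (deriv (mollifier θ ε)) y ^ 2 - ν * p y) *
    conv u (iteratedDeriv 2 (mollifier θ ε)) y) (mollifier θ ε)

/-- `U ∈ E₀(T)` solves the mollified Gao beam problem with parameter `ε`: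
`u_tt + ∂ₜ(θ^ε(x - ζ(t)) u_t) + u_xxxx - [((u ⋆ θ^ε′)² - ν p)(u ⋆ θ^ε″)] ⋆ θ^ε + h^ε = 0`,
where `h^ε = -(f + θ^ε(x - ζ(t)) P(t))`, with `u(0) = u₀ ⋆ θ^ε` and `u_t(0) = u₁ ⋆ θ^ε`.
The equation holds in `L²(ℝ)` for each `t ∈ [0,T]`, and
`∂ₜ(θ^ε(x - ζ(t)) u_t) = θ^ε(x - ζ(t)) u_tt - ζ'(t) θ^ε′(x - ζ(t)) u_t`. -/
structure IsMollifiedSolution (T ν : ℝ) (ζ P θ : ℝ → ℝ) (f p : ℝ → SobolevH 2)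
    (u₀ : SobolevH 2) (u₁ : LTwo) (ε : ℝ) (U : ℝ → SobolevH 4) : Prop where
  regular : MemEZero T U
  equation : ∀ t ∈ Icc 0 T, ∀ᵐ x : ℝ,
    dt T 2 U t x
      + (mollifier θ ε (x - ζ t) * dt T 2 U t x
        - derivWithin ζ (Icc 0 T) t * deriv (mollifier θ ε) (x - ζ t) * dt T 1 U t x)
      + dx 4 (U t) x
      - nonlinearTerm θ ε ν (dx 0 (p t)) (dx 0 (U t)) x
      + -(dx 0 (f t) x + mollifier θ ε (x - ζ t) * P t) = 0
  init_pos : ∀ᵐ x : ℝ, dx 0 (U 0) x = conv (dx 0 u₀) (mollifier θ ε) x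
  init_vel : ∀ᵐ x : ℝ, dt T 1 U 0 x = conv u₁ (mollifier θ ε) x

end

open scoped BoundedContinuousFunction

instance factTwoNeTop : Fact ((2 : ℝ≥0∞) ≠ ⊤) := ⟨ENNReal.ofNat_ne_top⟩

theorem inner_eq_integral (f g : LTwo) : inner ℝ f g = ∫ x, f x * g x := by
  rw [L2.inner_def]
  refine integral_congr_ae (Eventually.of_forall fun x => ?_)
  simp [mul_comm]

theorem LTwo.integrable_mul (f g : LTwo) : Integrable (fun x => f x * g x) :=
  MemLp.integrable_mul (p := 2) (q := 2) (Lp.memLp f) (Lp.memLp g)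

theorem LTwo.locallyIntegrable (f : LTwo) : LocallyIntegrable f volume :=
  (Lp.memLp f).locallyIntegrable one_le_two

/-! ### Multiplication by bounded continuous functions -/

theorem memLp_bcf_mul (φ : ℝ →ᵇ ℝ) (f : LTwo) : MemLp (fun x => φ x * f x) 2 volume := by
  refine (Lp.memLp f).of_le_mul (c := ‖φ‖)
    (φ.continuous.aestronglyMeasurable.mul (Lp.aestronglyMeasurable f))
    (Eventually.of_forall fun x => ?_)
  rw [norm_mul]
  gcongr
  exact φ.norm_coe_le_norm x

/-- Multiplication of `L²` functions by bounded continuous functions. -/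
noncomputable def mulL : (ℝ →ᵇ ℝ) →L[ℝ] LTwo →L[ℝ] LTwo :=
  LinearMap.mkContinuous₂
    (LinearMap.mk₂ ℝ (fun φ f => (memLp_bcf_mul φ f).toLp)
      (fun φ ψ f => by
        apply Lp.ext
        filter_upwards [(memLp_bcf_mul (φ + ψ) f).coeFn_toLp, (memLp_bcf_mul φ f).coeFn_toLp,
          (memLp_bcf_mul ψ f).coeFn_toLp,
          Lp.coeFn_add (memLp_bcf_mul φ f).toLp (memLp_bcf_mul ψ f).toLp] with x h1 h2 h3 h4
        rw [h1, h4, Pi.add_apply, h2, h3, BoundedContinuousFunction.add_apply, add_mul])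
      (fun c φ f => by
        apply Lp.ext
        filter_upwards [(memLp_bcf_mul (c • φ) f).coeFn_toLp, (memLp_bcf_mul φ f).coeFn_toLp,
          Lp.coeFn_smul c (memLp_bcf_mul φ f).toLp] with x h1 h2 h4
        rw [h1, h4, Pi.smul_apply, h2, BoundedContinuousFunction.smul_apply, smul_mul_assoc])
      (fun φ f g => by
        apply Lp.ext
        filter_upwards [(memLp_bcf_mul φ (f + g)).coeFn_toLp, (memLp_bcf_mul φ f).coeFn_toLp,
          (memLp_bcf_mul φ g).coeFn_toLp, Lp.coeFn_add f g,
          Lp.coeFn_add (memLp_bcf_mul φ f).toLp (memLp_bcf_mul φ g).toLp] with x h1 h2 h3 h5 h4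
        rw [h1, h4, Pi.add_apply, h2, h3, h5, Pi.add_apply, mul_add])
      (fun c φ f => by
        apply Lp.ext
        filter_upwards [(memLp_bcf_mul φ (c • f)).coeFn_toLp, (memLp_bcf_mul φ f).coeFn_toLp,
          Lp.coeFn_smul c f, Lp.coeFn_smul c (memLp_bcf_mul φ f).toLp] with x h1 h2 h3 h4
        rw [h1, h4, Pi.smul_apply, h2, h3, Pi.smul_apply, mul_smul_comm]))
    1 (fun φ f => by
      rw [one_mul]
      refine Lp.norm_le_mul_norm_of_ae_le_mul ?_
      filter_upwards [(memLp_bcf_mul φ f).coeFn_toLp] with x h1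
      rw [LinearMap.mk₂_apply, h1, norm_mul]
      gcongr
      exact φ.norm_coe_le_norm x)

theorem coeFn_mulL (φ : ℝ →ᵇ ℝ) (f : LTwo) : mulL φ f =ᵐ[volume] fun x => φ x * f x :=
  (memLp_bcf_mul φ f).coeFn_toLp

theorem norm_mulL_le (φ : ℝ →ᵇ ℝ) (f : LTwo) : ‖mulL φ f‖ ≤ ‖φ‖ * ‖f‖ := by
  refine Lp.norm_le_mul_norm_of_ae_le_mul ?_
  filter_upwards [coeFn_mulL φ f] with x h1
  rw [h1, norm_mul]
  gcongr
  exact φ.norm_coe_le_norm x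

theorem inner_mulL_left (φ : ℝ →ᵇ ℝ) (f g : LTwo) :
    inner ℝ (mulL φ f) g = ∫ x, φ x * f x * g x := by
  rw [inner_eq_integral]
  refine integral_congr_ae ?_
  filter_upwards [coeFn_mulL φ f] with x h
  rw [h]

theorem inner_mulL_comm (φ : ℝ →ᵇ ℝ) (f g : LTwo) :
    inner ℝ (mulL φ f) g = inner ℝ (mulL φ g) f := by
  rw [inner_mulL_left, inner_mulL_left]
  refine integral_congr_ae (Eventually.of_forall fun x => ?_)
  ring

theorem mulL_mulL (φ ψ : ℝ →ᵇ ℝ) (f : LTwo) : mulL φ (mulL ψ f) = mulL (φ * ψ) f := by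
  apply Lp.ext
  filter_upwards [coeFn_mulL φ (mulL ψ f), coeFn_mulL ψ f, coeFn_mulL (φ * ψ) f] with x h1 h2 h3
  rw [h1, h2, h3, BoundedContinuousFunction.mul_apply, mul_assoc]

/-! ### Convolution with a compactly supported kernel -/

theorem conv_apply (f k : ℝ → ℝ) (x : ℝ) : conv f k x = ∫ y, f y * k (x - y) := rfl

theorem HasCompactSupport.comp_sub_left {k : ℝ → ℝ} (hc : HasCompactSupport k) (x : ℝ) :
    HasCompactSupport (fun y => k (x - y)) :=
  hc.comp_homeomorph (Homeomorph.subLeft x)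

/-- The function `y ↦ k (x - y)` as an element of `L²`. -/
noncomputable def kernelAt {k : ℝ → ℝ} (hk : Continuous k) (hc : HasCompactSupport k) (x : ℝ) :
    LTwo :=
  ((hk.comp (continuous_const.sub continuous_id)).memLp_of_hasCompactSupport
    (hc.comp_sub_left x) : MemLp (fun y => k (x - y)) 2 volume).toLp

theorem coeFn_kernelAt {k : ℝ → ℝ} (hk : Continuous k) (hc : HasCompactSupport k) (x : ℝ) :
    kernelAt hk hc x =ᵐ[volume] fun y => k (x - y) := MemLp.coeFn_toLp _

theorem conv_eq_inner {k : ℝ → ℝ} (hk : Continuous k) (hc : HasCompactSupport k) (f : LTwo)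
    (x : ℝ) : conv f k x = inner ℝ f (kernelAt hk hc x) := by
  rw [conv_apply, inner_eq_integral]
  refine integral_congr_ae ?_
  filter_upwards [coeFn_kernelAt hk hc x] with y hy
  rw [hy]

theorem norm_kernelAt {k : ℝ → ℝ} (hk : Continuous k) (hc : HasCompactSupport k) (x : ℝ) :
    ‖kernelAt hk hc x‖ = (eLpNorm k 2 volume).toReal := by
  rw [kernelAt, Lp.norm_toLp]
  congr 1
  exact eLpNorm_comp_measurePreserving hk.aestronglyMeasurable
    (Measure.measurePreserving_sub_left volume x)

theorem continuous_conv {k : ℝ → ℝ} (hk : Continuous k) (hc : HasCompactSupport k) (f : LTwo) :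
    Continuous (conv f k) :=
  hc.continuous_convolution_right _ f.locallyIntegrable hk

theorem conv_congr_ae {f f' : ℝ → ℝ} (h : f =ᵐ[volume] f') (k : ℝ → ℝ) : conv f k = conv f' k := by
  funext x
  rw [conv_apply, conv_apply]
  refine integral_congr_ae ?_
  filter_upwards [h] with y hy
  rw [hy]

/-- Convolution with a kernel, from `L²` to the bounded continuous functions. -/
noncomputable def convB {k : ℝ → ℝ} (hk : Continuous k) (hc : HasCompactSupport k) :
    LTwo →L[ℝ] (ℝ →ᵇ ℝ) :=
  LinearMap.mkContinuous
    { toFun := fun f => BoundedContinuousFunction.ofNormedAddCommGroup (conv f k)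
        (continuous_conv hk hc f) (‖f‖ * (eLpNorm k 2 volume).toReal) (fun x => by
          rw [conv_eq_inner hk hc, ← norm_kernelAt hk hc x]
          exact norm_inner_le_norm _ _)
      map_add' := fun f g => by
        ext x
        simp only [BoundedContinuousFunction.coe_ofNormedAddCommGroup,
          BoundedContinuousFunction.add_apply, conv_eq_inner hk hc, inner_add_left]
      map_smul' := fun c f => by
        ext x
        simp only [BoundedContinuousFunction.coe_ofNormedAddCommGroup, RingHom.id_apply,
          BoundedContinuousFunction.smul_apply, conv_eq_inner hk hc, inner_smul_left, smul_eq_mul]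
        simp }
    (eLpNorm k 2 volume).toReal (fun f => by
      refine (BoundedContinuousFunction.norm_le (by positivity)).2 fun x => ?_
      change ‖conv f k x‖ ≤ _
      rw [conv_eq_inner hk hc, ← norm_kernelAt hk hc x, mul_comm]
      exact norm_inner_le_norm _ _)

theorem eLpNorm_two_sq (f : ℝ → ℝ) : eLpNorm f 2 volume ^ 2 = ∫⁻ x, ‖f x‖ₑ ^ 2 := by
  rw [eLpNorm_eq_lintegral_rpow_enorm_toReal two_ne_zero ENNReal.ofNat_ne_top]
  rw [← ENNReal.rpow_natCast, ← ENNReal.rpow_mul]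
  simp

theorem enorm_conv_sq_le {k : ℝ → ℝ} (hk : Continuous k) {f : ℝ → ℝ}
    (hf : AEStronglyMeasurable f volume) (x : ℝ) :
    ‖conv f k x‖ₑ ^ 2 ≤ (∫⁻ y, ‖f y‖ₑ ^ 2 * ‖k (x - y)‖ₑ) * ∫⁻ y, ‖k y‖ₑ := by
  have hkm : AEMeasurable (fun y => ‖k (x - y)‖ₑ) volume :=
    (hk.comp (continuous_const.sub continuous_id)).measurable.enorm.aemeasurable
  have h1 : ‖conv f k x‖ₑ ≤ ∫⁻ y, ((fun y => ‖f y‖ₑ * ‖k (x - y)‖ₑ ^ (1 / 2 : ℝ)) *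
      fun y => ‖k (x - y)‖ₑ ^ (1 / 2 : ℝ)) y := by
    refine (enorm_integral_le_lintegral_enorm _).trans (lintegral_mono fun y => ?_)
    simp only [Pi.mul_apply]
    rw [mul_assoc, ← ENNReal.rpow_add_of_nonneg _ _ (by norm_num) (by norm_num)]
    norm_num [enorm_mul]
  have h2 := h1.trans (ENNReal.lintegral_mul_le_Lp_mul_Lq volume Real.HolderConjugate.two_two
    (hf.enorm.mul (hkm.pow_const _)) (hkm.pow_const _))
  have e1 : ∀ y, (‖f y‖ₑ * ‖k (x - y)‖ₑ ^ (1 / 2 : ℝ)) ^ (2 : ℝ) = ‖f y‖ₑ ^ 2 * ‖k (x - y)‖ₑ := by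
    intro y
    rw [ENNReal.mul_rpow_of_nonneg _ _ (by norm_num), ← ENNReal.rpow_mul]
    norm_num
  have e2 : ∀ y, (‖k (x - y)‖ₑ ^ (1 / 2 : ℝ)) ^ (2 : ℝ) = ‖k (x - y)‖ₑ := by
    intro y
    rw [← ENNReal.rpow_mul]
    norm_num
  simp only [e1, e2] at h2
  calc ‖conv f k x‖ₑ ^ 2 ≤ ((∫⁻ y, ‖f y‖ₑ ^ 2 * ‖k (x - y)‖ₑ) ^ (1 / 2 : ℝ) *
          (∫⁻ y, ‖k (x - y)‖ₑ) ^ (1 / 2 : ℝ)) ^ 2 := by gcongr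
    _ = (∫⁻ y, ‖f y‖ₑ ^ 2 * ‖k (x - y)‖ₑ) * ∫⁻ y, ‖k (x - y)‖ₑ := by
      rw [mul_pow, ← ENNReal.rpow_natCast, ← ENNReal.rpow_mul, ← ENNReal.rpow_natCast,
        ← ENNReal.rpow_mul]
      norm_num
    _ = _ := by
      rw [lintegral_sub_left_eq_self (fun y => ‖k y‖ₑ) x]

theorem eLpNorm_conv_le {k : ℝ → ℝ} (hk : Continuous k) {f : ℝ → ℝ}
    (hf : AEStronglyMeasurable f volume) :
    eLpNorm (conv f k) 2 volume ≤ (∫⁻ y, ‖k y‖ₑ) * eLpNorm f 2 volume := by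
  have hm : AEMeasurable (Function.uncurry fun x y => ‖f y‖ₑ ^ 2 * ‖k (x - y)‖ₑ)
      ((volume : Measure ℝ).prod volume) := by
    have h1 : AEMeasurable (fun z : ℝ × ℝ => ‖f z.2‖ₑ ^ 2) (volume.prod volume) :=
      ((hf.comp_quasiMeasurePreserving Measure.quasiMeasurePreserving_snd).enorm).pow_const 2
    have h2 : AEMeasurable (fun z : ℝ × ℝ => ‖k (z.1 - z.2)‖ₑ) (volume.prod volume) :=
      (hk.comp (continuous_fst.sub continuous_snd)).measurable.enorm.aemeasurable
    exact h1.mul h2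
  have key : eLpNorm (conv f k) 2 volume ^ 2 ≤ ((∫⁻ y, ‖k y‖ₑ) * eLpNorm f 2 volume) ^ 2 := by
    rw [eLpNorm_two_sq, mul_pow, eLpNorm_two_sq]
    calc ∫⁻ x, ‖conv f k x‖ₑ ^ 2
        ≤ ∫⁻ x, (∫⁻ y, ‖f y‖ₑ ^ 2 * ‖k (x - y)‖ₑ) * ∫⁻ y, ‖k y‖ₑ :=
          lintegral_mono fun x => enorm_conv_sq_le hk hf x
      _ = (∫⁻ x, ∫⁻ y, ‖f y‖ₑ ^ 2 * ‖k (x - y)‖ₑ) * ∫⁻ y, ‖k y‖ₑ :=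
          lintegral_mul_const'' _ hm.lintegral_prod_right'
      _ = (∫⁻ y, ∫⁻ x, ‖f y‖ₑ ^ 2 * ‖k (x - y)‖ₑ) * ∫⁻ y, ‖k y‖ₑ := by
          rw [lintegral_lintegral_swap hm]
      _ = (∫⁻ y, ‖f y‖ₑ ^ 2 * ∫⁻ x, ‖k x‖ₑ) * ∫⁻ y, ‖k y‖ₑ := by
          congr 1
          refine lintegral_congr fun y => ?_
          have hm' : Measurable fun x => ‖k (x - y)‖ₑ :=
            (hk.comp (continuous_id.sub continuous_const)).measurable.enorm
          rw [lintegral_const_mul _ hm']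
          rw [lintegral_sub_right_eq_self (fun y => ‖k y‖ₑ) y]
      _ = _ := by
          rw [lintegral_mul_const'' _ (hf.enorm.pow_const 2)]
          ring
  exact le_of_sq_le_sq key
where
  le_of_sq_le_sq {a b : ℝ≥0∞} (h : a ^ 2 ≤ b ^ 2) : a ≤ b :=
    (ENNReal.pow_le_pow_left_iff two_ne_zero).1 h

theorem lintegral_enorm_kernel_lt_top {k : ℝ → ℝ} (hk : Continuous k) (hc : HasCompactSupport k) :
    ∫⁻ y, ‖k y‖ₑ < ⊤ :=
  (hk.integrable_of_hasCompactSupport hc).hasFiniteIntegral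

theorem memLp_conv {k : ℝ → ℝ} (hk : Continuous k) (hc : HasCompactSupport k) (f : LTwo) :
    MemLp (conv f k) 2 volume :=
  ⟨(continuous_conv hk hc f).aestronglyMeasurable,
    (eLpNorm_conv_le hk (Lp.aestronglyMeasurable f)).trans_lt
      (ENNReal.mul_lt_top (lintegral_enorm_kernel_lt_top hk hc) (Lp.eLpNorm_lt_top f))⟩

/-- Convolution with a kernel, as an operator on `L²`. -/
noncomputable def convL {k : ℝ → ℝ} (hk : Continuous k) (hc : HasCompactSupport k) :
    LTwo →L[ℝ] LTwo :=
  LinearMap.mkContinuous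
    { toFun := fun f => (memLp_conv hk hc f).toLp
      map_add' := fun f g => by
        apply Lp.ext
        filter_upwards [(memLp_conv hk hc (f + g)).coeFn_toLp, (memLp_conv hk hc f).coeFn_toLp,
          (memLp_conv hk hc g).coeFn_toLp,
          Lp.coeFn_add (memLp_conv hk hc f).toLp (memLp_conv hk hc g).toLp] with x h1 h2 h3 h4
        rw [h1, h4, Pi.add_apply, h2, h3]
        simp only [conv_eq_inner hk hc, inner_add_left]
      map_smul' := fun c f => by
        apply Lp.ext
        filter_upwards [(memLp_conv hk hc (c • f)).coeFn_toLp, (memLp_conv hk hc f).coeFn_toLp,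
          Lp.coeFn_smul c (memLp_conv hk hc f).toLp] with x h1 h2 h4
        rw [h1, RingHom.id_apply, h4, Pi.smul_apply, h2]
        simp [conv_eq_inner hk hc, inner_smul_left] }
    (∫⁻ y, ‖k y‖ₑ).toReal (fun f => by
      change ‖(memLp_conv hk hc f).toLp‖ ≤ _
      rw [Lp.norm_toLp, Lp.norm_def, ← ENNReal.toReal_mul]
      exact ENNReal.toReal_mono (ENNReal.mul_lt_top (lintegral_enorm_kernel_lt_top hk hc)
        (Lp.eLpNorm_lt_top f)).ne (eLpNorm_conv_le hk (Lp.aestronglyMeasurable f)))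

theorem coeFn_convL {k : ℝ → ℝ} (hk : Continuous k) (hc : HasCompactSupport k) (f : LTwo) :
    convL hk hc f =ᵐ[volume] conv f k := (memLp_conv hk hc f).coeFn_toLp

theorem norm_convL_le {k : ℝ → ℝ} (hk : Continuous k) (hc : HasCompactSupport k) (f : LTwo) :
    ‖convL hk hc f‖ ≤ (∫⁻ y, ‖k y‖ₑ).toReal * ‖f‖ := by
  change ‖(memLp_conv hk hc f).toLp‖ ≤ _
  rw [Lp.norm_toLp, Lp.norm_def, ← ENNReal.toReal_mul]
  exact ENNReal.toReal_mono (ENNReal.mul_lt_top (lintegral_enorm_kernel_lt_top hk hc)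
    (Lp.eLpNorm_lt_top f)).ne (eLpNorm_conv_le hk (Lp.aestronglyMeasurable f))

theorem integrable_conv_kernel {k : ℝ → ℝ} (hk : Continuous k) (hc : HasCompactSupport k)
    (f g : LTwo) :
    Integrable (Function.uncurry fun x y => f y * k (x - y) * g x) (volume.prod volume) := by
  have hm : AEStronglyMeasurable (Function.uncurry fun x y => f y * k (x - y) * g x)
      ((volume : Measure ℝ).prod volume) := by
    refine AEStronglyMeasurable.mul (AEStronglyMeasurable.mul ?_ ?_) ?_
    · exact (Lp.aestronglyMeasurable f).comp_quasiMeasurePreserving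
        Measure.quasiMeasurePreserving_snd
    · exact (hk.comp (continuous_fst.sub continuous_snd)).aestronglyMeasurable
    · exact (Lp.aestronglyMeasurable g).comp_quasiMeasurePreserving
        Measure.quasiMeasurePreserving_fst
  rw [integrable_prod_iff hm]
  constructor
  · refine Eventually.of_forall fun x => ?_
    exact (integrable_mul_of_test f (ψ := fun y => k (x - y))
      (hk.comp (continuous_const.sub continuous_id)) (hc.comp_sub_left x)).mul_const (g x)
  · have habs : MemLp (conv (fun y => |f y|) (fun z => |k z|)) 2 volume := by
      have := memLp_conv hk.abs hc.abs (Lp.memLp f).abs.toLp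
      rwa [conv_congr_ae (Lp.memLp f).abs.coeFn_toLp] at this
    refine (MemLp.integrable_mul (p := 2) (q := 2) habs (Lp.memLp g).abs).congr
      (Eventually.of_forall fun x => ?_)
    simp only [Pi.mul_apply, Function.uncurry_apply_pair, norm_mul, Real.norm_eq_abs, conv_apply,
      Pi.abs_apply]
    rw [integral_mul_const]

theorem inner_convL_comm {k : ℝ → ℝ} (hk : Continuous k) (hc : HasCompactSupport k)
    (heven : ∀ x, k (-x) = k x) (f g : LTwo) :
    inner ℝ (convL hk hc f) g = inner ℝ f (convL hk hc g) := by
  have e1 : inner ℝ (convL hk hc f) g = ∫ x, ∫ y, f y * k (x - y) * g x := by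
    rw [inner_eq_integral]
    refine integral_congr_ae ?_
    filter_upwards [coeFn_convL hk hc f] with x hx
    rw [hx, conv_apply, integral_mul_const]
  have e2 : inner ℝ f (convL hk hc g) = ∫ y, ∫ x, f y * k (x - y) * g x := by
    rw [inner_eq_integral]
    refine integral_congr_ae ?_
    filter_upwards [coeFn_convL hk hc g] with y hy
    rw [hy, conv_apply, ← integral_const_mul]
    refine integral_congr_ae (Eventually.of_forall fun x => ?_)
    simp only
    rw [← heven (y - x), neg_sub]
    ring
  rw [e1, e2]
  exact integral_integral_swap (integrable_conv_kernel hk hc f g)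

theorem norm_convL_le_of_density {k : ℝ → ℝ} (hk : Continuous k) (hc : HasCompactSupport k)
    (h0 : ∀ x, 0 ≤ k x) (h1 : ∫ x, k x = 1) (f : LTwo) : ‖convL hk hc f‖ ≤ ‖f‖ := by
  have h : (∫⁻ y, ‖k y‖ₑ).toReal = 1 := by
    rw [← integral_norm_eq_lintegral_enorm hk.aestronglyMeasurable, ← h1]
    refine integral_congr_ae (Eventually.of_forall fun x => ?_)
    simp [abs_of_nonneg (h0 x)]
  simpa [h] using norm_convL_le hk hc f

/-! ### Weak derivatives -/

theorem LTwo.ext_of_test {f g : LTwo}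
    (h : ∀ φ : ℝ → ℝ, ContDiff ℝ ∞ φ → HasCompactSupport φ →
      ∫ x, f x * φ x = ∫ x, g x * φ x) : f = g := by
  apply Lp.ext
  refine ae_eq_of_integral_contDiff_smul_eq f.locallyIntegrable g.locallyIntegrable
    fun φ hφ hc => ?_
  simpa [mul_comm] using h φ hφ hc

theorem IsWeakDeriv.unique {j : ℕ} {f g g' : LTwo} (h : IsWeakDeriv j f g)
    (h' : IsWeakDeriv j f g') : g = g' := by
  refine LTwo.ext_of_test fun φ hφ hc => ?_
  have := (h φ hφ hc).symm.trans (h' φ hφ hc)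
  exact mul_left_cancel₀ (pow_ne_zero _ (by norm_num)) this

theorem contDiff_deriv_top {φ : ℝ → ℝ} (hφ : ContDiff ℝ ∞ φ) : ContDiff ℝ ∞ (deriv φ) :=
  (contDiff_infty_iff_deriv.1 hφ).2

theorem isWeakDeriv_one_iff {f g : LTwo} : IsWeakDeriv 1 f g ↔
    ∀ φ : ℝ → ℝ, ContDiff ℝ ∞ φ → HasCompactSupport φ →
      ∫ x, f x * deriv φ x = -∫ x, g x * φ x := by
  simp [IsWeakDeriv, iteratedDeriv_one]

theorem IsWeakDeriv.of_succ {j : ℕ} {f g h : LTwo} (hg : IsWeakDeriv j f g)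
    (hh : IsWeakDeriv (j + 1) f h) : IsWeakDeriv 1 g h := by
  refine isWeakDeriv_one_iff.2 fun φ hφ hc => ?_
  have h1 := hg _ (contDiff_deriv_top hφ) hc.deriv
  have h2 := hh φ hφ hc
  rw [iteratedDeriv_succ', h1, pow_succ, mul_assoc, neg_one_mul] at h2
  exact mul_left_cancel₀ (pow_ne_zero _ (by norm_num)) h2

theorem IsWeakDeriv.succ {j : ℕ} {f g h : LTwo} (hg : IsWeakDeriv j f g)
    (hh : IsWeakDeriv 1 g h) : IsWeakDeriv (j + 1) f h := by
  intro φ hφ hc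
  rw [iteratedDeriv_succ', hg _ (contDiff_deriv_top hφ) hc.deriv,
    isWeakDeriv_one_iff.1 hh φ hφ hc, pow_succ, mul_assoc, neg_one_mul]

theorem isWeakDeriv_zero (f : LTwo) : IsWeakDeriv 0 f f := by
  intro φ _ _
  simp

theorem IsWeakDeriv.mul_smooth {f g : LTwo} (h : IsWeakDeriv 1 f g) {χ χ' : ℝ →ᵇ ℝ}
    (hχ : ContDiff ℝ ∞ χ) (hχ' : ∀ x, HasDerivAt χ (χ' x) x) :
    IsWeakDeriv 1 (mulL χ f) (mulL χ' f + mulL χ g) := by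
  refine isWeakDeriv_one_iff.2 fun φ hφ hc => ?_
  have h1 := isWeakDeriv_one_iff.1 h (fun x => χ x * φ x) (hχ.mul hφ) hc.mul_left
  have hd : ∀ x, deriv (fun x => χ x * φ x) x = χ' x * φ x + χ x * deriv φ x := fun x =>
    ((hχ' x).mul (hφ.differentiable (by simp)).differentiableAt.hasDerivAt).deriv
  have i1 : Integrable (fun x => f x * (χ' x * φ x)) :=
    integrable_mul_of_test f (χ'.continuous.mul hφ.continuous) hc.mul_left
  have i2 : Integrable (fun x => f x * (χ x * deriv φ x)) :=
    integrable_mul_of_test f (χ.continuous.mul (contDiff_deriv_top hφ).continuous)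
      hc.deriv.mul_left
  have i3 : Integrable (fun x => g x * (χ x * φ x)) :=
    integrable_mul_of_test g (χ.continuous.mul hφ.continuous) hc.mul_left
  simp only [hd, mul_add] at h1
  rw [integral_add i1 i2] at h1
  have e1 : ∫ x, mulL χ f x * deriv φ x = ∫ x, f x * (χ x * deriv φ x) := by
    refine integral_congr_ae ?_
    filter_upwards [coeFn_mulL χ f] with x hx
    rw [hx]; ring
  have e2 : ∫ x, (mulL χ' f + mulL χ g : LTwo) x * φ x
      = ∫ x, (f x * (χ' x * φ x) + g x * (χ x * φ x)) := by
    refine integral_congr_ae ?_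
    filter_upwards [coeFn_mulL χ' f, coeFn_mulL χ g,
      Lp.coeFn_add (mulL χ' f) (mulL χ g)] with x hx hy hz
    rw [hz, Pi.add_apply, hx, hy]; ring
  rw [e1, e2, integral_add i1 i3]
  linarith

theorem integral_convL_mul {k : ℝ → ℝ} (hk : Continuous k) (hc : HasCompactSupport k)
    (heven : ∀ x, k (-x) = k x) (f : LTwo) {φ : ℝ → ℝ} (hφ : Continuous φ)
    (hφc : HasCompactSupport φ) :
    ∫ x, convL hk hc f x * φ x = ∫ x, f x * conv φ k x := by
  have hm : MemLp φ 2 volume := hφ.memLp_of_hasCompactSupport hφc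
  have h := inner_convL_comm hk hc heven f (hm.toLp φ)
  rw [inner_eq_integral, inner_eq_integral] at h
  have e1 : ∫ x, convL hk hc f x * φ x = ∫ x, convL hk hc f x * (hm.toLp φ) x := by
    refine integral_congr_ae ?_
    filter_upwards [hm.coeFn_toLp] with x hx
    rw [hx]
  rw [e1, h]
  refine integral_congr_ae ?_
  filter_upwards [coeFn_convL hk hc (hm.toLp φ)] with x hx
  rw [hx, conv_congr_ae hm.coeFn_toLp]

theorem IsWeakDeriv.convolve {f g : LTwo} (h : IsWeakDeriv 1 f g) {k : ℝ → ℝ} (hk : Continuous k)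
    (hc : HasCompactSupport k) (heven : ∀ x, k (-x) = k x) :
    IsWeakDeriv 1 (convL hk hc f) (convL hk hc g) := by
  refine isWeakDeriv_one_iff.2 fun φ hφ hφc => ?_
  rw [integral_convL_mul hk hc heven f (contDiff_deriv_top hφ).continuous hφc.deriv,
    integral_convL_mul hk hc heven g hφ.continuous hφc]
  have h1 := isWeakDeriv_one_iff.1 h (conv φ k)
    (hφc.contDiff_convolution_left _ hφ (hk.locallyIntegrable)) (hφc.convolution _ hc)
  rw [← h1]
  refine integral_congr_ae (Eventually.of_forall fun x => ?_)
  simp only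
  congr 1
  exact ((hφc.hasDerivAt_convolution_left _ (hφ.of_le (by exact_mod_cast le_top))
    hk.locallyIntegrable x).deriv).symm

theorem IsWeakDeriv.conv_eq {f g : LTwo} (h : IsWeakDeriv 1 f g) {k : ℝ → ℝ}
    (hk : ContDiff ℝ ∞ k) (hc : HasCompactSupport k) : conv g k = conv f (deriv k) := by
  funext x
  have h1 := isWeakDeriv_one_iff.1 h (fun y => k (x - y))
    (hk.comp (contDiff_const.sub contDiff_id)) (hc.comp_sub_left x)
  have hd : ∀ y, deriv (fun y => k (x - y)) y = -deriv k (x - y) := fun y =>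
    deriv_comp_const_sub ..
  simp only [hd, mul_neg, integral_neg, neg_inj] at h1
  exact h1.symm

theorem hasDerivAt_conv (f : LTwo) {k : ℝ → ℝ} (hk : ContDiff ℝ ∞ k) (hc : HasCompactSupport k)
    (x : ℝ) : HasDerivAt (conv f k) (conv f (deriv k) x) x :=
  hc.hasDerivAt_convolution_right _ f.locallyIntegrable (hk.of_le (by exact_mod_cast le_top)) x

theorem IsWeakDeriv.hasDerivAt_convolve {f g : LTwo} (h : IsWeakDeriv 1 f g) {k : ℝ → ℝ}
    (hk : ContDiff ℝ ∞ k) (hc : HasCompactSupport k) (x : ℝ) :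
    HasDerivAt (conv f k) (conv g k x) x := by
  rw [h.conv_eq hk hc]
  exact hasDerivAt_conv f hk hc x

/-! ### Approximate identities -/

theorem exists_approximate_identity : ∃ κ : ℕ → ℝ → ℝ, (∀ n, IsEvenBump (κ n)) ∧
    ∀ f : LTwo, ∀ᵐ x : ℝ, Tendsto (fun n => conv f (κ n) x) atTop (𝓝 (f x)) := by
  let φ : ℕ → ContDiffBump (0 : ℝ) := fun n =>
    ⟨1 / ((n : ℝ) + 1), 2 / ((n : ℝ) + 1), by positivity, by gcongr; norm_num⟩
  refine ⟨fun n => (φ n).normed volume, fun n => ⟨(φ n).contDiff_normed,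
    (φ n).hasCompactSupport_normed, (φ n).nonneg_normed, fun x => (φ n).normed_neg x,
    (φ n).integral_normed⟩, fun f => ?_⟩
  have h0 : Tendsto (fun n => (φ n).rOut) atTop (𝓝 0) := by
    have := (tendsto_one_div_add_atTop_nhds_zero_nat (𝕜 := ℝ)).const_mul 2
    simpa [φ, div_eq_mul_inv] using this
  have h1 : ∀ᶠ n in atTop, (φ n).rOut ≤ 2 * (φ n).rIn :=
    Eventually.of_forall fun n => by simp [φ, div_eq_mul_inv]
  filter_upwards [ContDiffBump.ae_convolution_tendsto_right_of_locallyIntegrable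
    (μ := volume) h0 h1 f.locallyIntegrable] with x hx
  refine hx.congr fun n => ?_
  rw [conv, ← convolution_flip]
  congr 1
  ext
  simp

theorem IsEvenBump.norm_convL_le {κ : ℝ → ℝ} (h : IsEvenBump κ) (f : LTwo) :
    ‖convL h.smooth.continuous h.compact f‖ ≤ ‖f‖ :=
  norm_convL_le_of_density _ _ h.nonneg h.integral_eq_one f

theorem integral_abs_mul_le (f g : LTwo) : ∫ x, |f x * g x| ≤ ‖f‖ * ‖g‖ := by
  have h := real_inner_le_norm |f| |g|
  rw [norm_abs_eq_norm, norm_abs_eq_norm, inner_eq_integral] at h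
  refine le_trans (le_of_eq (integral_congr_ae ?_)) h
  filter_upwards [Lp.coeFn_abs f, Lp.coeFn_abs g] with x hx hy
  rw [hx, hy, abs_mul]

theorem IsWeakDeriv.sq_conv_le {f g : LTwo} (h : IsWeakDeriv 1 f g) {κ : ℝ → ℝ}
    (hκ : IsEvenBump κ) (x : ℝ) : conv f κ x ^ 2 ≤ 2 * (‖f‖ * ‖g‖) := by
  have hk := hκ.smooth.continuous
  have hc := hκ.compact
  have hi : ∀ f g : LTwo, Integrable (fun y => conv f κ y * conv g κ y) := fun f g =>
    MemLp.integrable_mul (p := 2) (q := 2) (memLp_conv hk hc f) (memLp_conv hk hc g)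
  have hd : ∀ y, HasDerivAt (fun y => conv f κ y ^ 2) (2 * (conv f κ y * conv g κ y)) y := by
    intro y
    refine ((h.hasDerivAt_convolve hκ.smooth hc y).pow 2).congr_deriv ?_
    simp; ring
  have hi2 : Integrable (fun y => conv f κ y ^ 2) := by simpa [sq] using hi f f
  have h0 := tendsto_zero_of_hasDerivAt_of_integrableOn_Iic (a := x) (fun y _ => hd y)
    ((hi f g).const_mul 2).integrableOn hi2.integrableOn
  have h1 := integral_Iic_of_hasDerivAt_of_tendsto (a := x)
    (hd x).continuousAt.continuousWithinAt (fun y _ => hd y)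
    ((hi f g).const_mul 2).integrableOn h0
  rw [sub_zero] at h1
  rw [← h1, integral_const_mul]
  gcongr
  calc ∫ y in Iic x, conv f κ y * conv g κ y ≤ ∫ y in Iic x, |conv f κ y * conv g κ y| :=
        integral_mono (hi f g).integrableOn (hi f g).abs.integrableOn fun y => le_abs_self _
    _ ≤ ∫ y, |conv f κ y * conv g κ y| :=
        setIntegral_le_integral (hi f g).abs (Eventually.of_forall fun y => abs_nonneg _)
    _ = ∫ y, |convL hk hc f y * convL hk hc g y| := by
        refine integral_congr_ae ?_
        filter_upwards [coeFn_convL hk hc f, coeFn_convL hk hc g] with y h1 h2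
        rw [h1, h2]
    _ ≤ _ := integral_abs_mul_le _ _
    _ ≤ ‖f‖ * ‖g‖ := by gcongr <;> exact hκ.norm_convL_le _

theorem IsWeakDeriv.ae_sq_le {f g : LTwo} (h : IsWeakDeriv 1 f g) :
    ∀ᵐ x : ℝ, f x ^ 2 ≤ 2 * (‖f‖ * ‖g‖) := by
  obtain ⟨κ, hκ, hlim⟩ := exists_approximate_identity
  filter_upwards [hlim f] with x hx
  exact le_of_tendsto (hx.pow 2) (Eventually.of_forall fun n => h.sq_conv_le (hκ n) x)

theorem IsWeakDeriv.sq_conv_sub_le {f g : LTwo} (h : IsWeakDeriv 1 f g) {κ : ℝ → ℝ}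
    (hκ : IsEvenBump κ) (x y : ℝ) :
    (conv f κ y - conv f κ x) ^ 2 ≤ |y - x| * ‖g‖ ^ 2 := by
  wlog hxy : x ≤ y generalizing x y
  · have := this y x (le_of_not_ge hxy)
    rwa [abs_sub_comm, ← neg_sub, neg_sq] at this
  have hk := hκ.smooth.continuous
  have hc := hκ.compact
  have h1 : ∫ z in x..y, conv g κ z = conv f κ y - conv f κ x :=
    intervalIntegral.integral_eq_sub_of_hasDerivAt
      (fun z _ => h.hasDerivAt_convolve hκ.smooth hc z)
      ((continuous_conv hk hc g).intervalIntegrable _ _)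
  have hv : volume (Ioc x y) ≠ ⊤ := by simp
  have h2 : inner ℝ (indicatorConstLp 2 measurableSet_Ioc hv (1 : ℝ)) (convL hk hc g)
      = conv f κ y - conv f κ x := by
    rw [L2.inner_indicatorConstLp_one, ← h1, intervalIntegral.integral_of_le hxy]
    refine integral_congr_ae (ae_restrict_of_ae (coeFn_convL hk hc g))
  rw [← h2, ← sq_abs]
  calc _ ≤ (‖indicatorConstLp 2 (measurableSet_Ioc (a := x) (b := y)) hv (1 : ℝ)‖ *
        ‖convL hk hc g‖) ^ 2 := by gcongr; exact abs_real_inner_le_norm _ _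
    _ ≤ (|y - x| ^ (1 / 2 : ℝ) * ‖g‖) ^ 2 := by
        rw [norm_indicatorConstLp two_ne_zero ENNReal.ofNat_ne_top]
        have : (volume : Measure ℝ).real (Ioc x y) = |y - x| := by
          rw [Real.volume_real_Ioc_of_le hxy, abs_of_nonneg (sub_nonneg.2 hxy)]
        rw [this]
        simp only [norm_one, one_mul, ENNReal.toReal_ofNat]
        gcongr
        exact hκ.norm_convL_le _
    _ = _ := by
        rw [mul_pow, ← Real.sqrt_eq_rpow, Real.sq_sqrt (abs_nonneg _)]

theorem IsWeakDeriv.ae_sq_sub_le {f g : LTwo} (h : IsWeakDeriv 1 f g) :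
    ∀ᵐ x : ℝ, ∀ᵐ y : ℝ, (f y - f x) ^ 2 ≤ |y - x| * ‖g‖ ^ 2 := by
  obtain ⟨κ, hκ, hlim⟩ := exists_approximate_identity
  filter_upwards [hlim f] with x hx
  filter_upwards [hlim f] with y hy
  exact le_of_tendsto ((hy.sub hx).pow 2)
    (Eventually.of_forall fun n => h.sq_conv_sub_le (hκ n) x y)

theorem IsWeakDeriv.ae_abs_conv_sub_le {f g : LTwo} (h : IsWeakDeriv 1 f g) {κ : ℝ → ℝ}
    (hκ : IsEvenBump κ) {R : ℝ} (hR : ∀ x, R < |x| → κ x = 0) :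
    ∀ᵐ x : ℝ, |conv f κ x - f x| ≤ √R * ‖g‖ := by
  have hk := hκ.smooth.continuous
  have hc := hκ.compact
  filter_upwards [h.ae_sq_sub_le] with x hx
  have hi : Integrable (fun y => κ (x - y)) :=
    (hk.comp (continuous_const.sub continuous_id)).integrable_of_hasCompactSupport
      (hc.comp_sub_left x)
  have h1 : ∫ y, κ (x - y) = 1 := by
    rw [integral_sub_left_eq_self κ volume x, hκ.integral_eq_one]
  have hif : Integrable (fun y => f y * κ (x - y)) :=
    integrable_mul_of_test f (ψ := fun y => κ (x - y))
      (hk.comp (continuous_const.sub continuous_id)) (hc.comp_sub_left x)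
  have e : conv f κ x - f x = ∫ y, (f y - f x) * κ (x - y) := by
    simp only [sub_mul]
    rw [integral_sub hif (hi.const_mul _), integral_const_mul, h1, mul_one, conv_apply]
  rw [e]
  calc |∫ y, (f y - f x) * κ (x - y)| ≤ ∫ y, (√R * ‖g‖) * κ (x - y) := by
        refine norm_integral_le_of_norm_le (f := fun y => (f y - f x) * κ (x - y))
          (hi.const_mul _) ?_
        filter_upwards [hx] with y hy
        rw [norm_mul, Real.norm_of_nonneg (hκ.nonneg _)]
        by_cases hxy : R < |x - y|
        · simp [hR _ hxy]
        · refine mul_le_mul_of_nonneg_right ?_ (hκ.nonneg _)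
          rw [not_lt, abs_sub_comm] at hxy
          refine abs_le_of_sq_le_sq (hy.trans ?_) (by positivity)
          rw [mul_pow, Real.sq_sqrt ((abs_nonneg _).trans hxy)]
          gcongr
    _ = _ := by rw [integral_const_mul, h1, mul_one]

/-! ### Weak derivatives and the Fourier transform -/

theorem exists_cutoff : ∃ χ : ℝ → ℝ, ContDiff ℝ ∞ χ ∧ HasCompactSupport χ ∧
    (∀ x, |x| ≤ 1 → χ x = 1) ∧ ∀ x, |χ x| ≤ 1 := by
  let b : ContDiffBump (0 : ℝ) := ⟨1, 2, by norm_num, by norm_num⟩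
  refine ⟨b, b.contDiff, b.hasCompactSupport, fun x hx => b.one_of_mem_closedBall ?_, fun x => ?_⟩
  · simpa [Metric.mem_closedBall, b] using hx
  · rw [abs_of_nonneg b.nonneg]
    exact b.le_one

theorem IsWeakDeriv.integral_mul_deriv {f g : LTwo} (h : IsWeakDeriv 1 f g) {φ : ℝ → ℝ}
    (hφ : ContDiff ℝ ∞ φ) (h0 : MemLp φ 2 volume) (h1 : MemLp (deriv φ) 2 volume) :
    ∫ x, f x * deriv φ x = -∫ x, g x * φ x := by
  obtain ⟨χ, hχ, hχc, hχ1, hχb⟩ := exists_cutoff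
  obtain ⟨C, hC⟩ := (contDiff_deriv_top hχ).continuous.bounded_above_of_compact_support hχc.deriv
  let s : ℕ → ℝ := fun n => ((n : ℝ) + 1)⁻¹
  have hs0 : ∀ n, 0 < s n := fun n => by positivity
  have hs1 : ∀ n, s n ≤ 1 := fun n => inv_le_one_of_one_le₀ (by simp)
  have hev : ∀ x : ℝ, ∀ᶠ n in atTop, |s n * x| < 1 := by
    intro x
    have : Tendsto (fun n => |s n * x|) atTop (𝓝 |0 * x|) := by
      have h0 : Tendsto s atTop (𝓝 0) := by
        simpa [s] using tendsto_one_div_add_atTop_nhds_zero_nat (𝕜 := ℝ)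
      exact (h0.mul_const x).abs
    refine this.eventually_lt_const ?_
    simp
  let ψ : ℕ → ℝ → ℝ := fun n x => χ (s n * x) * φ x
  have hcs : ∀ n, HasCompactSupport fun x => χ (s n * x) := fun n =>
    hχc.comp_homeomorph (Homeomorph.mulLeft₀ (s n) (hs0 n).ne')
  have hψ : ∀ n, ContDiff ℝ ∞ (ψ n) := fun n =>
    (hχ.comp (contDiff_const.mul contDiff_id)).mul hφ
  have hd : ∀ n x, deriv (ψ n) x = s n * deriv χ (s n * x) * φ x + χ (s n * x) * deriv φ x := by
    intro n x
    have e1 : HasDerivAt (fun x => χ (s n * x)) (deriv χ (s n * x) * s n) x := by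
      have := ((hχ.differentiable (by simp)).differentiableAt (x := s n * x)).hasDerivAt
      exact this.comp x (by simpa using (hasDerivAt_id x).const_mul (s n))
    have e2 := e1.mul ((hφ.differentiable (by simp)).differentiableAt (x := x)).hasDerivAt
    refine e2.deriv.trans ?_
    ring
  have key := fun n => isWeakDeriv_one_iff.1 h (ψ n) (hψ n) (hcs n).mul_right
  have t1 : Tendsto (fun n => ∫ x, f x * deriv (ψ n) x) atTop (𝓝 (∫ x, f x * deriv φ x)) := by
    refine tendsto_integral_of_dominated_convergence
      (fun x => C * |f x * φ x| + |f x * deriv φ x|) (fun n => ?_) ?_ (fun n => ?_) ?_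
    · exact (Lp.aestronglyMeasurable f).mul
        (contDiff_deriv_top (hψ n)).continuous.aestronglyMeasurable
    · exact ((MemLp.integrable_mul (p := 2) (q := 2) (Lp.memLp f) h0).abs.const_mul C).add
        (MemLp.integrable_mul (p := 2) (q := 2) (Lp.memLp f) h1).abs
    · refine Eventually.of_forall fun x => ?_
      rw [hd, mul_add]
      refine (norm_add_le _ _).trans (add_le_add ?_ ?_)
      · have : |s n * deriv χ (s n * x)| ≤ C := by
          rw [abs_mul, abs_of_pos (hs0 n)]
          calc s n * |deriv χ (s n * x)| ≤ 1 * C :=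
                mul_le_mul (hs1 n) (hC _) (abs_nonneg _) zero_le_one
            _ = C := one_mul C
        calc ‖f x * (s n * deriv χ (s n * x) * φ x)‖
            = |s n * deriv χ (s n * x)| * |f x * φ x| := by
              rw [Real.norm_eq_abs, ← abs_mul]; congr 1; ring
          _ ≤ C * |f x * φ x| := by gcongr
      · calc ‖f x * (χ (s n * x) * deriv φ x)‖ = |χ (s n * x)| * |f x * deriv φ x| := by
              rw [Real.norm_eq_abs, ← abs_mul]; congr 1; ring
          _ ≤ 1 * |f x * deriv φ x| := by gcongr; exact hχb _
          _ = _ := one_mul _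
    · refine Eventually.of_forall fun x => ?_
      refine tendsto_const_nhds.congr' ?_
      filter_upwards [hev x] with n hn
      have hz : deriv χ (s n * x) = 0 := by
        have : χ =ᶠ[𝓝 (s n * x)] fun _ => 1 := by
          filter_upwards [(isOpen_lt continuous_abs continuous_const).mem_nhds hn] with y hy
          exact hχ1 y (le_of_lt hy)
        rw [this.deriv_eq, deriv_const]
      rw [hd, hz, hχ1 _ hn.le]
      ring
  have t2 : Tendsto (fun n => -∫ x, g x * ψ n x) atTop (𝓝 (-∫ x, g x * φ x)) := by
    refine Tendsto.neg (tendsto_integral_of_dominated_convergence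
      (fun x => |g x * φ x|) (fun n => ?_) ?_ (fun n => ?_) ?_)
    · exact (Lp.aestronglyMeasurable g).mul (hψ n).continuous.aestronglyMeasurable
    · exact (MemLp.integrable_mul (p := 2) (q := 2) (Lp.memLp g) h0).abs
    · refine Eventually.of_forall fun x => ?_
      calc ‖g x * (χ (s n * x) * φ x)‖ = |χ (s n * x)| * |g x * φ x| := by
            rw [Real.norm_eq_abs, ← abs_mul]; congr 1; ring
        _ ≤ 1 * |g x * φ x| := by gcongr; exact hχb _
        _ = _ := one_mul _
    · refine Eventually.of_forall fun x => ?_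
      refine tendsto_const_nhds.congr' ?_
      filter_upwards [hev x] with n hn
      simp [ψ, hχ1 _ hn.le]
  exact tendsto_nhds_unique t1 (t2.congr fun n => (key n).symm)

theorem coeFn_toComplexLTwo (f : LTwo) :
    toComplexLTwo f =ᵐ[volume] fun x => (f x : ℂ) :=
  ContinuousLinearMap.coeFn_compLp _ f

theorem norm_toComplexLTwo (f : LTwo) : ‖toComplexLTwo f‖ = ‖f‖ := by
  rw [Lp.norm_def, Lp.norm_def]
  congr 1
  refine eLpNorm_congr_norm_ae ?_
  filter_upwards [coeFn_toComplexLTwo f] with x hx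
  rw [hx, Complex.norm_real]

theorem inner_toComplexLTwo (f g : LTwo) :
    inner ℂ (toComplexLTwo f) (toComplexLTwo g) = (inner ℝ f g : ℝ) := by
  rw [L2.inner_def, inner_eq_integral, ← integral_complex_ofReal]
  refine integral_congr_ae ?_
  filter_upwards [coeFn_toComplexLTwo f, coeFn_toComplexLTwo g] with x hx hy
  rw [hx, hy]
  simp [mul_comm]

open FourierTransform SchwartzMap in
theorem IsWeakDeriv.integral_schwartz {f g : LTwo} (h : IsWeakDeriv 1 f g) (ψ : 𝓢(ℝ, ℂ)) :
    ∫ x, deriv ψ x * toComplexLTwo f x = -∫ x, ψ x * toComplexLTwo g x := by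
  have hψ : ContDiff ℝ ∞ ψ := ψ.smooth'
  have hdiff : ∀ x, HasDerivAt ψ (deriv ψ x) x := fun x =>
    (hψ.differentiable (by simp)).differentiableAt.hasDerivAt
  have hder : (fun x => deriv ψ x) = SchwartzMap.derivCLM ℂ ℂ ψ := by
    ext x; simp
  have h0 : MemLp ψ 2 volume := ψ.memLp 2 volume
  have h1 : MemLp (fun x => deriv ψ x) 2 volume := by
    rw [hder]; exact (SchwartzMap.derivCLM ℂ ℂ ψ).memLp 2 volume
  have hre : ∀ x, HasDerivAt (fun x => (ψ x).re) (deriv ψ x).re x := fun x =>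
    (Complex.reCLM.hasFDerivAt.comp_hasDerivAt x (hdiff x))
  have him : ∀ x, HasDerivAt (fun x => (ψ x).im) (deriv ψ x).im x := fun x =>
    (Complex.imCLM.hasFDerivAt.comp_hasDerivAt x (hdiff x))
  have ere : deriv (fun x => (ψ x).re) = fun x => (deriv ψ x).re := funext fun x => (hre x).deriv
  have eim : deriv (fun x => (ψ x).im) = fun x => (deriv ψ x).im := funext fun x => (him x).deriv
  have k1 := h.integral_mul_deriv (φ := fun x => (ψ x).re) (Complex.reCLM.contDiff.comp hψ)
    h0.re (by rw [ere]; exact h1.re)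
  have k2 := h.integral_mul_deriv (φ := fun x => (ψ x).im) (Complex.imCLM.contDiff.comp hψ)
    h0.im (by rw [eim]; exact h1.im)
  rw [ere] at k1
  rw [eim] at k2
  have gen : ∀ (F : LTwo) (q : ℝ → ℂ), MemLp q 2 volume → ∫ x, q x * toComplexLTwo F x
      = ((∫ x, F x * (q x).re : ℝ) : ℂ) + ((∫ x, F x * (q x).im : ℝ) : ℂ) * Complex.I := by
    intro F q hq
    have hi : Integrable fun x => q x * toComplexLTwo F x :=
      MemLp.integrable_mul (p := 2) (q := 2) hq (Lp.memLp (toComplexLTwo F))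
    rw [← integral_re_add_im hi]
    congr 1
    · congr 1
      refine integral_congr_ae ?_
      filter_upwards [coeFn_toComplexLTwo F] with x hx
      rw [hx]; simp [mul_comm]
    · congr 2
      refine integral_congr_ae ?_
      filter_upwards [coeFn_toComplexLTwo F] with x hx
      rw [hx]; simp [mul_comm]
  rw [gen f _ h1, gen g _ h0, k1, k2]
  push_cast
  ring

open FourierTransform SchwartzMap LineDeriv in
theorem IsWeakDeriv.lineDeriv_toTemperedDistribution {f g : LTwo} (h : IsWeakDeriv 1 f g) :
    ∂_{(1 : ℝ)} (Lp.toTemperedDistribution (toComplexLTwo f) : 𝓢'(ℝ, ℂ))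
      = Lp.toTemperedDistribution (toComplexLTwo g) := by
  ext ψ
  rw [TemperedDistribution.lineDerivOp_apply_apply]
  have := h.integral_schwartz ψ
  simp only [Lp.toTemperedDistribution_apply, smul_eq_mul, map_neg]
  rw [← neg_eq_iff_eq_neg] at this
  rw [← this]
  rfl

open FourierTransform SchwartzMap in
theorem IsWeakDeriv.fourier_eq {f g : LTwo} (h : IsWeakDeriv 1 f g) :
    (𝓕 (toComplexLTwo g) : Lp ℂ 2 (volume : Measure ℝ)) =ᵐ[volume] fun ξ =>
      (2 * Real.pi * Complex.I * ξ) * (𝓕 (toComplexLTwo f) : Lp ℂ 2 (volume : Measure ℝ)) ξ := by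
  set F : Lp ℂ 2 (volume : Measure ℝ) := 𝓕 (toComplexLTwo f) with hF
  set G : Lp ℂ 2 (volume : Measure ℝ) := 𝓕 (toComplexLTwo g) with hG
  have key : (Lp.toTemperedDistribution G : 𝓢'(ℝ, ℂ)) = (2 * Real.pi * Complex.I) •
      TemperedDistribution.smulLeftCLM ℂ (inner ℝ · (1 : ℝ)) (Lp.toTemperedDistribution F) := by
    rw [hG, hF, ← Lp.fourier_toTemperedDistribution_eq, ← Lp.fourier_toTemperedDistribution_eq,
      ← h.lineDeriv_toTemperedDistribution, TemperedDistribution.fourier_lineDerivOp_eq]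
  have hFl : LocallyIntegrable F volume := (Lp.memLp F).locallyIntegrable one_le_two
  have hGl : LocallyIntegrable G volume := (Lp.memLp G).locallyIntegrable one_le_two
  have hc : Continuous fun ξ : ℝ => (2 * Real.pi * Complex.I * (ξ : ℂ)) := by fun_prop
  have hFl' : LocallyIntegrable (fun ξ : ℝ => (2 * Real.pi * Complex.I * (ξ : ℂ)) * F ξ)
      volume := by
    rw [locallyIntegrable_iff] at hFl ⊢
    intro k hk
    exact (hFl k hk).continuousOn_mul hc.continuousOn hk
  refine ae_eq_of_integral_contDiff_smul_eq hGl hFl' fun φ hφ hφc => ?_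
  have hg₁ : HasCompactSupport (Complex.ofRealCLM ∘ φ) := hφc.comp_left rfl
  have hg₂ : ContDiff ℝ ∞ (Complex.ofRealCLM ∘ φ) := by fun_prop
  have := congrArg (fun D => D (hg₁.toSchwartzMap hg₂)) key
  have ht : (fun x : ℝ => ((inner ℝ x (1 : ℝ) : ℝ) : ℂ)).HasTemperateGrowth := by fun_prop
  have ht' : (fun x : ℝ => (x : ℂ)).HasTemperateGrowth := by simpa using ht
  simp only [Lp.toTemperedDistribution_apply] at this
  simp [TemperedDistribution.smulLeftCLM_apply_apply] at this
  simp only [SchwartzMap.smulLeftCLM_apply_apply ht'] at this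
  simp only [Complex.real_smul]
  rw [this, ← integral_const_mul]
  refine integral_congr_ae (Eventually.of_forall fun x => ?_)
  simp
  ring

theorem inner_eq_inner_fourier (f g : LTwo) : ((inner ℝ f g : ℝ) : ℂ) =
    ∫ ξ, inner ℂ
      ((FourierTransform.fourier (toComplexLTwo f) : Lp ℂ 2 (volume : Measure ℝ)) ξ)
      ((FourierTransform.fourier (toComplexLTwo g) : Lp ℂ 2 (volume : Measure ℝ)) ξ) := by
  rw [← inner_toComplexLTwo, ← Lp.inner_fourier_eq, L2.inner_def]

/-- Integration by parts in `H¹`. -/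
theorem IsWeakDeriv.inner_eq_neg {f f' g g' : LTwo} (hf : IsWeakDeriv 1 f f')
    (hg : IsWeakDeriv 1 g g') : inner ℝ f g' = -inner ℝ f' g := by
  have h : ((inner ℝ f g' : ℝ) : ℂ) = -((inner ℝ f' g : ℝ) : ℂ) := by
    rw [inner_eq_inner_fourier, inner_eq_inner_fourier, ← integral_neg]
    refine integral_congr_ae ?_
    filter_upwards [hf.fourier_eq, hg.fourier_eq] with ξ h1 h2
    rw [h1, h2]
    simp only [RCLike.inner_apply, map_mul, map_ofNat, Complex.conj_ofReal, Complex.conj_I]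
    ring
  exact_mod_cast h

theorem IsWeakDeriv.inner_self {f f' : LTwo} (hf : IsWeakDeriv 1 f f') :
    inner ℝ f f' = (0 : ℝ) := by
  have := hf.inner_eq_neg hf
  rw [real_inner_comm] at this
  rw [real_inner_comm]
  linarith

theorem IsWeakDeriv.norm_sq_le {f g h : LTwo} (hf : IsWeakDeriv 1 f g)
    (hg : IsWeakDeriv 1 g h) : ‖g‖ ^ 2 ≤ ‖f‖ * ‖h‖ := by
  rw [← real_inner_self_eq_norm_sq]
  have := hf.inner_eq_neg hg
  have h2 := abs_real_inner_le_norm f h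
  rw [this, abs_neg] at h2
  exact (le_abs_self _).trans h2

theorem exists_rpow_le {r δ : ℝ} (h0 : 0 ≤ r) (h1 : r < 1) (hδ : 0 < δ) :
    ∃ C, 0 ≤ C ∧ ∀ y : ℝ, 1 ≤ y → y ^ r ≤ δ * y + C := by
  obtain ⟨R, hR⟩ := eventually_atTop.1
    ((tendsto_rpow_neg_atTop (sub_pos.2 h1)).eventually_le_const hδ)
  refine ⟨max R 1 ^ r, by positivity, fun y hy => ?_⟩
  rcases le_total R y with hRy | hRy
  · have h3 : y ^ r ≤ δ * y := by
      calc y ^ r = y ^ (-(1 - r)) * y := by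
            rw [← Real.rpow_add_one (by positivity)]
            ring_nf
        _ ≤ δ * y := by
            gcongr
            exact hR y hRy
    have : 0 ≤ max R 1 ^ r := by positivity
    linarith
  · have : y ^ r ≤ max R 1 ^ r :=
      Real.rpow_le_rpow (by positivity) (hRy.trans (le_max_left _ _)) h0
    have : 0 ≤ δ * y := by positivity
    linarith

/-- Interpolation of `H^s`, `0 ≤ s < 2`, between `L²` and `H²`. -/
theorem exists_hsENorm_le {s δ : ℝ} (h0 : 0 ≤ s) (h2 : s < 2) (hδ : 0 < δ) :
    ∃ C, 0 ≤ C ∧ ∀ f g h : LTwo, IsWeakDeriv 1 f g → IsWeakDeriv 1 g h →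
      hsENorm s f ≤ ENNReal.ofReal (δ * ‖h‖ + C * ‖f‖) := by
  obtain ⟨C, hC0, hC⟩ := exists_rpow_le (r := s / 2) (δ := δ) (by linarith) (by linarith) hδ
  refine ⟨δ + C, by positivity, fun f g h hf hg => ?_⟩
  set F : Lp ℂ 2 (volume : Measure ℝ) := FourierTransform.fourier (toComplexLTwo f) with hF
  set H : Lp ℂ 2 (volume : Measure ℝ) := FourierTransform.fourier (toComplexLTwo h) with hH
  have nF : ‖F‖ = ‖f‖ := by rw [hF, Lp.norm_fourier_eq, norm_toComplexLTwo]
  have nH : ‖H‖ = ‖h‖ := by rw [hH, Lp.norm_fourier_eq, norm_toComplexLTwo]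
  have hb : ∀ᵐ ξ : ℝ, ‖(1 + ξ ^ 2) ^ (s / 2) • F ξ‖ ≤ ‖δ * ‖H ξ‖ + (δ + C) * ‖F ξ‖‖ := by
    filter_upwards [hf.fourier_eq, hg.fourier_eq] with ξ e1 e2
    rw [Real.norm_of_nonneg (by positivity), norm_smul, Real.norm_of_nonneg (by positivity)]
    have hH' : ‖H ξ‖ = (4 * Real.pi ^ 2) * ξ ^ 2 * ‖F ξ‖ := by
      rw [e2, e1]
      simp only [norm_mul, Complex.norm_I, Complex.norm_real, Complex.norm_ofNat, mul_one,
        Real.norm_eq_abs, abs_of_pos Real.pi_pos]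
      rw [← sq_abs ξ]
      ring
    have hpi : ξ ^ 2 * ‖F ξ‖ ≤ ‖H ξ‖ := by
      rw [hH']
      have : 1 ≤ 4 * Real.pi ^ 2 := by nlinarith [Real.pi_gt_three]
      calc ξ ^ 2 * ‖F ξ‖ = 1 * ξ ^ 2 * ‖F ξ‖ := by ring
        _ ≤ _ := by gcongr
    calc (1 + ξ ^ 2) ^ (s / 2) * ‖F ξ‖ ≤ (δ * (1 + ξ ^ 2) + C) * ‖F ξ‖ := by
          gcongr
          exact hC _ (by nlinarith [sq_nonneg ξ])
      _ = δ * (ξ ^ 2 * ‖F ξ‖) + (δ + C) * ‖F ξ‖ := by ring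
      _ ≤ _ := by gcongr
  have aF : AEStronglyMeasurable (fun ξ => ‖F ξ‖) volume := (Lp.aestronglyMeasurable F).norm
  have aH : AEStronglyMeasurable (fun ξ => ‖H ξ‖) volume := (Lp.aestronglyMeasurable H).norm
  have nF' : eLpNorm (fun ξ => ‖F ξ‖) 2 volume = ENNReal.ofReal ‖f‖ := by
    rw [eLpNorm_norm, ← nF, Lp.norm_def, ENNReal.ofReal_toReal (Lp.eLpNorm_ne_top F)]
  have nH' : eLpNorm (fun ξ => ‖H ξ‖) 2 volume = ENNReal.ofReal ‖h‖ := by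
    rw [eLpNorm_norm, ← nH, Lp.norm_def, ENNReal.ofReal_toReal (Lp.eLpNorm_ne_top H)]
  calc hsENorm s f ≤ eLpNorm (fun ξ => δ * ‖H ξ‖ + (δ + C) * ‖F ξ‖) 2 volume :=
        eLpNorm_mono_ae hb
    _ ≤ eLpNorm (fun ξ => δ * ‖H ξ‖) 2 volume + eLpNorm (fun ξ => (δ + C) * ‖F ξ‖) 2 volume :=
        eLpNorm_add_le (aH.const_mul _) (aF.const_mul _) one_le_two
    _ = ENNReal.ofReal (δ * ‖h‖ + (δ + C) * ‖f‖) := by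
        have e1 : (fun ξ => δ * ‖H ξ‖) = δ • fun ξ => ‖H ξ‖ := rfl
        have e2 : (fun ξ => (δ + C) * ‖F ξ‖) = (δ + C) • fun ξ => ‖F ξ‖ := rfl
        rw [e1, e2, eLpNorm_const_smul, eLpNorm_const_smul, nF', nH',
          ENNReal.ofReal_add (by positivity) (by positivity),
          ENNReal.ofReal_mul hδ.le, ENNReal.ofReal_mul (by positivity),
          Real.enorm_of_nonneg hδ.le, Real.enorm_of_nonneg (by positivity)]

/-! ### Translates of a kernel -/

/-- The translate `x ↦ k (x - s)` as a bounded continuous function. -/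
noncomputable def shiftB {k : ℝ → ℝ} (hk : Continuous k) (hc : HasCompactSupport k) (s : ℝ) :
    ℝ →ᵇ ℝ :=
  BoundedContinuousFunction.ofNormedAddCommGroup (fun x => k (x - s))
    (hk.comp (continuous_id.sub continuous_const))
    (hc.exists_bound_of_continuous hk).choose
    (fun x => (hc.exists_bound_of_continuous hk).choose_spec (x - s))

theorem shiftB_apply {k : ℝ → ℝ} (hk : Continuous k) (hc : HasCompactSupport k) (s x : ℝ) :
    shiftB hk hc s x = k (x - s) := rfl

theorem abs_taylor_le {k : ℝ → ℝ} (hk : ContDiff ℝ ∞ k) {C : ℝ}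
    (hC : ∀ x, ‖deriv (deriv k) x‖ ≤ C) (y h : ℝ) :
    |k (y - h) - k y + h * deriv k y| ≤ C * h ^ 2 := by
  have hk1 : ∀ z, HasDerivAt k (deriv k z) z := fun z =>
    ((hk.differentiable (by simp)).differentiableAt).hasDerivAt
  have hlip : ∀ z w, |deriv k z - deriv k w| ≤ C * |z - w| := fun z w =>
    Convex.norm_image_sub_le_of_norm_deriv_le (s := univ)
      (fun x _ => ((contDiff_deriv_top hk).differentiable (by simp)).differentiableAt)
      (fun x _ => hC x) convex_univ (mem_univ w) (mem_univ z)
  have hC0 : 0 ≤ C := (norm_nonneg _).trans (hC 0)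
  have hφ : ∀ τ ∈ uIcc 0 h, HasDerivWithinAt (fun τ => k (y - τ) + τ * deriv k y)
      (deriv k y - deriv k (y - τ)) (uIcc 0 h) τ := by
    intro τ _
    have h1 : HasDerivAt (fun τ => k (y - τ)) (-deriv k (y - τ)) τ := by
      have := (hk1 (y - τ)).comp τ ((hasDerivAt_id τ).const_sub y)
      exact this.congr_deriv (by simp)
    have h2 : HasDerivAt (fun τ => τ * deriv k y) (deriv k y) τ := by
      simpa using (hasDerivAt_id τ).mul_const (deriv k y)
    refine ((h1.add h2).congr_deriv ?_).hasDerivWithinAt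
    ring
  have hb : ∀ τ ∈ uIcc 0 h, ‖deriv k y - deriv k (y - τ)‖ ≤ C * |h| := by
    intro τ hτ
    refine (hlip _ _).trans (mul_le_mul_of_nonneg_left ?_ hC0)
    have := abs_sub_left_of_mem_uIcc hτ
    simpa using this
  have := (convex_uIcc 0 h).norm_image_sub_le_of_norm_hasDerivWithin_le hφ hb
    left_mem_uIcc right_mem_uIcc
  simp only [sub_zero, zero_mul, add_zero, Real.norm_eq_abs] at this
  calc |k (y - h) - k y + h * deriv k y| = |k (y - h) + h * deriv k y - k y| := by ring_nf
    _ ≤ C * |h| * |h| := this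
    _ = C * h ^ 2 := by rw [mul_assoc, abs_mul_abs_self, sq]

theorem hasDerivAt_shiftB {k : ℝ → ℝ} (hk : ContDiff ℝ ∞ k) (hc : HasCompactSupport k) (s : ℝ) :
    HasDerivAt (shiftB hk.continuous hc)
      (-shiftB (contDiff_deriv_top hk).continuous hc.deriv s) s := by
  obtain ⟨C, hC⟩ := hc.deriv.deriv.exists_bound_of_continuous
    (contDiff_deriv_top (contDiff_deriv_top hk)).continuous
  have hC0 : 0 ≤ C := (norm_nonneg _).trans (hC 0)
  rw [hasDerivAt_iff_isLittleO_nhds_zero]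
  have h1 : (fun h : ℝ => shiftB hk.continuous hc (s + h) - shiftB hk.continuous hc s -
      h • -shiftB (contDiff_deriv_top hk).continuous hc.deriv s) =O[𝓝 0] fun h => h ^ 2 := by
    refine Asymptotics.IsBigO.of_bound C (Eventually.of_forall fun h => ?_)
    rw [Real.norm_of_nonneg (sq_nonneg h)]
    refine (BoundedContinuousFunction.norm_le (by positivity)).2 fun x => ?_
    have := abs_taylor_le hk hC (x - s) h
    simp only [BoundedContinuousFunction.sub_apply, BoundedContinuousFunction.smul_apply,
      BoundedContinuousFunction.neg_apply, shiftB_apply, smul_eq_mul, mul_neg, sub_neg_eq_add,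
      Real.norm_eq_abs]
    rwa [← sub_sub]
  exact h1.trans_isLittleO (Asymptotics.isLittleO_pow_id one_lt_two)

theorem isEvenBump_mollifier {θ : ℝ → ℝ} (h : IsEvenBump θ) {ε : ℝ} (hε : 0 < ε) :
    IsEvenBump (mollifier θ ε) where
  smooth := contDiff_const.mul (h.smooth.comp (contDiff_id.div_const ε))
  compact := by
    have : HasCompactSupport fun x => θ (x * ε⁻¹) :=
      h.compact.comp_homeomorph (Homeomorph.mulRight₀ ε⁻¹ (inv_pos.2 hε).ne')
    exact this.mul_left
  nonneg := fun x => mul_nonneg (by positivity) (h.nonneg _)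
  even := fun x => by simp [mollifier, neg_div, h.even]
  integral_eq_one := by
    simp only [mollifier]
    rw [integral_const_mul, Measure.integral_comp_div, h.integral_eq_one, abs_of_pos hε]
    simp [hε.ne']

/-! ### Sobolev functions -/

/-- The weak derivative of order `j` as a continuous linear map on `H^m`. -/
noncomputable def dxL {m : ℕ} (j : Fin (m + 1)) : SobolevH m →L[ℝ] LTwo :=
  (PiLp.proj 2 (fun _ : Fin (m + 1) => LTwo) j).comp (SobolevH m).subtypeL

theorem isWeakDeriv_dx {m : ℕ} (j : Fin (m + 1)) (u : SobolevH m) :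
    IsWeakDeriv j (dx 0 u) (dx j u) := u.2 j

theorem isWeakDeriv_dx_succ {m : ℕ} (i : Fin m) (u : SobolevH m) :
    IsWeakDeriv 1 (dx i.castSucc u) (dx i.succ u) :=
  IsWeakDeriv.of_succ (j := i) (isWeakDeriv_dx i.castSucc u)
    (by simpa using isWeakDeriv_dx i.succ u)

theorem norm_dx_le {m : ℕ} (j : Fin (m + 1)) (u : SobolevH m) : ‖dx j u‖ ≤ ‖u‖ :=
  PiLp.norm_apply_le (u : PiLp 2 (fun _ : Fin (m + 1) => LTwo)) j

/-- The first and second time derivatives of a curve in `E₀(T)`, together with the time derivatives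
of its space derivatives. -/
theorem MemEZero.exists_deriv {T : ℝ} (hT : 0 < T) {U : ℝ → SobolevH 4} (h : MemEZero T U) :
    ContinuousOn (fun t => dt T 1 U t) (Icc 0 T) ∧
    ∃ V' : ℝ → SobolevH 2, ∀ t ∈ Icc 0 T, dx 0 (V' t) = dt T 1 U t ∧
      HasDerivWithinAt (fun t => dx 0 (U t)) (dt T 1 U t) (Icc 0 T) t ∧
      HasDerivWithinAt (fun t => dt T 1 U t) (dt T 2 U t) (Icc 0 T) t ∧
      HasDerivWithinAt (fun t => dx 1 (U t)) (dx 1 (V' t)) (Icc 0 T) t ∧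
      HasDerivWithinAt (fun t => dx 2 (U t)) (dx 2 (V' t)) (Icc 0 T) t := by
  have hu : UniqueDiffOn ℝ (Icc 0 T) := uniqueDiffOn_Icc hT
  obtain ⟨-, ⟨V, hV, hVU⟩, hU2⟩ := h
  have e1 : ∀ t, dt T 1 U t = derivWithin (fun s => dx 0 (U s)) (Icc 0 T) t := fun t => by
    rw [dt, iteratedDerivWithin_one]
  have e2 : ∀ t, dt T 2 U t = derivWithin (fun s => dt T 1 U s) (Icc 0 T) t := fun t => by
    rw [dt, iteratedDerivWithin_succ]
    rfl
  have hd1 : ContDiffOn ℝ 1 (fun t => dt T 1 U t) (Icc 0 T) := by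
    simp only [e1]
    exact ((contDiffOn_succ_iff_derivWithin (n := 1) hu).1 hU2).2.2
  refine ⟨hd1.continuousOn, fun t => derivWithin V (Icc 0 T) t, fun t ht => ?_⟩
  have hVd : HasDerivWithinAt V (derivWithin V (Icc 0 T) t) (Icc 0 T) t :=
    ((hV.differentiableOn (by norm_num)) t ht).hasDerivWithinAt
  have hVj : ∀ j : Fin 3, HasDerivWithinAt (fun t => dx j (V t))
      (dx j (derivWithin V (Icc 0 T) t)) (Icc 0 T) t := fun j =>
    (dxL j).hasFDerivAt.comp_hasDerivWithinAt t hVd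
  have hUd : HasDerivWithinAt (fun t => dx 0 (U t)) (dt T 1 U t) (Icc 0 T) t := by
    rw [e1]
    exact ((hU2.differentiableOn (by norm_num)) t ht).hasDerivWithinAt
  refine ⟨?_, hUd, ?_, ?_, ?_⟩
  · have := ((hVj 0).congr (fun s hs => (hVU s hs).symm) (hVU t ht).symm)
    exact (hu t ht).eq_deriv _ this hUd
  · rw [e2]
    exact ((hd1.differentiableOn (by norm_num)) t ht).hasDerivWithinAt
  · have e : ∀ s ∈ Icc 0 T, dx 1 (U s) = dx 1 (V s) := fun s hs =>
      (isWeakDeriv_dx 1 (U s)).unique (by rw [← hVU s hs]; exact isWeakDeriv_dx 1 (V s))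
    exact (hVj 1).congr e (e t ht)
  · have e : ∀ s ∈ Icc 0 T, dx 2 (U s) = dx 2 (V s) := fun s hs =>
      (isWeakDeriv_dx 2 (U s)).unique (by rw [← hVU s hs]; exact isWeakDeriv_dx 2 (V s))
    exact (hVj 2).congr e (e t ht)

/-! ### The operators attached to a mollifier -/

namespace IsEvenBump

variable {κ : ℝ → ℝ}

/-- Multiplication by `κ (x - s)`. -/
noncomputable def mass (h : IsEvenBump κ) (s : ℝ) : LTwo →L[ℝ] LTwo := mulL (shiftB h.smooth.continuous h.compact s)

/-- Multiplication by `κ' (x - s)`. -/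
noncomputable def massDeriv (h : IsEvenBump κ) (s : ℝ) : LTwo →L[ℝ] LTwo :=
  mulL (shiftB (contDiff_deriv_top h.smooth).continuous h.compact.deriv s)

/-- Mollification, as a map into the bounded continuous functions. -/
noncomputable def mollB (h : IsEvenBump κ) : LTwo →L[ℝ] (ℝ →ᵇ ℝ) := convB h.smooth.continuous h.compact

/-- Mollification, as an operator on `L²`. -/
noncomputable def mollL (h : IsEvenBump κ) : LTwo →L[ℝ] LTwo := convL h.smooth.continuous h.compact

/-- The function `y ↦ κ (s - y)` in `L²`. -/
noncomputable def bumpAt (h : IsEvenBump κ) (s : ℝ) : LTwo := kernelAt h.smooth.continuous h.compact s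

theorem mollB_apply (h : IsEvenBump κ) (f : LTwo) (x : ℝ) : h.mollB f x = conv f κ x := rfl

theorem coeFn_mollL (h : IsEvenBump κ) (f : LTwo) : h.mollL f =ᵐ[volume] conv f κ := coeFn_convL _ _ f

theorem norm_mollL_le (h : IsEvenBump κ) (f : LTwo) : ‖h.mollL f‖ ≤ ‖f‖ := h.norm_convL_le f

theorem hasDerivAt_mass (h : IsEvenBump κ) (s : ℝ) : HasDerivAt h.mass (-h.massDeriv s) s := by
  have := (mulL : (ℝ →ᵇ ℝ) →L[ℝ] LTwo →L[ℝ] LTwo).hasFDerivAt.comp_hasDerivAt s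
    (hasDerivAt_shiftB h.smooth h.compact s)
  rw [map_neg] at this
  exact this

theorem mass_symm (h : IsEvenBump κ) (s : ℝ) (f g : LTwo) : inner ℝ (h.mass s f) g = inner ℝ (h.mass s g) f :=
  inner_mulL_comm _ f g

theorem mass_nonneg (h : IsEvenBump κ) (s : ℝ) (f : LTwo) : 0 ≤ inner ℝ (h.mass s f) f := by
  rw [mass, inner_mulL_left]
  refine integral_nonneg fun x => ?_
  simp only [shiftB_apply, Pi.zero_apply]
  rw [mul_assoc]
  exact mul_nonneg (h.nonneg _) (mul_self_nonneg _)

theorem integrable_shift (h : IsEvenBump κ) (s : ℝ) : Integrable fun x => κ (x - s) :=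
  (h.smooth.continuous.integrable_of_hasCompactSupport h.compact).comp_sub_right s

theorem integral_shift (h : IsEvenBump κ) (s : ℝ) : ∫ x, κ (x - s) = 1 := by
  rw [integral_sub_right_eq_self κ s, h.integral_eq_one]

theorem mass_self_le (h : IsEvenBump κ) {s C : ℝ} {f : LTwo} (hf : ∀ᵐ x : ℝ, f x ^ 2 ≤ C) :
    inner ℝ (h.mass s f) f ≤ C := by
  rw [mass, inner_mulL_left]
  calc ∫ x, shiftB h.smooth.continuous h.compact s x * f x * f x ≤ ∫ x, κ (x - s) * C := by
        refine integral_mono_of_nonneg (Eventually.of_forall fun x => ?_)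
          ((h.integrable_shift s).mul_const C) ?_
        · simp only [shiftB_apply, Pi.zero_apply]
          rw [mul_assoc]
          exact mul_nonneg (h.nonneg _) (mul_self_nonneg _)
        · filter_upwards [hf] with x hx
          rw [shiftB_apply, mul_assoc, ← sq]
          exact mul_le_mul_of_nonneg_left hx (h.nonneg _)
    _ = C := by rw [integral_mul_const, h.integral_shift, one_mul]

theorem abs_mass_le (h : IsEvenBump κ) (s : ℝ) (f g : LTwo) {c : ℝ} (hc : 0 < c) :
    |inner ℝ (h.mass s f) g| ≤ c * inner ℝ (h.mass s f) f + inner ℝ (h.mass s g) g / (4 * c) := by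
  have key : ∀ r : ℝ, 0 ≤ inner ℝ (h.mass s f) f - 2 * r * inner ℝ (h.mass s f) g
      + r ^ 2 * inner ℝ (h.mass s g) g := by
    intro r
    have := h.mass_nonneg s (f - r • g)
    simp only [map_sub, map_smul, inner_sub_left, inner_sub_right, inner_smul_left,
      inner_smul_right, RCLike.conj_to_real] at this
    rw [h.mass_symm s g f] at this
    linarith
  have k1 := key (1 / (2 * c))
  have k2 := key (-(1 / (2 * c)))
  rw [abs_le]
  constructor
  · have : 0 ≤ c * (inner ℝ (h.mass s f) f - 2 * -(1 / (2 * c)) * inner ℝ (h.mass s f) g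
      + (-(1 / (2 * c))) ^ 2 * inner ℝ (h.mass s g) g) := mul_nonneg hc.le k2
    field_simp at this ⊢
    linarith
  · have : 0 ≤ c * (inner ℝ (h.mass s f) f - 2 * (1 / (2 * c)) * inner ℝ (h.mass s f) g
      + (1 / (2 * c)) ^ 2 * inner ℝ (h.mass s g) g) := mul_nonneg hc.le k1
    field_simp at this ⊢
    linarith

theorem abs_inner_bumpAt_le (h : IsEvenBump κ) (s : ℝ) (f : LTwo) :
    |inner ℝ (h.bumpAt s) f| ≤ (1 + inner ℝ (h.mass s f) f) / 2 := by
  have hi : Integrable fun x => κ (x - s) * f x * f x := by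
    refine (LTwo.integrable_mul (h.mass s f) f).congr ?_
    filter_upwards [coeFn_mulL (shiftB h.smooth.continuous h.compact s) f] with x hx
    rw [mass, hx, shiftB_apply]
  have e : inner ℝ (h.bumpAt s) f = ∫ x, κ (x - s) * f x := by
    rw [inner_eq_integral]
    refine integral_congr_ae ?_
    filter_upwards [coeFn_kernelAt h.smooth.continuous h.compact s] with x hx
    rw [bumpAt, hx, ← h.even, neg_sub]
  rw [e, mass, inner_mulL_left, ← h.integral_shift s]
  calc |∫ x, κ (x - s) * f x| ≤ ∫ x, (κ (x - s) + κ (x - s) * f x * f x) / 2 := by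
        refine norm_integral_le_of_norm_le (f := fun x => κ (x - s) * f x)
          (((h.integrable_shift s).add hi).div_const 2) (Eventually.of_forall fun x => ?_)
        rw [norm_mul, Real.norm_of_nonneg (h.nonneg _), Real.norm_eq_abs]
        have := mul_nonneg (h.nonneg (x - s)) (sq_nonneg (|f x| - 1))
        rw [sub_sq, sq_abs] at this
        linarith
    _ = _ := by
        rw [integral_div, integral_add (h.integrable_shift s) hi]
        rfl

theorem isWeakDeriv_mass (h : IsEvenBump κ) {f f' : LTwo} (hf : IsWeakDeriv 1 f f') (s : ℝ) :
    IsWeakDeriv 1 (h.mass s f) (h.massDeriv s f + h.mass s f') := by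
  refine hf.mul_smooth (h.smooth.comp (contDiff_id.sub contDiff_const)) fun x => ?_
  have h1 : HasDerivAt κ (deriv κ (x - s)) (x - s) :=
    ((h.smooth.differentiable (by simp)).differentiableAt).hasDerivAt
  exact (h1.comp x ((hasDerivAt_id x).sub_const s)).congr_deriv (by simp [shiftB_apply])

theorem two_mul_inner_mass_deriv (h : IsEvenBump κ) {f f' : LTwo} (hf : IsWeakDeriv 1 f f') (s : ℝ) :
    2 * inner ℝ (h.mass s f) f' = -inner ℝ (h.massDeriv s f) f := by
  have h1 := (h.isWeakDeriv_mass hf s).inner_eq_neg hf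
  rw [inner_add_left, h.mass_symm s f' f] at h1
  linarith

theorem mollL_symm (h : IsEvenBump κ) (f g : LTwo) : inner ℝ (h.mollL f) g = inner ℝ f (h.mollL g) :=
  inner_convL_comm _ _ h.even f g

theorem integrable_moll_mul (h : IsEvenBump κ) (φ : ℝ →ᵇ ℝ) (f g : LTwo) :
    Integrable fun x => φ x * conv f κ x * conv g κ x := by
  refine (LTwo.integrable_mul (mulL φ (h.mollL f)) (h.mollL g)).congr ?_
  filter_upwards [coeFn_mulL φ (h.mollL f), h.coeFn_mollL f, h.coeFn_mollL g] with x h1 h2 h3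
  rw [h1, h2, h3]

theorem inner_mulL_moll (h : IsEvenBump κ) (φ : ℝ →ᵇ ℝ) (f g : LTwo) :
    inner ℝ (mulL φ (h.mollL f)) (h.mollL g) = ∫ x, φ x * conv f κ x * conv g κ x := by
  rw [inner_mulL_left]
  refine integral_congr_ae ?_
  filter_upwards [h.coeFn_mollL f, h.coeFn_mollL g] with x h2 h3
  rw [h2, h3]

theorem integral_conv_pow_three_mul (h : IsEvenBump κ) {b c v w : LTwo} (hb : IsWeakDeriv 1 b c)
    (hv : IsWeakDeriv 1 v w) :
    ∫ x, conv b κ x ^ 3 * conv w κ x = -(3 * ∫ x, conv b κ x ^ 2 * conv c κ x * conv v κ x) := by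
  rw [integral_mul_deriv_eq_deriv_mul_of_integrable (u := fun x => conv b κ x ^ 3)
    (v := fun x => conv v κ x) (u' := fun x => 3 * conv b κ x ^ 2 * conv c κ x)
    (fun x _ => by
      exact ((hb.hasDerivAt_convolve h.smooth h.compact x).pow 3).congr_deriv (by simp))
    (fun x _ => hv.hasDerivAt_convolve h.smooth h.compact x)]
  · rw [← integral_const_mul]
    congr 1
    refine integral_congr_ae (Eventually.of_forall fun x => ?_)
    simp only
    ring
  · refine (h.integrable_moll_mul (h.mollB b * h.mollB b) b w).congr
      (Eventually.of_forall fun x => ?_)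
    simp only [BoundedContinuousFunction.mul_apply, mollB_apply, Pi.mul_apply]
    ring
  · refine (h.integrable_moll_mul (3 * (h.mollB b * h.mollB b)) c v).congr
      (Eventually.of_forall fun x => ?_)
    simp only [BoundedContinuousFunction.mul_apply, mollB_apply, Pi.mul_apply]
    change 3 * _ * _ * _ = _
    ring
  · refine (h.integrable_moll_mul (h.mollB b * h.mollB b) b v).congr
      (Eventually.of_forall fun x => ?_)
    simp only [BoundedContinuousFunction.mul_apply, mollB_apply, Pi.mul_apply]
    ring

theorem integral_conv_pow_three_mul_deriv (h : IsEvenBump κ) {b c : LTwo} (hb : IsWeakDeriv 1 b c) :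
    ∫ x, conv b κ x ^ 3 * conv c κ x = 0 := by
  have := h.integral_conv_pow_three_mul hb hb
  have e : ∫ x, conv b κ x ^ 2 * conv c κ x * conv b κ x = ∫ x, conv b κ x ^ 3 * conv c κ x := by
    refine integral_congr_ae (Eventually.of_forall fun x => ?_)
    simp only
    ring
  rw [e] at this
  linarith

/-- The nonlinear term before the outer mollification. -/
noncomputable def nonlin (h : IsEvenBump κ) (ν : ℝ) (p b c : LTwo) : LTwo :=
  mulL (h.mollB c) (mulL (h.mollB b) (h.mollL b) - ν • p)

theorem conv_nonlin (h : IsEvenBump κ) (ν : ℝ) (p : LTwo) {a b c : LTwo} (hb : IsWeakDeriv 1 a b)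
    (hc : IsWeakDeriv 1 b c) :
    conv (h.nonlin ν p b c) κ = conv (fun y => (conv a (deriv κ) y ^ 2 - ν * p y) *
      conv a (iteratedDeriv 2 κ) y) κ := by
  refine conv_congr_ae ?_ κ
  have e1 : conv a (deriv κ) = conv b κ := (hb.conv_eq h.smooth h.compact).symm
  have e2 : conv a (iteratedDeriv 2 κ) = conv c κ := by
    rw [hc.conv_eq h.smooth h.compact,
      hb.conv_eq (contDiff_deriv_top h.smooth) h.compact.deriv, iteratedDeriv_succ,
      iteratedDeriv_one]
  filter_upwards [coeFn_mulL (h.mollB c) (mulL (h.mollB b) (h.mollL b) - ν • p),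
    coeFn_mulL (h.mollB b) (h.mollL b), h.coeFn_mollL b, Lp.coeFn_smul ν p,
    Lp.coeFn_sub (mulL (h.mollB b) (h.mollL b)) (ν • p)] with x h1 h2 h3 h4 h5
  rw [nonlin, h1, h5, Pi.sub_apply, h2, h3, h4, Pi.smul_apply, e1, e2, mollB_apply, mollB_apply,
    smul_eq_mul]
  ring

theorem inner_mollL_nonlin (h : IsEvenBump κ) (ν : ℝ) (p : LTwo) {b c v w : LTwo} (hb : IsWeakDeriv 1 b c)
    (hv : IsWeakDeriv 1 v w) (z : ℝ) :
    inner ℝ (h.mollL (h.nonlin ν p b c)) (v + z • b)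
      = -(∫ x, conv b κ x ^ 3 * conv w κ x) / 3
        - ν * inner ℝ (mulL (h.mollB c) p) (h.mollL (v + z • b)) := by
  have e : ∀ f : LTwo, inner ℝ (mulL (h.mollB c) (mulL (h.mollB b) (h.mollL b))) (h.mollL f)
      = ∫ x, conv b κ x ^ 2 * conv c κ x * conv f κ x := by
    intro f
    rw [mulL_mulL, h.inner_mulL_moll]
    refine integral_congr_ae (Eventually.of_forall fun x => ?_)
    simp only [BoundedContinuousFunction.mul_apply, mollB_apply]
    ring
  have e3 : ∫ x, conv b κ x ^ 2 * conv c κ x * conv b κ x = 0 := by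
    rw [← h.integral_conv_pow_three_mul_deriv hb]
    refine integral_congr_ae (Eventually.of_forall fun x => ?_)
    simp only
    ring
  rw [h.mollL_symm, nonlin, map_sub, inner_sub_left, map_add, inner_add_right, e, map_smul,
    inner_smul_right, e, e3, h.integral_conv_pow_three_mul hb hv, (mulL (h.mollB c)).map_smul,
    inner_smul_left]
  simp only [RCLike.conj_to_real]
  ring

theorem abs_inner_mulL_moll_le (h : IsEvenBump κ) {p : LTwo} {Pb : ℝ} (hp : ∀ᵐ x : ℝ, |p x| ≤ Pb) (c w : LTwo) :
    |inner ℝ (mulL (h.mollB c) p) (h.mollL w)| ≤ Pb * ‖c‖ * ‖w‖ := by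
  have hPb : 0 ≤ Pb := by
    obtain ⟨x, hx⟩ := hp.exists
    exact (abs_nonneg _).trans hx
  have h1 : ‖mulL (h.mollB c) p‖ ≤ Pb * ‖h.mollL c‖ := by
    refine Lp.norm_le_mul_norm_of_ae_le_mul ?_
    filter_upwards [coeFn_mulL (h.mollB c) p, h.coeFn_mollL c, hp] with x h1 h2 h3
    rw [h1, h2, norm_mul, mollB_apply, mul_comm]
    gcongr
    exact h3
  refine (abs_real_inner_le_norm _ _).trans ?_
  gcongr
  · exact h1.trans (by gcongr; exact h.norm_mollL_le c)
  · exact h.norm_mollL_le w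

/-- `∂ₓu ⋆ κ` squared. -/
noncomputable def sqMoll (h : IsEvenBump κ) (b : LTwo) : LTwo := mulL (h.mollB b) (h.mollL b)

theorem norm_sqMoll_sq_le (h : IsEvenBump κ) {b c : LTwo} (hb : IsWeakDeriv 1 b c) :
    ‖h.sqMoll b‖ ^ 2 ≤ 2 * (‖b‖ * ‖c‖) * ‖b‖ ^ 2 := by
  have h1 : ‖h.mollB b‖ ≤ √(2 * (‖b‖ * ‖c‖)) := by
    refine (BoundedContinuousFunction.norm_le (by positivity)).2 fun x => ?_
    exact Real.abs_le_sqrt (hb.sq_conv_le h x)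
  calc ‖h.sqMoll b‖ ^ 2 ≤ (√(2 * (‖b‖ * ‖c‖)) * ‖b‖) ^ 2 := by
        gcongr
        exact (norm_mulL_le _ _).trans (by gcongr; exact h.norm_mollL_le b)
    _ = _ := by rw [mul_pow, Real.sq_sqrt (by positivity)]

theorem inner_sqMoll_deriv (h : IsEvenBump κ) (b w : LTwo) :
    inner ℝ (h.sqMoll b) (mulL (h.mollB w) (h.mollL b) + mulL (h.mollB b) (h.mollL w))
      = 2 * ∫ x, conv b κ x ^ 3 * conv w κ x := by
  have e1 : inner ℝ (h.sqMoll b) (mulL (h.mollB w) (h.mollL b))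
      = ∫ x, conv b κ x ^ 3 * conv w κ x := by
    rw [real_inner_comm, inner_mulL_left]
    refine integral_congr_ae ?_
    filter_upwards [coeFn_mulL (h.mollB b) (h.mollL b), h.coeFn_mollL b] with x h1 h2
    rw [sqMoll, h1, h2, mollB_apply, mollB_apply]
    ring
  have e2 : inner ℝ (h.sqMoll b) (mulL (h.mollB b) (h.mollL w))
      = ∫ x, conv b κ x ^ 3 * conv w κ x := by
    rw [real_inner_comm, inner_mulL_left]
    refine integral_congr_ae ?_
    filter_upwards [coeFn_mulL (h.mollB b) (h.mollL b), h.coeFn_mollL b,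
      h.coeFn_mollL w] with x h1 h2 h3
    rw [sqMoll, h1, h2, h3, mollB_apply]
    ring
  rw [inner_add_right, e1, e2]
  ring

end IsEvenBump

/-! ### The energy identity -/

namespace IsEvenBump

variable {κ : ℝ → ℝ}

/-- The modified energy of a state with velocity `v`, slope `b` and curvature `c`, when the moving
mass is at `s` with speed `z`. -/
noncomputable def energy (h : IsEvenBump κ) (v b c : LTwo) (s z : ℝ) : ℝ :=
  ‖v‖ ^ 2 / 2 + inner ℝ (h.mass s v) v / 2 + ‖c‖ ^ 2 / 2 + ‖h.sqMoll b‖ ^ 2 / 12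
    + z * (inner ℝ v b + inner ℝ (h.mass s v) b)

theorem hasDerivWithinAt_energy (h : IsEvenBump κ) {S : Set ℝ} {t : ℝ} {v b c : ℝ → LTwo}
    {v' b' c' : LTwo} {s z : ℝ → ℝ} {z' : ℝ}
    (hv : HasDerivWithinAt v v' S t) (hb : HasDerivWithinAt b b' S t)
    (hc : HasDerivWithinAt c c' S t) (hs : HasDerivWithinAt s (z t) S t)
    (hz : HasDerivWithinAt z z' S t) :
    HasDerivWithinAt (fun t => h.energy (v t) (b t) (c t) (s t) (z t))
      (inner ℝ v' (v t)
        + (inner ℝ (h.mass (s t) v') (v t)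
          - z t * inner ℝ (h.massDeriv (s t) (v t)) (v t) / 2)
        + inner ℝ c' (c t) + (∫ x, conv (b t) κ x ^ 3 * conv b' κ x) / 3
        + (z' * (inner ℝ (v t) (b t) + inner ℝ (h.mass (s t) (v t)) (b t))
          + z t * (inner ℝ v' (b t) + inner ℝ (v t) b' + inner ℝ (h.mass (s t) v') (b t)
            - z t * inner ℝ (h.massDeriv (s t) (v t)) (b t)
            + inner ℝ (h.mass (s t) (v t)) b'))) S t := by
  have hM : HasDerivWithinAt (fun t => h.mass (s t)) (z t • -h.massDeriv (s t)) S t :=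
    (h.hasDerivAt_mass (s t)).scomp_hasDerivWithinAt t hs
  have hMv := hM.clm_apply hv
  have hQ : HasDerivWithinAt (fun t => h.sqMoll (b t))
      (mulL (h.mollB b') (h.mollL (b t)) + mulL (h.mollB (b t)) (h.mollL b')) S t := by
    have h1 : HasDerivWithinAt (fun t => mulL (h.mollB (b t))) (mulL (h.mollB b')) S t :=
      (mulL.comp h.mollB).hasFDerivAt.comp_hasDerivWithinAt t hb
    exact h1.clm_apply (h.mollL.hasFDerivAt.comp_hasDerivWithinAt t hb)
  have key := ((((hv.norm_sq.div_const 2).add ((hMv.inner ℝ hv).div_const 2)).add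
    (hc.norm_sq.div_const 2)).add (hQ.norm_sq.div_const 12)).add
    (hz.mul ((hv.inner ℝ hb).add (hMv.inner ℝ hb)))
  refine key.congr_deriv ?_
  rw [h.inner_sqMoll_deriv]
  simp only [inner_add_left, smul_apply, neg_apply, Pi.add_apply,
    inner_smul_left, inner_neg_left, RCLike.conj_to_real]
  rw [real_inner_comm v' (v t), real_inner_comm c' (c t), h.mass_symm (s t) (v t) v']
  ring

theorem energy_deriv_eq (h : IsEvenBump κ) {v v' b c d₃ d₄ b' c' F p : LTwo} {s z z' ν P : ℝ}
    (hbc : IsWeakDeriv 1 b c) (hc₃ : IsWeakDeriv 1 c d₃) (h₃₄ : IsWeakDeriv 1 d₃ d₄)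
    (hvb : IsWeakDeriv 1 v b') (hbc' : IsWeakDeriv 1 b' c')
    (heq : v' + (h.mass s v' - z • h.massDeriv s v) + d₄ - h.mollL (h.nonlin ν p b c)
      - (F + P • h.bumpAt s) = 0) :
    inner ℝ v' v + (inner ℝ (h.mass s v') v - z * inner ℝ (h.massDeriv s v) v / 2)
        + inner ℝ c' c + (∫ x, conv b κ x ^ 3 * conv b' κ x) / 3
        + (z' * (inner ℝ v b + inner ℝ (h.mass s v) b)
          + z * (inner ℝ v' b + inner ℝ v b' + inner ℝ (h.mass s v') b
            - z * inner ℝ (h.massDeriv s v) b + inner ℝ (h.mass s v) b'))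
      = -ν * inner ℝ (mulL (h.mollB c) p) (h.mollL (v + z • b)) + inner ℝ F (v + z • b)
        + P * inner ℝ (h.bumpAt s) (v + z • b)
        + z' * (inner ℝ v b + inner ℝ (h.mass s v) b) := by
  have e1 : inner ℝ c' c = inner ℝ d₄ v := by
    have h1 := hbc'.inner_eq_neg hc₃
    have h2 := hvb.inner_eq_neg h₃₄
    rw [real_inner_comm d₄ v] at h2
    linarith
  have e2 : inner ℝ v b' = (0 : ℝ) := hvb.inner_self
  have e3 := h.two_mul_inner_mass_deriv hvb s
  have e4 : inner ℝ d₄ b = (0 : ℝ) := by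
    have h1 := hbc.inner_eq_neg h₃₄
    have h2 := hc₃.inner_self
    rw [real_inner_comm, h1, h2, neg_zero]
  have e5 := h.inner_mollL_nonlin ν p hbc hvb z
  have e6 : inner ℝ (v' + (h.mass s v' - z • h.massDeriv s v) + d₄ - h.mollL (h.nonlin ν p b c)
      - (F + P • h.bumpAt s)) (v + z • b) = (0 : ℝ) := by
    rw [heq, inner_zero_left]
  rw [inner_sub_left, inner_sub_left, e5] at e6
  simp only [inner_add_left, inner_sub_left, inner_add_right, inner_smul_left, inner_smul_right,
    RCLike.conj_to_real, map_add, map_smul] at e6 ⊢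
  linear_combination e6 + e1 + z * e2 + z / 2 * e3 - z * e4

end IsEvenBump

/-- The equation of the mollified problem as an identity in `L²`. -/
theorem IsMollifiedSolution.equation_lTwo {T ν : ℝ} {ζ P θ : ℝ → ℝ} {f p : ℝ → SobolevH 2}
    {u₀ : SobolevH 2} {u₁ : LTwo} {ε : ℝ} {U : ℝ → SobolevH 4}
    (hU : IsMollifiedSolution T ν ζ P θ f p u₀ u₁ ε U) (h : IsEvenBump (mollifier θ ε))
    {t : ℝ} (ht : t ∈ Icc 0 T) :
    dt T 2 U t + (h.mass (ζ t) (dt T 2 U t)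
        - derivWithin ζ (Icc 0 T) t • h.massDeriv (ζ t) (dt T 1 U t)) + dx 4 (U t)
      - h.mollL (h.nonlin ν (dx 0 (p t)) (dx 1 (U t)) (dx 2 (U t)))
      - (dx 0 (f t) + P t • h.bumpAt (ζ t)) = 0 := by
  set a2 := dt T 2 U t
  set a1 := dt T 1 U t
  set z := derivWithin ζ (Icc 0 T) t
  set N := h.nonlin ν (dx 0 (p t)) (dx 1 (U t)) (dx 2 (U t)) with hN
  have hn : conv N (mollifier θ ε) = nonlinearTerm θ ε ν (dx 0 (p t)) (dx 0 (U t)) :=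
    h.conv_nonlin ν (dx 0 (p t)) (isWeakDeriv_dx_succ 0 (U t)) (isWeakDeriv_dx_succ 1 (U t))
  have hev : ∀ x, mollifier θ ε (ζ t - x) = mollifier θ ε (x - ζ t) := fun x => by
    rw [← h.even, neg_sub]
  apply Lp.ext
  filter_upwards [hU.equation t ht,
    Lp.coeFn_sub (a2 + (h.mass (ζ t) a2 - z • h.massDeriv (ζ t) a1) + dx 4 (U t) - h.mollL N)
      (dx 0 (f t) + P t • h.bumpAt (ζ t)),
    Lp.coeFn_sub (a2 + (h.mass (ζ t) a2 - z • h.massDeriv (ζ t) a1) + dx 4 (U t)) (h.mollL N),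
    Lp.coeFn_add (a2 + (h.mass (ζ t) a2 - z • h.massDeriv (ζ t) a1)) (dx 4 (U t)),
    Lp.coeFn_add a2 (h.mass (ζ t) a2 - z • h.massDeriv (ζ t) a1),
    Lp.coeFn_sub (h.mass (ζ t) a2) (z • h.massDeriv (ζ t) a1),
    Lp.coeFn_smul z (h.massDeriv (ζ t) a1), Lp.coeFn_add (dx 0 (f t)) (P t • h.bumpAt (ζ t)),
    Lp.coeFn_smul (P t) (h.bumpAt (ζ t)),
    coeFn_mulL (shiftB h.smooth.continuous h.compact (ζ t)) a2,
    coeFn_mulL (shiftB (contDiff_deriv_top h.smooth).continuous h.compact.deriv (ζ t)) a1,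
    h.coeFn_mollL N, coeFn_kernelAt h.smooth.continuous h.compact (ζ t),
    Lp.coeFn_zero ℝ 2 (volume : Measure ℝ)] with x h0 h1 h2 h3 h4 h5 h6 h7 h8 h9 h10 h11 h12 h13
  rw [h13, h1, Pi.sub_apply, h2, Pi.sub_apply, h3, Pi.add_apply, h4, Pi.add_apply, h5,
    Pi.sub_apply, h6, Pi.smul_apply, h7, Pi.add_apply, h8, Pi.smul_apply, IsEvenBump.mass,
    IsEvenBump.massDeriv, h9, h10, h11, hn, IsEvenBump.bumpAt, h12, shiftB_apply, shiftB_apply,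
    Pi.zero_apply, smul_eq_mul, smul_eq_mul, hev]
  linear_combination h0

/-! ### The energy estimate -/

theorem le_exp_mul_of_deriv_le {T C : ℝ} {y y' : ℝ → ℝ} (hT : 0 ≤ T)
    (hy : ∀ t ∈ Icc 0 T, HasDerivWithinAt y (y' t) (Icc 0 T) t)
    (hle : ∀ t ∈ Icc 0 T, y' t ≤ C * y t) : ∀ t ∈ Icc 0 T, y t ≤ y 0 * Real.exp (C * t) := by
  have hd : ∀ t ∈ Icc 0 T, HasDerivWithinAt (fun t => Real.exp (-C * t) * y t)
      (Real.exp (-C * t) * (y' t - C * y t)) (Icc 0 T) t := by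
    intro t ht
    have h1 : HasDerivAt (fun t => Real.exp (-C * t)) (Real.exp (-C * t) * -C) t := by
      simpa using ((hasDerivAt_id t).const_mul (-C)).exp
    exact (h1.hasDerivWithinAt.mul (hy t ht)).congr_deriv (by ring)
  have hanti : AntitoneOn (fun t => Real.exp (-C * t) * y t) (Icc 0 T) := by
    refine antitoneOn_of_hasDerivWithinAt_nonpos (convex_Icc 0 T)
      (fun t ht => (hd t ht).continuousWithinAt)
      (fun t ht => (hd t (interior_subset ht)).mono interior_subset) fun t ht => ?_
    exact mul_nonpos_of_nonneg_of_nonpos (Real.exp_pos _).le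
      (sub_nonpos.2 (hle t (interior_subset ht)))
  intro t ht
  have h := hanti (left_mem_Icc.2 hT) ht ht.1
  simp only [mul_zero, Real.exp_zero, one_mul] at h
  calc y t = Real.exp (C * t) * (Real.exp (-C * t) * y t) := by
        rw [← mul_assoc, ← Real.exp_add]
        simp
    _ ≤ Real.exp (C * t) * y 0 := by gcongr
    _ = _ := mul_comm _ _

theorem energy_coercive {L X Y Z W B S I J Q z : ℝ} (hL : 1 ≤ L) (hz : |z| ≤ L) (hX : 0 ≤ X)
    (hB : 0 ≤ B) (hQ : 0 ≤ Q) (hBWZ : B ^ 2 ≤ W * Z)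
    (hS : S ≤ 2 * (B * Z)) (hJ : |J| ≤ X * B) (hI : |I| ≤ 1 / (4 * L) * Y + S / (4 * (1 / (4 * L)))) :
    (X ^ 2 + Y + Z ^ 2 + W ^ 2) / 4 ≤
      X ^ 2 / 2 + Y / 2 + Z ^ 2 / 2 + Q / 12 + z * (J + I)
        + (2 * (L ^ 2 + 8 * L ^ 4) ^ 2 + 1 / 4) * W ^ 2 := by
  have h0 : 0 < L := by linarith
  have h1 : |z * J| ≤ X ^ 2 / 4 + L ^ 2 * B ^ 2 := by
    rw [abs_mul]
    calc |z| * |J| ≤ L * (X * B) := by gcongr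
      _ ≤ _ := by nlinarith [sq_nonneg (X / 2 - L * B)]
  have h2 : |z * I| ≤ Y / 4 + L ^ 2 * S := by
    rw [abs_mul]
    calc |z| * |I| ≤ L * (1 / (4 * L) * Y + S / (4 * (1 / (4 * L)))) := by gcongr
      _ = _ := by field_simp
  have h3 : L ^ 2 * S ≤ Z ^ 2 / 8 + 8 * L ^ 4 * B ^ 2 := by
    calc L ^ 2 * S ≤ L ^ 2 * (2 * (B * Z)) := by gcongr
      _ ≤ _ := by nlinarith [sq_nonneg (Z - 8 * L ^ 2 * B)]
  have h4 : (L ^ 2 + 8 * L ^ 4) * B ^ 2 ≤ Z ^ 2 / 8 + 2 * (L ^ 2 + 8 * L ^ 4) ^ 2 * W ^ 2 := by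
    have : 0 ≤ L ^ 2 + 8 * L ^ 4 := by positivity
    calc (L ^ 2 + 8 * L ^ 4) * B ^ 2 ≤ (L ^ 2 + 8 * L ^ 4) * (W * Z) := by gcongr
      _ ≤ _ := by
        generalize L ^ 2 + 8 * L ^ 4 = M
        nlinarith [sq_nonneg (Z - 4 * M * W)]
  have h5 := neg_abs_le (z * J)
  have h6 := neg_abs_le (z * I)
  linarith

theorem production_le {X Y Z W B ν Pb Φ Pm P L L₂ z z' i₁ i₂ i₃ i₄ J I : ℝ}
    (hX0 : 0 ≤ X) (hB0 : 0 ≤ B) (hZ0 : 0 ≤ Z) (hW0 : 0 ≤ W) (hY : 0 ≤ Y)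
    (hL : 0 ≤ L) (hz : |z| ≤ L) (hL₂ : 0 ≤ L₂) (hz' : |z'| ≤ L₂) (hPm : 0 ≤ Pm) (hP : |P| ≤ Pm)
    (hPb : 0 ≤ Pb) (hΦ : 0 ≤ Φ) (hB : B ^ 2 ≤ W * Z)
    (t1 : |i₁| ≤ Pb * Z * (X + L * B)) (t2 : |i₂| ≤ Φ * (X + L * B))
    (t3 : |i₃| ≤ (1 + Y) / 2) (t4 : |i₄| ≤ (1 + 2 * (B * Z)) / 2)
    (hJ : |J| ≤ X * B) (hI : |I| ≤ 1 / 2 * Y + 2 * (B * Z) / (4 * (1 / 2))) :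
    -ν * i₁ + i₂ + P * (i₃ + z * i₄) + z' * (J + I) ≤
      (|ν| * Pb * (1 + L) + Φ * (1 + L) + Pm * (1 + L) + 3 * L₂) *
        (1 + (X ^ 2 + Y + Z ^ 2 + W ^ 2)) := by
  obtain ⟨R, hR⟩ : ∃ R, R = 1 + (X ^ 2 + Y + Z ^ 2 + W ^ 2) := ⟨_, rfl⟩
  rw [← hR]
  have qX := sq_nonneg X
  have qZ := sq_nonneg Z
  have qW := sq_nonneg W
  have hB2 : B ^ 2 ≤ (W ^ 2 + Z ^ 2) / 2 := by linarith [sq_nonneg (W - Z), sub_sq W Z]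
  have hBZ : 2 * (B * Z) ≤ B ^ 2 + Z ^ 2 := by linarith [sq_nonneg (B - Z), sub_sq B Z]
  have hXZ : 2 * (X * Z) ≤ X ^ 2 + Z ^ 2 := by linarith [sq_nonneg (X - Z), sub_sq X Z]
  have hXB : 2 * (X * B) ≤ X ^ 2 + B ^ 2 := by linarith [sq_nonneg (X - B), sub_sq X B]
  have hX1 : X ≤ R := by linarith [sq_nonneg (X - 1), sub_sq X 1]
  have hB1 : B ≤ R := by linarith [sq_nonneg (B - 1), sub_sq B 1]
  have hR0 : 0 ≤ R := hX0.trans hX1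
  have b1 : -ν * i₁ ≤ |ν| * Pb * (1 + L) * R := by
    refine (le_abs_self _).trans ?_
    rw [abs_mul, abs_neg]
    calc |ν| * |i₁| ≤ |ν| * (Pb * Z * (X + L * B)) := by gcongr
      _ = |ν| * Pb * (X * Z + L * (B * Z)) := by ring
      _ ≤ |ν| * Pb * (R + L * R) := by
          gcongr <;> linarith
      _ = _ := by ring
  have b2 : i₂ ≤ Φ * (1 + L) * R := by
    calc i₂ ≤ Φ * (X + L * B) := (le_abs_self _).trans t2
      _ ≤ Φ * (R + L * R) := by gcongr
      _ = _ := by ring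
  have b3 : P * (i₃ + z * i₄) ≤ Pm * (1 + L) * R := by
    refine (le_abs_self _).trans ?_
    rw [abs_mul]
    have u1 : |i₃| ≤ R := t3.trans (by linarith)
    have u2 : |i₄| ≤ R := t4.trans (by linarith)
    calc |P| * |i₃ + z * i₄| ≤ Pm * (R + L * R) := by
          gcongr
          refine (abs_add_le _ _).trans ?_
          rw [abs_mul]
          gcongr
      _ = _ := by ring
  have b4 : z' * (J + I) ≤ 3 * L₂ * R := by
    refine (le_abs_self _).trans ?_
    rw [abs_mul]
    have u : |J + I| ≤ 3 * R := (abs_add_le _ _).trans (by linarith)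
    calc |z'| * |J + I| ≤ L₂ * (3 * R) := by gcongr
      _ = _ := by ring
  calc _ ≤ |ν| * Pb * (1 + L) * R + Φ * (1 + L) * R + Pm * (1 + L) * R + 3 * L₂ * R := by
        linarith
    _ = _ := by ring

theorem exists_bound_on_Icc {E : Type*} [NormedAddCommGroup E] {T : ℝ} {g : ℝ → E}
    (hg : ContinuousOn g (Icc 0 T)) : ∃ C, 0 ≤ C ∧ ∀ t ∈ Icc 0 T, ‖g t‖ ≤ C := by
  obtain ⟨C, hC⟩ := isCompact_Icc.exists_bound_of_continuousOn hg
  exact ⟨max C 0, le_max_right _ _, fun t ht => (hC t ht).trans (le_max_left _ _)⟩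

namespace IsEvenBump

variable {κ : ℝ → ℝ}

theorem abs_inner_mass_le (h : IsEvenBump κ) (s : ℝ) {v b c : LTwo} (hbc : IsWeakDeriv 1 b c)
    {r : ℝ} (hr : 0 < r) : |inner ℝ (h.mass s v) b| ≤
      r * inner ℝ (h.mass s v) v + 2 * (‖b‖ * ‖c‖) / (4 * r) := by
  refine (h.abs_mass_le s v b hr).trans ?_
  gcongr
  exact h.mass_self_le hbc.ae_sq_le

/-- The production term of the energy identity is bounded by the energy. -/
theorem energy_production_le (h : IsEvenBump κ) {a v b c F p : LTwo}
    {s z z' ν P L L₂ Pm Pb Φ : ℝ} (hab : IsWeakDeriv 1 a b) (hbc : IsWeakDeriv 1 b c)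
    (hL : 0 ≤ L) (hz : |z| ≤ L) (hL₂ : 0 ≤ L₂) (hz' : |z'| ≤ L₂) (hPm : 0 ≤ Pm) (hP : |P| ≤ Pm)
    (hPb : 0 ≤ Pb) (hp : ∀ᵐ x : ℝ, |p x| ≤ Pb) (hΦ : 0 ≤ Φ) (hF : ‖F‖ ≤ Φ) :
    -ν * inner ℝ (mulL (h.mollB c) p) (h.mollL (v + z • b)) + inner ℝ F (v + z • b)
        + P * inner ℝ (h.bumpAt s) (v + z • b)
        + z' * (inner ℝ v b + inner ℝ (h.mass s v) b) ≤
      (|ν| * Pb * (1 + L) + Φ * (1 + L) + Pm * (1 + L) + 3 * L₂) *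
        (1 + (‖v‖ ^ 2 + inner ℝ (h.mass s v) v + ‖c‖ ^ 2 + ‖a‖ ^ 2)) := by
  have hI := h.abs_inner_mass_le s (v := v) hbc (r := 1 / 2) (by norm_num)
  have hw : ‖v + z • b‖ ≤ ‖v‖ + L * ‖b‖ := by
    refine (norm_add_le _ _).trans ?_
    rw [norm_smul]
    gcongr
    exact hz
  have t1 : |inner ℝ (mulL (h.mollB c) p) (h.mollL (v + z • b))|
      ≤ Pb * ‖c‖ * (‖v‖ + L * ‖b‖) :=
    (h.abs_inner_mulL_moll_le hp c (v + z • b)).trans (by gcongr)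
  have t2 : |inner ℝ F (v + z • b)| ≤ Φ * (‖v‖ + L * ‖b‖) :=
    (abs_real_inner_le_norm F (v + z • b)).trans (by gcongr)
  have t4 : |inner ℝ (h.bumpAt s) b| ≤ (1 + 2 * (‖b‖ * ‖c‖)) / 2 :=
    (h.abs_inner_bumpAt_le s b).trans (by gcongr; exact h.mass_self_le hbc.ae_sq_le)
  rw [inner_add_right (h.bumpAt s), inner_smul_right]
  exact production_le (norm_nonneg _) (norm_nonneg _) (norm_nonneg _) (norm_nonneg _)
    (h.mass_nonneg s v) hL hz hL₂ hz' hPm hP hPb hΦ (hab.norm_sq_le hbc) t1 t2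
    (h.abs_inner_bumpAt_le s v) t4 (abs_real_inner_le_norm v b) hI

theorem energy_initial_le (h : IsEvenBump κ) {v b c : LTwo} {s z L x₀ b₀ c₀ y₀ : ℝ}
    (hbc : IsWeakDeriv 1 b c) (hL : 0 ≤ L) (hz : |z| ≤ L) (hv : ‖v‖ ≤ x₀) (hb : ‖b‖ ≤ b₀)
    (hc : ‖c‖ ≤ c₀) (hy : inner ℝ (h.mass s v) v ≤ y₀) :
    h.energy v b c s z ≤ x₀ ^ 2 / 2 + y₀ / 2 + c₀ ^ 2 / 2 + 2 * (b₀ * c₀) * b₀ ^ 2 / 12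
      + L * (x₀ * b₀ + (1 * y₀ + 2 * (b₀ * c₀) / (4 * 1))) := by
  have hb0 : 0 ≤ b₀ := (norm_nonneg _).trans hb
  have hc0 : 0 ≤ c₀ := (norm_nonneg _).trans hc
  have hx0 : 0 ≤ x₀ := (norm_nonneg _).trans hv
  have hI := h.abs_inner_mass_le s (v := v) hbc one_pos
  have hJ := abs_real_inner_le_norm v b
  have hQ := h.norm_sqMoll_sq_le hbc
  have e1 : ‖v‖ ^ 2 ≤ x₀ ^ 2 := by gcongr
  have e2 : ‖c‖ ^ 2 ≤ c₀ ^ 2 := by gcongr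
  have e3 : ‖h.sqMoll b‖ ^ 2 ≤ 2 * (b₀ * c₀) * b₀ ^ 2 := hQ.trans (by gcongr)
  have e4 : z * (inner ℝ v b + inner ℝ (h.mass s v) b)
      ≤ L * (x₀ * b₀ + (1 * y₀ + 2 * (b₀ * c₀) / (4 * 1))) := by
    refine (le_abs_self _).trans ?_
    rw [abs_mul]
    gcongr
    refine (abs_add_le _ _).trans (add_le_add (hJ.trans (by gcongr)) (hI.trans (by gcongr)))
  rw [energy]
  linarith

theorem conv_sq_le (h : IsEvenBump κ) {f : LTwo} {M : ℝ} (hf : ∀ᵐ x : ℝ, |f x| ≤ M) (x : ℝ) :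
    conv f κ x ^ 2 ≤ M ^ 2 := by
  have hi : Integrable (fun y => κ (x - y)) :=
    (h.smooth.continuous.integrable_of_hasCompactSupport h.compact).comp_sub_left x
  have h1 : ∫ y, κ (x - y) = 1 := by
    rw [integral_sub_left_eq_self κ volume x, h.integral_eq_one]
  refine sq_le_sq' ?_ ?_ <;> [skip; skip]
  all_goals
    have : |conv f κ x| ≤ M := by
      calc |conv f κ x| ≤ ∫ y, M * κ (x - y) := by
            refine norm_integral_le_of_norm_le (f := fun y => f y * κ (x - y))
              (hi.const_mul M) ?_
            filter_upwards [hf] with y hy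
            rw [norm_mul, Real.norm_of_nonneg (h.nonneg _)]
            exact mul_le_mul_of_nonneg_right hy (h.nonneg _)
        _ = M := by rw [integral_const_mul, h1, mul_one]
  · exact (abs_le.1 this).1
  · exact (abs_le.1 this).2

end IsEvenBump

theorem IsMollifiedSolution.initial {T ν : ℝ} {ζ P θ : ℝ → ℝ} {f p : ℝ → SobolevH 2}
    {u₀ : SobolevH 2} {u₁ : LTwo} {ε : ℝ} {U : ℝ → SobolevH 4}
    (hU : IsMollifiedSolution T ν ζ P θ f p u₀ u₁ ε U) (h : IsEvenBump (mollifier θ ε)) :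
    dt T 1 U 0 = h.mollL u₁ ∧ dx 0 (U 0) = h.mollL (dx 0 u₀) ∧
      dx 1 (U 0) = h.mollL (dx 1 u₀) ∧ dx 2 (U 0) = h.mollL (dx 2 u₀) := by
  have e0 : dx 0 (U 0) = h.mollL (dx 0 u₀) := by
    apply Lp.ext
    filter_upwards [hU.init_pos, h.coeFn_mollL (dx 0 u₀)] with x h1 h2
    rw [h1, h2]
  have e1 : dx 1 (U 0) = h.mollL (dx 1 u₀) :=
    (isWeakDeriv_dx_succ 0 (U 0)).unique (by
      have := (isWeakDeriv_dx_succ 0 u₀).convolve h.smooth.continuous h.compact h.even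
      change IsWeakDeriv 1 (dx 0 (U 0)) _
      rw [e0]
      exact this)
  have e2 : dx 2 (U 0) = h.mollL (dx 2 u₀) :=
    (isWeakDeriv_dx_succ 1 (U 0)).unique (by
      have := (isWeakDeriv_dx_succ 1 u₀).convolve h.smooth.continuous h.compact h.even
      change IsWeakDeriv 1 (dx 1 (U 0)) _
      rw [e1]
      exact this)
  refine ⟨?_, e0, e1, e2⟩
  apply Lp.ext
  filter_upwards [hU.init_vel, h.coeFn_mollL u₁] with x h1 h2
  rw [h1, h2]

/-- Solutions of the mollified problems are bounded in `H²`, and their velocities in `L²`, uniformly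
in time and in the mollification parameter. -/
theorem exists_uniform_bound {T ν : ℝ} (hT : 0 < T) {ζ P θ : ℝ → ℝ} {f p : ℝ → SobolevH 2}
    {u₀ : SobolevH 2} {u₁ : LTwo} (hζ : ContDiffOn ℝ 2 ζ (Icc 0 T))
    (hP : ContinuousOn P (Icc 0 T)) (hf : ContinuousOn f (Icc 0 T))
    (hp : ContinuousOn p (Icc 0 T)) (hθ : IsEvenBump θ) (hu₁ : MemLp u₁ ⊤ volume) :
    ∃ C, ∀ ε, 0 < ε → ∀ U : ℝ → SobolevH 4, IsMollifiedSolution T ν ζ P θ f p u₀ u₁ ε U →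
      ∀ t ∈ Icc 0 T, ‖dt T 1 U t‖ ≤ C ∧ ‖dx 0 (U t)‖ ≤ C ∧ ‖dx 1 (U t)‖ ≤ C ∧
        ‖dx 2 (U t)‖ ≤ C := by
  have hu : UniqueDiffOn ℝ (Icc 0 T) := uniqueDiffOn_Icc hT
  set z : ℝ → ℝ := derivWithin ζ (Icc 0 T) with hz
  set z' : ℝ → ℝ := derivWithin z (Icc 0 T) with hz'
  have hzc : ContDiffOn ℝ 1 z (Icc 0 T) := ((contDiffOn_succ_iff_derivWithin (n := 1) hu).1 hζ).2.2
  have hz'c : ContinuousOn z' (Icc 0 T) :=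
    ((contDiffOn_succ_iff_derivWithin (n := 0) hu).1 hzc).2.2.continuousOn
  have hζd : ∀ t ∈ Icc 0 T, HasDerivWithinAt ζ (z t) (Icc 0 T) t := fun t ht =>
    (hζ.differentiableOn (by norm_num) t ht).hasDerivWithinAt
  have hzd : ∀ t ∈ Icc 0 T, HasDerivWithinAt z (z' t) (Icc 0 T) t := fun t ht =>
    (hzc.differentiableOn (by norm_num) t ht).hasDerivWithinAt
  obtain ⟨L0, hL0, hL⟩ := exists_bound_on_Icc hzc.continuousOn
  obtain ⟨L₂, hL₂0, hL₂⟩ := exists_bound_on_Icc hz'c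
  obtain ⟨Pm, hPm0, hPm⟩ := exists_bound_on_Icc hP
  obtain ⟨Φ, hΦ0, hΦ⟩ := exists_bound_on_Icc hf
  obtain ⟨Ψ, hΨ0, hΨ⟩ := exists_bound_on_Icc hp
  obtain ⟨M, hM⟩ : ∃ M : ℝ, ∀ᵐ x : ℝ, |u₁ x| ≤ M := by
    refine ⟨(eLpNorm u₁ ⊤ volume).toReal, ?_⟩
    filter_upwards [enorm_ae_le_eLpNormEssSup u₁ volume] with x hx
    rw [eLpNorm_exponent_top, ← Real.norm_eq_abs, ← toReal_enorm]
    exact ENNReal.toReal_mono (by simpa using hu₁.eLpNorm_ne_top) hx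
  set L := max L0 1
  have hL1 : 1 ≤ L := le_max_right _ _
  have hLz : ∀ t ∈ Icc 0 T, |z t| ≤ L := fun t ht => (hL t ht).trans (le_max_left _ _)
  set Pb := √(2 * (Ψ * Ψ))
  have hPb : ∀ t ∈ Icc 0 T, ∀ᵐ x : ℝ, |dx 0 (p t) x| ≤ Pb := by
    intro t ht
    filter_upwards [(isWeakDeriv_dx_succ 0 (p t)).ae_sq_le] with x hx
    refine Real.abs_le_sqrt (hx.trans ?_)
    gcongr <;> exact (norm_dx_le _ _).trans (hΨ t ht)
  set K := 2 * (L ^ 2 + 8 * L ^ 4) ^ 2 + 1 / 4 with hK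
  have hK0 : 0 ≤ K := by positivity
  set C₁ := |ν| * Pb * (1 + L) + Φ * (1 + L) + Pm * (1 + L) + 3 * L₂ with hC₁
  have hC₁0 : 0 ≤ C₁ := by positivity
  set x₀ := ‖u₁‖
  set b₀ := ‖dx 1 u₀‖
  set c₀ := ‖dx 2 u₀‖
  set E₀ := 1 + (x₀ ^ 2 / 2 + M ^ 2 / 2 + c₀ ^ 2 / 2 + 2 * (b₀ * c₀) * b₀ ^ 2 / 12
      + L * (x₀ * b₀ + (1 * M ^ 2 + 2 * (b₀ * c₀) / (4 * 1)))) + K * ‖dx 0 u₀‖ ^ 2 with hE₀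
  have hE₀0 : 0 ≤ E₀ := by positivity
  set C₃ := 4 * (C₁ + K) with hC₃
  refine ⟨1 + 4 * (E₀ * Real.exp (C₃ * T)), fun ε hε U hU => ?_⟩
  have h := isEvenBump_mollifier hθ hε
  obtain ⟨-, V', hV'⟩ := hU.regular.exists_deriv hT
  obtain ⟨i1, i2, i3, i4⟩ := hU.initial h
  let y : ℝ → ℝ := fun t => 1 + h.energy (dt T 1 U t) (dx 1 (U t)) (dx 2 (U t)) (ζ t) (z t)
    + K * ‖dx 0 (U t)‖ ^ 2
  let Ω : ℝ → ℝ := fun t => ‖dt T 1 U t‖ ^ 2 + inner ℝ (h.mass (ζ t) (dt T 1 U t)) (dt T 1 U t)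
    + ‖dx 2 (U t)‖ ^ 2 + ‖dx 0 (U t)‖ ^ 2
  have d01 : ∀ t, IsWeakDeriv 1 (dx 0 (U t)) (dx 1 (U t)) := fun t => isWeakDeriv_dx_succ 0 (U t)
  have d12 : ∀ t, IsWeakDeriv 1 (dx 1 (U t)) (dx 2 (U t)) := fun t => isWeakDeriv_dx_succ 1 (U t)
  have d23 : ∀ t, IsWeakDeriv 1 (dx 2 (U t)) (dx 3 (U t)) := fun t => isWeakDeriv_dx_succ 2 (U t)
  have d34 : ∀ t, IsWeakDeriv 1 (dx 3 (U t)) (dx 4 (U t)) := fun t => isWeakDeriv_dx_succ 3 (U t)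
  have hΩy : ∀ t ∈ Icc 0 T, Ω t / 4 ≤ y t - 1 := by
    intro t ht
    have hc := energy_coercive (Y := inner ℝ (h.mass (ζ t) (dt T 1 U t)) (dt T 1 U t))
      hL1 (hLz t ht) (norm_nonneg (dt T 1 U t)) (norm_nonneg (dx 1 (U t)))
      (sq_nonneg ‖h.sqMoll (dx 1 (U t))‖) ((d01 t).norm_sq_le (d12 t)) le_rfl
      (abs_real_inner_le_norm (dt T 1 U t) (dx 1 (U t)))
      (h.abs_inner_mass_le (ζ t) (d12 t) (by positivity))
    rw [← hK] at hc
    simp only [y, Ω, IsEvenBump.energy]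
    linarith
  have hΩ0 : ∀ t, 0 ≤ Ω t := fun t => by
    have := h.mass_nonneg (ζ t) (dt T 1 U t)
    positivity
  have hder : ∀ t ∈ Icc 0 T, ∃ D, HasDerivWithinAt y D (Icc 0 T) t ∧ D ≤ C₃ * y t := by
    intro t ht
    obtain ⟨v0, v1, v2, v3, v4⟩ := hV' t ht
    have hE := (((h.hasDerivWithinAt_energy v2 v3 v4 (hζd t ht) (hzd t ht)).const_add 1).add
      (v1.norm_sq.const_mul K))
    refine ⟨_, hE, ?_⟩
    have w01 : IsWeakDeriv 1 (dt T 1 U t) (dx 1 (V' t)) := by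
      rw [← v0]
      exact isWeakDeriv_dx_succ 0 (V' t)
    have w12 : IsWeakDeriv 1 (dx 1 (V' t)) (dx 2 (V' t)) := isWeakDeriv_dx_succ 1 (V' t)
    have heq := h.energy_deriv_eq (z' := z' t) (d12 t) (d23 t) (d34 t) w01 w12
      (hU.equation_lTwo h ht)
    rw [← hz] at heq
    rw [heq]
    have hprod := h.energy_production_le (s := ζ t) (v := dt T 1 U t) (ν := ν) (d01 t) (d12 t)
      (by positivity) (hLz t ht) hL₂0 (hL₂ t ht) hPm0 (hPm t ht) (by positivity) (hPb t ht) hΦ0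
      ((norm_dx_le 0 (f t)).trans (hΦ t ht))
    have h1 := hΩy t ht
    have h2 : 2 * inner ℝ (dx 0 (U t)) (dt T 1 U t) ≤ Ω t := by
      have := real_inner_le_norm (dx 0 (U t)) (dt T 1 U t)
      have hm := h.mass_nonneg (ζ t) (dt T 1 U t)
      simp only [Ω]
      linarith [two_mul_le_add_sq ‖dx 0 (U t)‖ ‖dt T 1 U t‖, sq_nonneg ‖dx 2 (U t)‖]
    calc _ ≤ C₁ * (1 + Ω t) + K * Ω t := by
          refine add_le_add hprod ?_
          exact mul_le_mul_of_nonneg_left h2 hK0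
      _ ≤ (C₁ + K) * (1 + Ω t) := by linarith [add_mul C₁ K (1 + Ω t), mul_add K 1 (Ω t)]
      _ ≤ (C₁ + K) * (4 * y t) := by
          gcongr
          linarith
      _ = _ := by ring
  choose! y' hy' hyle using hder
  have hgr := le_exp_mul_of_deriv_le hT.le hy' hyle
  have hy0 : y 0 ≤ E₀ := by
    have h0 : (0 : ℝ) ∈ Icc 0 T := left_mem_Icc.2 hT.le
    have q1 : ‖dt T 1 U 0‖ ≤ x₀ := by rw [i1]; exact h.norm_mollL_le _
    have q2 : ‖dx 0 (U 0)‖ ≤ ‖dx 0 u₀‖ := by rw [i2]; exact h.norm_mollL_le _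
    have q3 : ‖dx 1 (U 0)‖ ≤ b₀ := by rw [i3]; exact h.norm_mollL_le _
    have q4 : ‖dx 2 (U 0)‖ ≤ c₀ := by rw [i4]; exact h.norm_mollL_le _
    have q5 : inner ℝ (h.mass (ζ 0) (dt T 1 U 0)) (dt T 1 U 0) ≤ M ^ 2 := by
      refine h.mass_self_le ?_
      rw [i1]
      filter_upwards [h.coeFn_mollL u₁] with x hx
      rw [hx]
      exact h.conv_sq_le hM x
    have := h.energy_initial_le (d12 0) (by positivity) (hLz 0 h0) q1 q3 q4 q5
    have q6 : K * ‖dx 0 (U 0)‖ ^ 2 ≤ K * ‖dx 0 u₀‖ ^ 2 := by gcongr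
    simp only [y]
    linarith
  intro t ht
  have hΩt : Ω t ≤ 4 * (E₀ * Real.exp (C₃ * T)) := by
    have h1 := hΩy t ht
    have h2 := hgr t ht
    have h3 : y 0 * Real.exp (C₃ * t) ≤ E₀ * Real.exp (C₃ * T) := by
      have : C₃ * t ≤ C₃ * T := by
        have : 0 ≤ C₃ := by positivity
        exact mul_le_mul_of_nonneg_left ht.2 this
      gcongr
    linarith
  have hm := h.mass_nonneg (ζ t) (dt T 1 U t)
  have hsq : ∀ r : ℝ, r ^ 2 ≤ Ω t → r ≤ 1 + 4 * (E₀ * Real.exp (C₃ * T)) := fun r hr => by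
    linarith [sq_nonneg (r - 1), sub_sq r 1, sq_nonneg r]
  have hB := (d01 t).norm_sq_le (d12 t)
  have s1 := sq_nonneg ‖dt T 1 U t‖
  have s2 := sq_nonneg ‖dx 0 (U t)‖
  have s3 := sq_nonneg ‖dx 2 (U t)‖
  have s4 := two_mul_le_add_sq ‖dx 0 (U t)‖ ‖dx 2 (U t)‖
  refine ⟨hsq _ ?_, hsq _ ?_, hsq _ ?_, hsq _ ?_⟩ <;> simp only [Ω] <;> linarith

/-! ### Weak convergence in Hilbert spaces -/

section Weak

variable {H : Type*} [NormedAddCommGroup H] [InnerProductSpace ℝ H]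

/-- Weak convergence of a sequence in a Hilbert space. -/
def WeakTendsto (x : ℕ → H) (y : H) : Prop :=
  ∀ z, Tendsto (fun k => inner ℝ (x k) z) atTop (𝓝 (inner ℝ y z))

theorem WeakTendsto.comp {x : ℕ → H} {y : H} (h : WeakTendsto x y) {φ : ℕ → ℕ}
    (hφ : StrictMono φ) : WeakTendsto (x ∘ φ) y := fun z => (h z).comp hφ.tendsto_atTop

theorem WeakTendsto.sub {x x' : ℕ → H} {y y' : H} (h : WeakTendsto x y)
    (h' : WeakTendsto x' y') : WeakTendsto (fun k => x k - x' k) (y - y') := fun z => by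
  simpa only [inner_sub_left] using (h z).sub (h' z)

theorem weakTendsto_const (y : H) : WeakTendsto (fun _ => y) y := fun _ => tendsto_const_nhds

theorem WeakTendsto.norm_le {x : ℕ → H} {y : H} (h : WeakTendsto x y) {C : ℝ}
    (hC : ∀ k, ‖x k‖ ≤ C) : ‖y‖ ≤ C := by
  have h1 : inner ℝ y y ≤ C * ‖y‖ := le_of_tendsto (h y) (Eventually.of_forall fun k =>
    (real_inner_le_norm _ _).trans (by gcongr; exact hC k))
  rw [real_inner_self_eq_norm_mul_norm] at h1
  rcases (norm_nonneg y).eq_or_lt with h0 | h0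
  · rw [← h0]
    exact (norm_nonneg _).trans (hC 0)
  · exact le_of_mul_le_mul_right h1 h0

theorem weakTendsto_of_dense {x : ℕ → H} {y : H} {C : ℝ} (hC : ∀ k, ‖x k‖ ≤ C) {D : Set H}
    (hD : Dense D) (h : ∀ d ∈ D, Tendsto (fun k => inner ℝ (x k) d) atTop (𝓝 (inner ℝ y d))) :
    WeakTendsto x y := by
  intro z
  rw [Metric.tendsto_atTop]
  intro ε hε
  have hM : 0 < C + ‖y‖ + 1 := by
    have := (norm_nonneg _).trans (hC 0)
    positivity
  obtain ⟨d, hdD, hd⟩ := Metric.dense_iff.1 hD z (ε / (2 * (C + ‖y‖ + 1))) (by positivity)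
  rw [Metric.mem_ball, dist_eq_norm, norm_sub_rev] at hdD
  obtain ⟨N, hN⟩ := Metric.tendsto_atTop.1 (h d hd) (ε / 2) (by positivity)
  refine ⟨N, fun k hk => ?_⟩
  have h1 := hN k hk
  rw [Real.dist_eq] at h1 ⊢
  have e : inner ℝ (x k) z - inner ℝ y z
      = inner ℝ (x k - y) (z - d) + (inner ℝ (x k) d - inner ℝ y d) := by
    simp only [inner_sub_left, inner_sub_right]
    ring
  rw [e]
  calc |inner ℝ (x k - y) (z - d) + (inner ℝ (x k) d - inner ℝ y d)|
      ≤ |inner ℝ (x k - y) (z - d)| + |inner ℝ (x k) d - inner ℝ y d| := abs_add_le _ _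
    _ < ε / 2 + ε / 2 := by
        refine add_lt_add_of_le_of_lt ?_ h1
        calc |inner ℝ (x k - y) (z - d)| ≤ ‖x k - y‖ * ‖z - d‖ := abs_real_inner_le_norm _ _
          _ ≤ (C + ‖y‖ + 1) * (ε / (2 * (C + ‖y‖ + 1))) := by
              gcongr
              exact (norm_sub_le _ _).trans (by linarith [hC k])
          _ = ε / 2 := by field_simp
    _ = ε := add_halves ε

variable [CompleteSpace H] [TopologicalSpace.SeparableSpace H]

theorem exists_subseq_weakTendsto {x : ℕ → H} {C : ℝ} (hC : ∀ k, ‖x k‖ ≤ C) :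
    ∃ φ : ℕ → ℕ, StrictMono φ ∧ ∃ y, WeakTendsto (x ∘ φ) y := by
  let D : ℕ → WeakDual ℝ H := fun k =>
    StrongDual.toWeakDual (InnerProductSpace.toDual ℝ H (x k))
  have hmem : ∀ k, D k ∈ WeakDual.toStrongDual ⁻¹' Metric.closedBall (0 : StrongDual ℝ H) C := by
    intro k
    simpa [D] using hC k
  obtain ⟨a, -, φ, hφ, hlim⟩ := WeakDual.isSeqCompact_closedBall ℝ H 0 C hmem
  refine ⟨φ, hφ, (InnerProductSpace.toDual ℝ H).symm (WeakDual.toStrongDual a), fun z => ?_⟩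
  rw [InnerProductSpace.toDual_symm_apply]
  exact ((WeakDual.eval_continuous z).tendsto a).comp hlim

theorem exists_weakTendsto_of_dense {x : ℕ → H} {C : ℝ} (hC : ∀ k, ‖x k‖ ≤ C) {D : Set H}
    (hD : Dense D) (h : ∀ d ∈ D, ∃ l, Tendsto (fun k => inner ℝ (x k) d) atTop (𝓝 l)) :
    ∃ y, WeakTendsto x y := by
  obtain ⟨φ, hφ, y, hy⟩ := exists_subseq_weakTendsto hC
  refine ⟨y, weakTendsto_of_dense hC hD fun d hd => ?_⟩
  obtain ⟨l, hl⟩ := h d hd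
  rwa [tendsto_nhds_unique (hy d) (hl.comp hφ.tendsto_atTop)]

theorem exists_subseq_tendsto_of_bounded {ι : Type*} [Countable ι] {F : ℕ → ι → ℝ} {C : ι → ℝ}
    (hF : ∀ k i, |F k i| ≤ C i) :
    ∃ φ : ℕ → ℕ, StrictMono φ ∧ ∀ i, ∃ l, Tendsto (fun k => F (φ k) i) atTop (𝓝 l) := by
  have hc : IsCompact (Set.pi univ fun i => Icc (-C i) (C i)) :=
    isCompact_univ_pi fun i => isCompact_Icc
  obtain ⟨a, -, φ, hφ, hlim⟩ := hc.tendsto_subseq (x := F)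
    (fun k i _ => abs_le.1 (hF k i))
  exact ⟨φ, hφ, fun i => ⟨a i, (tendsto_pi_nhds.1 hlim) i⟩⟩

/-- A sequence of equi-Lipschitz bounded curves in a separable Hilbert space has a subsequence that
converges weakly at every time. -/
theorem exists_subseq_weakTendsto_of_lipschitz {T C : ℝ} (hT : 0 ≤ T) {w : ℕ → ℝ → H}
    (hC : ∀ k, ∀ t ∈ Icc 0 T, ‖w k t‖ ≤ C)
    (hL : ∀ k, ∀ s ∈ Icc 0 T, ∀ t ∈ Icc 0 T, ‖w k t - w k s‖ ≤ C * |t - s|) :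
    ∃ φ : ℕ → ℕ, StrictMono φ ∧ ∀ t ∈ Icc 0 T, ∃ y, WeakTendsto (fun k => w (φ k) t) y := by
  have : Nonempty (Icc 0 T) := ⟨⟨0, left_mem_Icc.2 hT⟩⟩
  have hC0 : 0 ≤ C := (norm_nonneg _).trans (hC 0 0 (left_mem_Icc.2 hT))
  let q : ℕ → Icc 0 T := TopologicalSpace.denseSeq (Icc 0 T)
  let d : ℕ → H := TopologicalSpace.denseSeq H
  obtain ⟨φ, hφ, hlim⟩ := exists_subseq_tendsto_of_bounded
    (F := fun k (i : ℕ × ℕ) => inner ℝ (w k (q i.1)) (d i.2)) (C := fun i => C * ‖d i.2‖)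
    (fun k i => (abs_real_inner_le_norm _ _).trans (by gcongr; exact hC k _ (q i.1).2))
  refine ⟨φ, hφ, fun t ht => exists_weakTendsto_of_dense (fun k => hC (φ k) t ht)
    (TopologicalSpace.denseRange_denseSeq H) ?_⟩
  rintro _ ⟨n, rfl⟩
  refine cauchySeq_tendsto_of_complete (Metric.cauchySeq_iff'.2 fun ε hε => ?_)
  change ∃ N, ∀ k ≥ N, dist (inner ℝ (w (φ k) t) (d n)) (inner ℝ (w (φ N) t) (d n)) < ε
  set δ := ε / (4 * (C * ‖d n‖ + 1)) with hδ
  have hδ0 : 0 < δ := by positivity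
  obtain ⟨_, hm, m, rfl⟩ := Metric.dense_iff.1 (TopologicalSpace.denseRange_denseSeq (Icc 0 T))
    ⟨t, ht⟩ δ hδ0
  have hmt : |t - q m| < δ := by
    rw [Metric.mem_ball, dist_comm] at hm
    exact hm
  have hclose : ∀ k, |inner ℝ (w k t) (d n) - inner ℝ (w k (q m)) (d n)| ≤ ε / 4 := by
    intro k
    rw [← inner_sub_left]
    calc |inner ℝ (w k t - w k (q m)) (d n)| ≤ ‖w k t - w k (q m)‖ * ‖d n‖ :=
          abs_real_inner_le_norm _ _
      _ ≤ C * δ * ‖d n‖ := by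
          gcongr
          exact (hL k _ (q m).2 t ht).trans (by gcongr)
      _ = (C * ‖d n‖) * δ := by ring
      _ ≤ (C * ‖d n‖ + 1) * δ := by gcongr; linarith
      _ = ε / 4 := by rw [hδ]; field_simp
  obtain ⟨l, hl⟩ := hlim (m, n)
  obtain ⟨N, hN⟩ := Metric.cauchySeq_iff'.1 hl.cauchySeq (ε / 4) (by positivity)
  refine ⟨N, fun k hk => ?_⟩
  have h1 := hN k hk
  have h2 := hclose (φ k)
  have h3 := hclose (φ N)
  rw [Real.dist_eq] at h1 ⊢
  simp only at h1
  rw [abs_lt] at h1 ⊢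
  rw [abs_le] at h2 h3
  constructor <;> linarith [h1.1, h1.2, h2.1, h2.2, h3.1, h3.2]

end Weak

instance : SecondCountableTopology LTwo := inferInstance

theorem integral_mul_eq_inner (f : LTwo) {ψ : ℝ → ℝ} (hψ : MemLp ψ 2 volume) :
    ∫ x, f x * ψ x = inner ℝ f (hψ.toLp ψ) := by
  rw [inner_eq_integral]
  refine integral_congr_ae ?_
  filter_upwards [hψ.coeFn_toLp] with x hx
  rw [hx]

theorem memLp_iteratedDeriv {φ : ℝ → ℝ} (hφ : ContDiff ℝ ∞ φ) (hc : HasCompactSupport φ) (j : ℕ) :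
    MemLp (iteratedDeriv j φ) 2 volume :=
  (hφ.continuous_iteratedDeriv j (by exact_mod_cast le_top)).memLp_of_hasCompactSupport
    (hasCompactSupport_iterated_deriv hc j)

theorem exists_isWeakDeriv_weakTendsto {j : ℕ} {x y : ℕ → LTwo} {x' : LTwo} {C : ℝ}
    (hxy : ∀ k, IsWeakDeriv j (x k) (y k)) (hC : ∀ k, ‖y k‖ ≤ C) (hx : WeakTendsto x x') :
    ∃ y', IsWeakDeriv j x' y' ∧ WeakTendsto y y' := by
  have hone : ((-1 : ℝ) ^ j) * (-1) ^ j = 1 := by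
    rw [← mul_pow]; simp
  have key : ∀ {φ : ℝ → ℝ} (hφ : ContDiff ℝ ∞ φ) (hc : HasCompactSupport φ) (k : ℕ),
      inner ℝ (y k) ((hφ.continuous.memLp_of_hasCompactSupport hc).toLp φ)
        = (-1) ^ j * inner ℝ (x k) ((memLp_iteratedDeriv hφ hc j).toLp _) := by
    intro φ hφ hc k
    rw [← integral_mul_eq_inner, ← integral_mul_eq_inner, hxy k φ hφ hc, ← mul_assoc, hone,
      one_mul]
  obtain ⟨y', hy'⟩ := exists_weakTendsto_of_dense hC
    (Lp.dense_hasCompactSupport_contDiff (F := ℝ) (μ := (volume : Measure ℝ))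
      (p := 2) ENNReal.ofNat_ne_top) (by
    rintro d ⟨φ, hdφ, hc, hφ⟩
    have hd : d = (hφ.continuous.memLp_of_hasCompactSupport hc).toLp φ :=
      Lp.ext (hdφ.trans (MemLp.coeFn_toLp _).symm)
    rw [hd]
    simp only [key hφ hc]
    exact ⟨_, (hx _).const_mul _⟩)
  refine ⟨y', fun φ hφ hc => ?_, hy'⟩
  rw [integral_mul_eq_inner x' (memLp_iteratedDeriv hφ hc j),
    integral_mul_eq_inner y' (hφ.continuous.memLp_of_hasCompactSupport hc)]
  have h1 := hy' ((hφ.continuous.memLp_of_hasCompactSupport hc).toLp φ)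
  simp only [key hφ hc] at h1
  have h2 := tendsto_nhds_unique h1 ((hx _).const_mul _)
  rw [h2, ← mul_assoc, hone, one_mul]

theorem IsWeakDeriv.sub {j : ℕ} {f g f' g' : LTwo} (h : IsWeakDeriv j f g)
    (h' : IsWeakDeriv j f' g') : IsWeakDeriv j (f - f') (g - g') := by
  have := h.add (h'.smul (-1))
  simpa only [neg_one_smul, ← sub_eq_add_neg] using this

/-! ### Local strong convergence -/

theorem exists_evenBump_supported {R : ℝ} (hR : 0 < R) :
    ∃ κ, IsEvenBump κ ∧ ∀ x, R < |x| → κ x = 0 := by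
  let b : ContDiffBump (0 : ℝ) := ⟨R / 2, R, by positivity, by linarith⟩
  refine ⟨b.normed volume, ⟨b.contDiff_normed, b.hasCompactSupport_normed, b.nonneg_normed,
    fun x => b.normed_neg x, b.integral_normed⟩, fun x hx => ?_⟩
  have : x ∉ Function.support (b.normed volume) := by
    rw [b.support_normed_eq]
    simp [b, hx.le]
  simpa using this

/-- Local compactness of the embedding of `H¹` in `L²`. -/
theorem tendsto_norm_mulL_of_weakTendsto {f g : ℕ → LTwo} {C : ℝ}
    (hfg : ∀ k, IsWeakDeriv 1 (f k) (g k)) (hf : ∀ k, ‖f k‖ ≤ C) (hg : ∀ k, ‖g k‖ ≤ C)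
    (h0 : WeakTendsto f 0) {χ : ℝ →ᵇ ℝ} (hχ : HasCompactSupport χ) :
    Tendsto (fun k => ‖mulL χ (f k)‖) atTop (𝓝 0) := by
  have hC0 : 0 ≤ C := (norm_nonneg _).trans (hf 0)
  have hχi : Integrable fun x => χ x ^ 2 := by
    refine (χ.continuous.pow 2).integrable_of_hasCompactSupport ?_
    simpa [sq] using hχ.mul_left (f := χ)
  set A := ∫ x, χ x ^ 2 with hA
  have hA0 : 0 ≤ A := integral_nonneg fun x => sq_nonneg _
  suffices h : Tendsto (fun k => ‖mulL χ (f k)‖ ^ 2) atTop (𝓝 0) by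
    have := h.sqrt
    simpa [Real.sqrt_sq (norm_nonneg _)] using this
  refine tendsto_order.2 ⟨fun a ha => Eventually.of_forall fun k => ha.trans_le (sq_nonneg _),
    fun η hη => ?_⟩
  set R := η / (4 * (A * C ^ 2 + 1)) with hR
  have hR0 : 0 < R := by positivity
  obtain ⟨κ, hκ, hκR⟩ := exists_evenBump_supported hR0
  have hlim : Tendsto (fun k => ∫ x, χ x ^ 2 * conv (f k) κ x ^ 2) atTop (𝓝 0) := by
    have : Tendsto (fun k => ∫ x, χ x ^ 2 * conv (f k) κ x ^ 2) atTop
        (𝓝 (∫ x, χ x ^ 2 * (0 : ℝ) ^ 2)) := by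
      refine tendsto_integral_of_dominated_convergence (fun x => χ x ^ 2 * (2 * (C * C)))
        (fun k => ?_) (hχi.mul_const _) (fun k => Eventually.of_forall fun x => ?_)
        (Eventually.of_forall fun x => ?_)
      · exact ((χ.continuous.pow 2).mul
          ((continuous_conv hκ.smooth.continuous hκ.compact (f k)).pow 2)).aestronglyMeasurable
      · rw [Real.norm_of_nonneg (by positivity)]
        gcongr
        refine ((hfg k).sq_conv_le hκ x).trans ?_
        gcongr
        exacts [hf k, hg k]
      · refine Tendsto.const_mul _ (Tendsto.pow ?_ 2)
        simp only [conv_eq_inner hκ.smooth.continuous hκ.compact]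
        simpa using h0 (kernelAt hκ.smooth.continuous hκ.compact x)
    simpa using this
  filter_upwards [hlim.eventually_lt_const (show 0 < η / 4 by positivity)] with k hk
  have hi1 : Integrable fun x => χ x ^ 2 * conv (f k) κ x ^ 2 := by
    refine (hκ.integrable_moll_mul (χ * χ) (f k) (f k)).congr (Eventually.of_forall fun x => ?_)
    simp only [BoundedContinuousFunction.mul_apply]
    ring
  calc ‖mulL χ (f k)‖ ^ 2 = ∫ x, (χ x * f k x) ^ 2 := by
        rw [← real_inner_self_eq_norm_sq, inner_eq_integral]
        refine integral_congr_ae ?_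
        filter_upwards [coeFn_mulL χ (f k)] with x hx
        rw [hx, sq]
    _ ≤ ∫ x, (2 * (χ x ^ 2 * conv (f k) κ x ^ 2) + 2 * (χ x ^ 2 * (R * C ^ 2))) := by
        refine integral_mono_of_nonneg (Eventually.of_forall fun x => sq_nonneg _)
          ((hi1.const_mul 2).add ((hχi.mul_const _).const_mul 2)) ?_
        filter_upwards [(hfg k).ae_abs_conv_sub_le hκ hκR] with x hx
        have h1 : (conv (f k) κ x - f k x) ^ 2 ≤ R * C ^ 2 := by
          rw [← sq_abs]
          calc |conv (f k) κ x - f k x| ^ 2 ≤ (√R * ‖g k‖) ^ 2 := by gcongr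
            _ = R * ‖g k‖ ^ 2 := by rw [mul_pow, Real.sq_sqrt hR0.le]
            _ ≤ R * C ^ 2 := by gcongr; exact hg k
        have h2 : f k x ^ 2 ≤ 2 * conv (f k) κ x ^ 2 + 2 * (R * C ^ 2) := by
          nlinarith [sq_nonneg (2 * conv (f k) κ x - f k x)]
        calc (χ x * f k x) ^ 2 = χ x ^ 2 * f k x ^ 2 := mul_pow _ _ _
          _ ≤ χ x ^ 2 * (2 * conv (f k) κ x ^ 2 + 2 * (R * C ^ 2)) := by gcongr
          _ = _ := by ring
    _ = 2 * (∫ x, χ x ^ 2 * conv (f k) κ x ^ 2) + 2 * (A * (R * C ^ 2)) := by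
        rw [integral_add (hi1.const_mul 2) ((hχi.mul_const _).const_mul 2), integral_const_mul,
          integral_const_mul, integral_mul_const]
    _ < η := by
        have : A * (R * C ^ 2) ≤ η / 4 := by
          calc A * (R * C ^ 2) = (A * C ^ 2) * R := by ring
            _ ≤ (A * C ^ 2 + 1) * R := by gcongr; linarith
            _ = η / 4 := by rw [hR]; field_simp
        linarith

/-- Pointwise convergence to zero of equi-Lipschitz curves is uniform on `[0,T]`. -/
theorem eventually_norm_le_of_lipschitz {H : Type*} [NormedAddCommGroup H] {T L : ℝ}
    {w : ℕ → ℝ → H} (hL : ∀ k, ∀ s ∈ Icc 0 T, ∀ t ∈ Icc 0 T, ‖w k t - w k s‖ ≤ L * |t - s|)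
    (h0 : ∀ t ∈ Icc 0 T, Tendsto (fun k => ‖w k t‖) atTop (𝓝 0)) {η : ℝ} (hη : 0 < η) :
    ∀ᶠ k in atTop, ∀ t ∈ Icc 0 T, ‖w k t‖ ≤ η := by
  refine isCompact_Icc.induction_on (p := fun S => ∀ᶠ k in atTop, ∀ t ∈ S, ‖w k t‖ ≤ η)
    (by simp) (fun s t hst h => h.mono fun k hk r hr => hk r (hst hr))
    (fun s t hs ht => ?_) (fun t ht => ?_)
  · filter_upwards [hs, ht] with k h1 h2 r hr
    exact hr.elim (h1 r) (h2 r)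
  · set δ := η / (2 * (|L| + 1)) with hδ
    have hδ0 : 0 < δ := by positivity
    refine ⟨Icc 0 T ∩ Metric.ball t δ, inter_mem self_mem_nhdsWithin
      (mem_nhdsWithin_of_mem_nhds (Metric.ball_mem_nhds t hδ0)), ?_⟩
    filter_upwards [(h0 t ht).eventually_lt_const (half_pos hη)] with k hk r hr
    have h1 : ‖w k r - w k t‖ ≤ η / 2 := by
      have hrt : |r - t| ≤ δ := by
        have := hr.2
        rw [Metric.mem_ball, Real.dist_eq] at this
        exact this.le
      calc ‖w k r - w k t‖ ≤ L * |r - t| := hL k t ht r hr.1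
        _ ≤ (|L| + 1) * δ := by
            gcongr
            linarith [le_abs_self L]
        _ = η / 2 := by rw [hδ]; field_simp
    calc ‖w k r‖ = ‖(w k r - w k t) + w k t‖ := by rw [sub_add_cancel]
      _ ≤ η / 2 + η / 2 := (norm_add_le _ _).trans (add_le_add h1 hk.le)
      _ = η := add_halves η

/-! ### Localization -/

theorem exists_smooth_cutoff {K : Set ℝ} (hK : IsCompact K) :
    ∃ χ χ' χ'' : ℝ →ᵇ ℝ, HasCompactSupport χ ∧ ContDiff ℝ ∞ χ ∧ ContDiff ℝ ∞ χ' ∧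
      (∀ x, HasDerivAt χ (χ' x) x) ∧ (∀ x, HasDerivAt χ' (χ'' x) x) ∧
      ∀ x ∈ K, χ x = 1 ∧ χ' x = 0 := by
  obtain ⟨κ, hκ, hκc, hκ1, -⟩ := exists_cutoff
  obtain ⟨r, hr0, hr⟩ := hK.isBounded.exists_pos_norm_lt
  set k : ℝ → ℝ := fun x => κ (r⁻¹ * x) with hk
  have hks : ContDiff ℝ ∞ k := hκ.comp (contDiff_const.mul contDiff_id)
  have hkc : HasCompactSupport k := hκc.comp_isClosedEmbedding
    (Homeomorph.mulLeft₀ r⁻¹ (inv_ne_zero hr0.ne')).isClosedEmbedding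
  have hk1 : ∀ x, |x| < r → k x = 1 := fun x hx => by
    refine hκ1 _ ?_
    rw [abs_mul, abs_of_pos (inv_pos.2 hr0), inv_mul_le_iff₀ hr0, mul_one]
    exact hx.le
  have hk's := contDiff_deriv_top hks
  have hk''s := contDiff_deriv_top hk's
  have hd : ∀ {g : ℝ → ℝ}, ContDiff ℝ ∞ g → ∀ x, HasDerivAt g (deriv g x) x := fun hg x =>
    ((hg.differentiable (by norm_num)) x).hasDerivAt
  have hs : ∀ {g : ℝ → ℝ} (hg : Continuous g) (hc : HasCompactSupport g),
      ⇑(shiftB hg hc 0) = g := fun hg hc => by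
    ext x
    rw [shiftB_apply, sub_zero]
  refine ⟨shiftB hks.continuous hkc 0, shiftB hk's.continuous hkc.deriv 0,
    shiftB hk''s.continuous hkc.deriv.deriv 0, ?_⟩
  simp only [hs]
  refine ⟨hkc, hks, hk's, hd hks, hd hk's, fun x hx => ⟨hk1 x (hr x hx), ?_⟩⟩
  have : k =ᶠ[𝓝 x] fun _ => 1 := by
    filter_upwards [(isOpen_lt continuous_abs continuous_const).mem_nhds (hr x hx)] with y hy
    exact hk1 y hy
  rw [this.deriv_eq, deriv_const]

theorem exists_localization {K : Set ℝ} (hK : IsCompact K) (C : ℝ) :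
    ∃ χ : ℝ →ᵇ ℝ, HasCompactSupport χ ∧ ∃ A, 0 ≤ A ∧ ∀ f g h : LTwo,
      IsWeakDeriv 1 f g → IsWeakDeriv 1 g h → ‖f‖ ≤ C → ‖g‖ ≤ C → ‖h‖ ≤ C →
      ∃ g' h', IsWeakDeriv 1 (mulL χ f) g' ∧ IsWeakDeriv 1 g' h' ∧ ‖h'‖ ≤ A ∧
        mulL χ f =ᵐ[volume.restrict K] f ∧ g' =ᵐ[volume.restrict K] g := by
  obtain ⟨χ, χ', χ'', hc, hs, hs', hd, hd', hχ⟩ := exists_smooth_cutoff hK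
  refine ⟨χ, hc, (‖χ''‖ + ‖χ'‖ + (‖χ'‖ + ‖χ‖)) * |C|, by positivity,
    fun f g h hfg hgh hf hg hh => ⟨mulL χ' f + mulL χ g,
      (mulL χ'' f + mulL χ' g) + (mulL χ' g + mulL χ h), hfg.mul_smooth hs hd,
      (hfg.mul_smooth hs' hd').add (hgh.mul_smooth hs hd), ?_, ?_, ?_⟩⟩
  · have hm : ∀ (φ : ℝ →ᵇ ℝ) (v : LTwo), ‖v‖ ≤ C → ‖mulL φ v‖ ≤ ‖φ‖ * |C| := fun φ v hv =>
      (norm_mulL_le φ v).trans (by gcongr; exact hv.trans (le_abs_self C))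
    calc _ ≤ (‖mulL χ'' f‖ + ‖mulL χ' g‖) + (‖mulL χ' g‖ + ‖mulL χ h‖) :=
          (norm_add_le _ _).trans (add_le_add (norm_add_le _ _) (norm_add_le _ _))
      _ ≤ (‖χ''‖ * |C| + ‖χ'‖ * |C|) + (‖χ'‖ * |C| + ‖χ‖ * |C|) := by
          gcongr
          exacts [hm _ _ hf, hm _ _ hg, hm _ _ hg, hm _ _ hh]
      _ = _ := by ring
  · filter_upwards [ae_restrict_of_ae (coeFn_mulL χ f), ae_restrict_mem hK.measurableSet]
      with x hx hxK
    rw [hx, (hχ x hxK).1, one_mul]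
  · filter_upwards [ae_restrict_of_ae (Lp.coeFn_add (mulL χ' f) (mulL χ g)),
      ae_restrict_of_ae (coeFn_mulL χ' f), ae_restrict_of_ae (coeFn_mulL χ g),
      ae_restrict_mem hK.measurableSet] with x h0 h1 h2 hxK
    rw [h0, Pi.add_apply, h1, h2, (hχ x hxK).1, (hχ x hxK).2, one_mul, zero_mul, zero_add]

theorem hsENormOn_lt_top {s : ℝ} (h0 : 0 ≤ s) (h2 : s < 2) (K : Set ℝ) {f g h : LTwo}
    (hfg : IsWeakDeriv 1 f g) (hgh : IsWeakDeriv 1 g h) : hsENormOn s K f < ⊤ := by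
  obtain ⟨C, -, hC⟩ := exists_hsENorm_le h0 h2 one_pos
  exact ((iInf₂_le f EventuallyEq.rfl).trans (hC f g h hfg hgh)).trans_lt ENNReal.ofReal_lt_top

/-- Interpolation: a function bounded in `H²` and locally small in `L²` is small in `H^s(K)`. -/
theorem exists_hsENormOn_le {s : ℝ} (h0 : 0 ≤ s) (h2 : s < 2) {K : Set ℝ} (hK : IsCompact K)
    (C : ℝ) {η : ℝ} (hη : 0 < η) :
    ∃ χ : ℝ →ᵇ ℝ, HasCompactSupport χ ∧ ∃ δ, 0 < δ ∧ ∀ f g h : LTwo,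
      IsWeakDeriv 1 f g → IsWeakDeriv 1 g h → ‖f‖ ≤ C → ‖g‖ ≤ C → ‖h‖ ≤ C →
      ‖mulL χ f‖ ≤ δ → hsENormOn s K f ≤ ENNReal.ofReal η := by
  obtain ⟨χ, hc, A, hA, H⟩ := exists_localization hK C
  obtain ⟨B, hB, hs⟩ := exists_hsENorm_le h0 h2 (δ := η / (2 * (A + 1))) (by positivity)
  refine ⟨χ, hc, η / (2 * (B + 1)), by positivity, fun f g h hfg hgh hf hg hh hχ => ?_⟩
  obtain ⟨g', h', hfg', hgh', hh', hfK, -⟩ := H f g h hfg hgh hf hg hh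
  refine ((iInf₂_le (mulL χ f) hfK).trans (hs _ g' h' hfg' hgh')).trans (ENNReal.ofReal_le_ofReal ?_)
  calc η / (2 * (A + 1)) * ‖h'‖ + B * ‖mulL χ f‖
      ≤ η / (2 * (A + 1)) * (A + 1) + (B + 1) * (η / (2 * (B + 1))) := by
        gcongr <;> linarith
    _ = η := by field_simp; ring

/-- Interpolation: a function bounded in `H²` and locally small in `L²` has a slope that is small
in `L^∞(K)`. -/
theorem exists_ae_abs_slope_le {K : Set ℝ} (hK : IsCompact K) (C : ℝ) {η : ℝ} (hη : 0 < η) :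
    ∃ χ : ℝ →ᵇ ℝ, HasCompactSupport χ ∧ ∃ δ, 0 < δ ∧ ∀ f g h : LTwo,
      IsWeakDeriv 1 f g → IsWeakDeriv 1 g h → ‖f‖ ≤ C → ‖g‖ ≤ C → ‖h‖ ≤ C →
      ‖mulL χ f‖ ≤ δ → ∀ᵐ x ∂(volume.restrict K), |g x| ≤ η := by
  obtain ⟨χ, hc, A, hA, H⟩ := exists_localization hK C
  set ρ := η ^ 2 / (2 * (A + 1)) with hρ
  have hρ0 : 0 < ρ := by positivity
  refine ⟨χ, hc, ρ ^ 2 / (A + 1), by positivity, fun f g h hfg hgh hf hg hh hχ => ?_⟩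
  obtain ⟨g', h', hfg', hgh', hh', -, hgK⟩ := H f g h hfg hgh hf hg hh
  have hg' : ‖g'‖ ≤ ρ := by
    refine le_of_sq_le_sq ?_ hρ0.le
    calc ‖g'‖ ^ 2 ≤ ‖mulL χ f‖ * ‖h'‖ := hfg'.norm_sq_le hgh'
      _ ≤ ρ ^ 2 / (A + 1) * (A + 1) := by gcongr; linarith
      _ = ρ ^ 2 := by field_simp
  filter_upwards [hgK, ae_restrict_of_ae hgh'.ae_sq_le] with x hx hx'
  rw [← hx]
  refine abs_le_of_sq_le_sq (hx'.trans ?_) hη.le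
  calc 2 * (‖g'‖ * ‖h'‖) ≤ 2 * (ρ * (A + 1)) := by gcongr; linarith
    _ = η ^ 2 := by rw [hρ]; field_simp

/-! ### Curves that are bounded in `H²` and Lipschitz in `L²` -/

/-- The curve `w₀` is Lipschitz in `L²`, and `w₁` and `w₂` are its first two derivatives in space;
everything is bounded by `C`. -/
structure IsBoundedCurve (T C : ℝ) (w₀ w₁ w₂ : ℝ → LTwo) : Prop where
  deriv_one : ∀ t ∈ Icc 0 T, IsWeakDeriv 1 (w₀ t) (w₁ t)
  deriv_two : ∀ t ∈ Icc 0 T, IsWeakDeriv 1 (w₁ t) (w₂ t)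
  norm_zero : ∀ t ∈ Icc 0 T, ‖w₀ t‖ ≤ C
  norm_one : ∀ t ∈ Icc 0 T, ‖w₁ t‖ ≤ C
  norm_two : ∀ t ∈ Icc 0 T, ‖w₂ t‖ ≤ C
  lipschitz : ∀ s ∈ Icc 0 T, ∀ t ∈ Icc 0 T, ‖w₀ t - w₀ s‖ ≤ C * |t - s|

namespace IsBoundedCurve

variable {T C : ℝ} {w₀ w₁ w₂ v₀ v₁ v₂ : ℝ → LTwo}

theorem sub (hw : IsBoundedCurve T C w₀ w₁ w₂) (hv : IsBoundedCurve T C v₀ v₁ v₂) :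
    IsBoundedCurve T (2 * C) (fun t => w₀ t - v₀ t) (fun t => w₁ t - v₁ t)
      (fun t => w₂ t - v₂ t) where
  deriv_one t ht := (hw.deriv_one t ht).sub (hv.deriv_one t ht)
  deriv_two t ht := (hw.deriv_two t ht).sub (hv.deriv_two t ht)
  norm_zero t ht := (norm_sub_le _ _).trans (by linarith [hw.norm_zero t ht, hv.norm_zero t ht])
  norm_one t ht := (norm_sub_le _ _).trans (by linarith [hw.norm_one t ht, hv.norm_one t ht])
  norm_two t ht := (norm_sub_le _ _).trans (by linarith [hw.norm_two t ht, hv.norm_two t ht])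
  lipschitz s hs t ht := by
    have e : w₀ t - v₀ t - (w₀ s - v₀ s) = (w₀ t - w₀ s) - (v₀ t - v₀ s) := by abel
    rw [e]
    exact (norm_sub_le _ _).trans (by linarith [hw.lipschitz s hs t ht, hv.lipschitz s hs t ht])

theorem continuousOn (hw : IsBoundedCurve T C w₀ w₁ w₂) : ContinuousOn w₀ (Icc 0 T) := by
  have : LipschitzOnWith C.toNNReal w₀ (Icc 0 T) := by
    refine LipschitzOnWith.of_dist_le_mul fun t ht s hs => ?_
    rw [dist_eq_norm, Real.dist_eq]
    exact (hw.lipschitz s hs t ht).trans (by gcongr; exact Real.le_coe_toNNReal C)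
  exact this.continuousOn

theorem continuousInHs (hw : IsBoundedCurve T C w₀ w₁ w₂) {s : ℝ} (h0 : 0 ≤ s) (h2 : s < 2)
    {K : Set ℝ} (hK : IsCompact K) : ContinuousInHs T s K w₀ := by
  intro t ht
  refine ⟨hsENormOn_lt_top h0 h2 K (hw.deriv_one t ht) (hw.deriv_two t ht), ?_⟩
  refine ENNReal.tendsto_nhds_zero.2 fun η hη => ?_
  obtain ⟨η', hη', hle⟩ := ENNReal.lt_iff_exists_nnreal_btwn.1 hη
  rw [ENNReal.coe_pos] at hη'
  obtain ⟨χ, -, δ, hδ, H⟩ := exists_hsENormOn_le h0 h2 hK (2 * C) (η := η') (by exact_mod_cast hη')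
  have hlim : Tendsto (fun r => mulL χ (w₀ r - w₀ t)) (𝓝[Icc 0 T] t) (𝓝 0) := by
    have h1 : Tendsto (fun r => w₀ r - w₀ t) (𝓝[Icc 0 T] t) (𝓝 0) := by
      simpa using (hw.continuousOn t ht).sub_const (w₀ t)
    rw [← map_zero (mulL χ)]
    exact ((mulL χ).continuous.tendsto 0).comp h1
  filter_upwards [hlim.norm.eventually_lt_const (u := δ) (by simpa using hδ),
    self_mem_nhdsWithin] with r hr hrT
  refine (H _ (w₁ r - w₁ t) (w₂ r - w₂ t) ((hw.deriv_one r hrT).sub (hw.deriv_one t ht))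
    ((hw.deriv_two r hrT).sub (hw.deriv_two t ht)) ?_ ?_ ?_ hr.le).trans ?_
  · exact (norm_sub_le _ _).trans (by linarith [hw.norm_zero t ht, hw.norm_zero r hrT])
  · exact (norm_sub_le _ _).trans (by linarith [hw.norm_one t ht, hw.norm_one r hrT])
  · exact (norm_sub_le _ _).trans (by linarith [hw.norm_two t ht, hw.norm_two r hrT])
  · rw [ENNReal.ofReal_coe_nnreal]
    exact hle.le

theorem ae_abs_slope_le (hw : IsBoundedCurve T C w₀ w₁ w₂) {t : ℝ} (ht : t ∈ Icc 0 T) :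
    ∀ᵐ x, |w₁ t x| ≤ 2 * C := by
  have hC : 0 ≤ C := (norm_nonneg _).trans (hw.norm_zero t ht)
  filter_upwards [(hw.deriv_two t ht).ae_sq_le] with x hx
  refine abs_le_of_sq_le_sq ?_ (by positivity)
  calc w₁ t x ^ 2 ≤ 2 * (‖w₁ t‖ * ‖w₂ t‖) := hx
    _ ≤ 2 * (C * C) := by gcongr; exacts [hw.norm_one t ht, hw.norm_two t ht]
    _ ≤ (2 * C) ^ 2 := by nlinarith

end IsBoundedCurve

theorem linftyENorm_le {T η : ℝ} {K : Set ℝ} {w : ℝ → LTwo}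
    (h : ∀ t ∈ Icc 0 T, ∀ᵐ x ∂(volume.restrict K), |w t x| ≤ η) :
    linftyENorm T K w ≤ ENNReal.ofReal η := by
  refine iSup₂_le fun t ht => ?_
  rw [eLpNorm_exponent_top]
  exact eLpNormEssSup_le_of_ae_bound (h t ht)

theorem sqNormOn_le {T a b η : ℝ} {w : ℝ → ℝ → ℝ}
    (h : ∀ t ∈ Icc 0 T, ∀ᵐ x ∂(volume.restrict (Icc a b)), |w t x| ≤ η) :
    sqNormOn T a b w ≤ ENNReal.ofReal η ^ 2 * ENNReal.ofReal (b - a) * ENNReal.ofReal T := by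
  have h1 : ∀ t ∈ Icc 0 T, ∫⁻ x in Icc a b, ‖w t x‖ₑ ^ 2
      ≤ ENNReal.ofReal η ^ 2 * ENNReal.ofReal (b - a) := fun t ht => by
    calc ∫⁻ x in Icc a b, ‖w t x‖ₑ ^ 2 ≤ ∫⁻ _ in Icc a b, ENNReal.ofReal η ^ 2 := by
          refine lintegral_mono_ae ?_
          filter_upwards [h t ht] with x hx
          rw [Real.enorm_eq_ofReal_abs]
          gcongr
      _ = _ := by simp
  calc sqNormOn T a b w
      ≤ ∫⁻ _ in Icc 0 T, ENNReal.ofReal η ^ 2 * ENNReal.ofReal (b - a) :=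
        setLIntegral_mono measurable_const h1
    _ = _ := by simp

theorem tendsto_sqNormOn {T a b : ℝ} {w : ℕ → ℝ → ℝ → ℝ}
    (h : ∀ η > 0, ∀ᶠ k in atTop, ∀ t ∈ Icc 0 T, ∀ᵐ x ∂(volume.restrict (Icc a b)),
      |w k t x| ≤ η) : Tendsto (fun k => sqNormOn T a b (w k)) atTop (𝓝 0) := by
  have hlim : Tendsto (fun η : ℝ => ENNReal.ofReal η ^ 2 * ENNReal.ofReal (b - a) *
      ENNReal.ofReal T) (𝓝[>] 0) (𝓝 0) := by
    have h1 : Tendsto (fun η : ℝ => ENNReal.ofReal (η ^ 2 * (|b - a| * |T|))) (𝓝[>] 0) (𝓝 0) := by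
      have : Continuous fun η : ℝ => ENNReal.ofReal (η ^ 2 * (|b - a| * |T|)) :=
        ENNReal.continuous_ofReal.comp (by fun_prop)
      simpa using (this.tendsto 0).mono_left nhdsWithin_le_nhds
    refine tendsto_of_tendsto_of_tendsto_of_le_of_le' tendsto_const_nhds h1
      (Eventually.of_forall fun _ => zero_le) ?_
    filter_upwards [self_mem_nhdsWithin] with η hη
    rw [ENNReal.ofReal_mul (sq_nonneg η), ENNReal.ofReal_mul (abs_nonneg _),
      ENNReal.ofReal_pow (le_of_lt hη), ← mul_assoc]
    gcongr <;> exact le_abs_self _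
  refine ENNReal.tendsto_nhds_zero.2 fun ε hε => ?_
  obtain ⟨η, hη, hη0⟩ := ((hlim.eventually_le_const hε).and self_mem_nhdsWithin).exists
  exact (h η hη0).mono fun k hk => (sqNormOn_le hk).trans hη

section Convergence

variable {T C : ℝ} {w₀ w₁ w₂ : ℕ → ℝ → LTwo} {v₀ v₁ v₂ : ℝ → LTwo}

theorem eventually_norm_mulL_sub_le (hw : ∀ k, IsBoundedCurve T C (w₀ k) (w₁ k) (w₂ k))
    (hv : IsBoundedCurve T C v₀ v₁ v₂)
    (h0 : ∀ t ∈ Icc 0 T, WeakTendsto (fun k => w₀ k t) (v₀ t)) {χ : ℝ →ᵇ ℝ}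
    (hχ : HasCompactSupport χ) {δ : ℝ} (hδ : 0 < δ) :
    ∀ᶠ k in atTop, ∀ t ∈ Icc 0 T, ‖mulL χ (w₀ k t - v₀ t)‖ ≤ δ := by
  refine eventually_norm_le_of_lipschitz (L := ‖χ‖ * (2 * C)) (fun k s hs t ht => ?_)
    (fun t ht => ?_) hδ
  · rw [← map_sub, mul_assoc]
    refine (norm_mulL_le _ _).trans ?_
    gcongr
    exact ((hw k).sub hv).lipschitz s hs t ht
  · refine tendsto_norm_mulL_of_weakTendsto (fun k => ((hw k).sub hv).deriv_one t ht)
      (fun k => ((hw k).sub hv).norm_zero t ht) (fun k => ((hw k).sub hv).norm_one t ht) ?_ hχ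
    simpa using (h0 t ht).sub (weakTendsto_const (v₀ t))

theorem tendstoInCHs_of_weakTendsto (hw : ∀ k, IsBoundedCurve T C (w₀ k) (w₁ k) (w₂ k))
    (hv : IsBoundedCurve T C v₀ v₁ v₂)
    (h0 : ∀ t ∈ Icc 0 T, WeakTendsto (fun k => w₀ k t) (v₀ t)) {s : ℝ} (hs0 : 0 ≤ s)
    (hs2 : s < 2) {K : Set ℝ} (hK : IsCompact K) : TendstoInCHs T s K w₀ v₀ := by
  refine ⟨fun k => (hw k).continuousInHs hs0 hs2 hK, hv.continuousInHs hs0 hs2 hK,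
    ENNReal.tendsto_nhds_zero.2 fun η hη => ?_⟩
  obtain ⟨η', hη', hle⟩ := ENNReal.lt_iff_exists_nnreal_btwn.1 hη
  rw [ENNReal.coe_pos] at hη'
  obtain ⟨χ, hχ, δ, hδ, H⟩ := exists_hsENormOn_le hs0 hs2 hK (2 * C) (η := η')
    (by exact_mod_cast hη')
  filter_upwards [eventually_norm_mulL_sub_le hw hv h0 hχ hδ] with k hk
  refine iSup₂_le fun t ht => ?_
  have hd := (hw k).sub hv
  refine (H _ _ _ (hd.deriv_one t ht) (hd.deriv_two t ht) (hd.norm_zero t ht) (hd.norm_one t ht)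
    (hd.norm_two t ht) (hk t ht)).trans ?_
  rw [ENNReal.ofReal_coe_nnreal]
  exact hle.le

theorem eventually_ae_abs_slope_sub_le (hw : ∀ k, IsBoundedCurve T C (w₀ k) (w₁ k) (w₂ k))
    (hv : IsBoundedCurve T C v₀ v₁ v₂)
    (h0 : ∀ t ∈ Icc 0 T, WeakTendsto (fun k => w₀ k t) (v₀ t)) {K : Set ℝ} (hK : IsCompact K)
    {η : ℝ} (hη : 0 < η) :
    ∀ᶠ k in atTop, ∀ t ∈ Icc 0 T, ∀ᵐ x ∂(volume.restrict K), |(w₁ k t - v₁ t : LTwo) x| ≤ η := by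
  obtain ⟨χ, hχ, δ, hδ, H⟩ := exists_ae_abs_slope_le hK (2 * C) hη
  filter_upwards [eventually_norm_mulL_sub_le hw hv h0 hχ hδ] with k hk t ht
  have hd := (hw k).sub hv
  exact H _ _ _ (hd.deriv_one t ht) (hd.deriv_two t ht) (hd.norm_zero t ht) (hd.norm_one t ht)
    (hd.norm_two t ht) (hk t ht)

theorem tendstoInLinfty_of_weakTendsto (hw : ∀ k, IsBoundedCurve T C (w₀ k) (w₁ k) (w₂ k))
    (hv : IsBoundedCurve T C v₀ v₁ v₂)
    (h0 : ∀ t ∈ Icc 0 T, WeakTendsto (fun k => w₀ k t) (v₀ t)) {K : Set ℝ} (hK : IsCompact K) :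
    TendstoInLinfty T K w₁ v₁ := by
  refine ⟨fun k => (linftyENorm_le fun t ht => ae_restrict_of_ae
    ((hw k).ae_abs_slope_le ht)).trans_lt ENNReal.ofReal_lt_top, (linftyENorm_le fun t ht =>
    ae_restrict_of_ae (hv.ae_abs_slope_le ht)).trans_lt ENNReal.ofReal_lt_top,
    ENNReal.tendsto_nhds_zero.2 fun η hη => ?_⟩
  obtain ⟨η', hη', hle⟩ := ENNReal.lt_iff_exists_nnreal_btwn.1 hη
  rw [ENNReal.coe_pos] at hη'
  filter_upwards [eventually_ae_abs_slope_sub_le hw hv h0 hK (η := η')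
    (by exact_mod_cast hη')] with k hk
  refine (linftyENorm_le hk).trans ?_
  rw [ENNReal.ofReal_coe_nnreal]
  exact hle.le

theorem mollifier_eq_zero {θ : ℝ → ℝ} {R ε : ℝ} (hR : ∀ x, R < |x| → θ x = 0) (hε : 0 < ε)
    {x : ℝ} (hx : R * ε < |x|) : mollifier θ ε x = 0 := by
  rw [mollifier, hR, mul_zero]
  rwa [abs_div, abs_of_pos hε, lt_div_iff₀ hε]

theorem IsEvenBump.exists_support_subset {θ : ℝ → ℝ} (hθ : IsEvenBump θ) :
    ∃ R, 0 < R ∧ ∀ x, R < |x| → θ x = 0 := by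
  obtain ⟨R, hR0, hR⟩ := hθ.compact.isCompact.isBounded.exists_pos_norm_lt
  refine ⟨R, hR0, fun x hx => image_eq_zero_of_notMem_tsupport fun hm => ?_⟩
  exact lt_asymm hx (hR x hm)

theorem ae_abs_conv_mollifier_sub_le {w₀ w₁ w₂ : ℝ → LTwo} (hw : IsBoundedCurve T C w₀ w₁ w₂)
    {θ : ℝ → ℝ} (hθ : IsEvenBump θ) {R : ℝ} (hR : ∀ x, R < |x| → θ x = 0) {ε : ℝ} (hε : 0 < ε)
    {t : ℝ} (ht : t ∈ Icc 0 T) :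
    ∀ᵐ x, |conv (w₁ t) (mollifier θ ε) x - w₁ t x| ≤ √(R * ε) * C := by
  filter_upwards [(hw.deriv_two t ht).ae_abs_conv_sub_le (isEvenBump_mollifier hθ hε)
    fun x hx => mollifier_eq_zero hR hε hx] with x hx
  refine hx.trans ?_
  gcongr
  exact hw.norm_two t ht

theorem eventually_ae_abs_conv_slope_sub_le
    (hw : ∀ k, IsBoundedCurve T C (w₀ k) (w₁ k) (w₂ k)) (hv : IsBoundedCurve T C v₀ v₁ v₂)
    (h0 : ∀ t ∈ Icc 0 T, WeakTendsto (fun k => w₀ k t) (v₀ t)) {θ : ℝ → ℝ} (hθ : IsEvenBump θ)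
    {ε : ℕ → ℝ} (hε : ∀ k, 0 < ε k) (hε0 : Tendsto ε atTop (𝓝 0)) {K : Set ℝ} (hK : IsCompact K)
    {η : ℝ} (hη : 0 < η) :
    ∀ᶠ k in atTop, ∀ t ∈ Icc 0 T, ∀ᵐ x ∂(volume.restrict K),
      |conv (w₁ k t) (mollifier θ (ε k)) x - v₁ t x| ≤ η := by
  obtain ⟨R, hR0, hR⟩ := hθ.exists_support_subset
  have hlim : Tendsto (fun k => √(R * ε k) * C) atTop (𝓝 0) := by
    simpa using ((hε0.const_mul R).sqrt).mul_const C
  filter_upwards [hlim.eventually_lt_const (half_pos hη),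
    eventually_ae_abs_slope_sub_le hw hv h0 hK (half_pos hη)] with k h1 h2 t ht
  filter_upwards [h2 t ht, ae_restrict_of_ae (Lp.coeFn_sub (w₁ k t) (v₁ t)),
    ae_restrict_of_ae (ae_abs_conv_mollifier_sub_le (hw k) hθ hR (hε k) ht)] with x hx he hc
  rw [he, Pi.sub_apply] at hx
  calc |conv (w₁ k t) (mollifier θ (ε k)) x - v₁ t x|
      ≤ |conv (w₁ k t) (mollifier θ (ε k)) x - w₁ k t x| + |w₁ k t x - v₁ t x| :=
        abs_sub_le _ _ _
    _ ≤ η / 2 + η / 2 := add_le_add (hc.trans h1.le) hx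
    _ = η := add_halves η

theorem abs_conv_slope_le {w₀ w₁ w₂ : ℝ → LTwo} (hw : IsBoundedCurve T C w₀ w₁ w₂)
    {κ : ℝ → ℝ} (hκ : IsEvenBump κ) {t : ℝ} (ht : t ∈ Icc 0 T) (x : ℝ) :
    |conv (w₁ t) κ x| ≤ 2 * C := by
  have hC : 0 ≤ C := (norm_nonneg _).trans (hw.norm_zero t ht)
  refine abs_le_of_sq_le_sq ?_ (by positivity)
  calc conv (w₁ t) κ x ^ 2 ≤ 2 * (‖w₁ t‖ * ‖w₂ t‖) := (hw.deriv_two t ht).sq_conv_le hκ x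
    _ ≤ 2 * (C * C) := by gcongr; exacts [hw.norm_one t ht, hw.norm_two t ht]
    _ ≤ (2 * C) ^ 2 := by nlinarith

theorem sqNormOn_lt_top {a b η : ℝ} {w : ℝ → ℝ → ℝ}
    (h : ∀ t ∈ Icc 0 T, ∀ᵐ x ∂(volume.restrict (Icc a b)), |w t x| ≤ η) :
    sqNormOn T a b w < ⊤ :=
  (sqNormOn_le h).trans_lt (ENNReal.mul_lt_top (ENNReal.mul_lt_top
    (ENNReal.pow_lt_top ENNReal.ofReal_lt_top) ENNReal.ofReal_lt_top) ENNReal.ofReal_lt_top)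

theorem abs_cube_sub_cube_le {x y M : ℝ} (hx : |x| ≤ M) (hy : |y| ≤ M) :
    |x ^ 3 - y ^ 3| ≤ 3 * M ^ 2 * |x - y| := by
  have e : x ^ 3 - y ^ 3 = (x ^ 2 + x * y + y ^ 2) * (x - y) := by ring
  have hM : 0 ≤ M := (abs_nonneg x).trans hx
  rw [e, abs_mul]
  gcongr
  calc |x ^ 2 + x * y + y ^ 2| ≤ |x| ^ 2 + |x| * |y| + |y| ^ 2 := by
        rw [← abs_mul, ← abs_pow, ← abs_pow]
        exact abs_add_three _ _ _
    _ ≤ M ^ 2 + M * M + M ^ 2 := by gcongr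
    _ = 3 * M ^ 2 := by ring

theorem tendstoInLTwoOn_conv_slope
    (hw : ∀ k, IsBoundedCurve T C (w₀ k) (w₁ k) (w₂ k)) (hv : IsBoundedCurve T C v₀ v₁ v₂)
    (h0 : ∀ t ∈ Icc 0 T, WeakTendsto (fun k => w₀ k t) (v₀ t)) {θ : ℝ → ℝ} (hθ : IsEvenBump θ)
    {ε : ℕ → ℝ} (hε : ∀ k, 0 < ε k) (hε0 : Tendsto ε atTop (𝓝 0)) (a b : ℝ) :
    TendstoInLTwoOn T a b (fun k t => conv (w₁ k t) (mollifier θ (ε k))) (fun t => v₁ t) :=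
  ⟨fun k => sqNormOn_lt_top fun _ ht => Eventually.of_forall
      (abs_conv_slope_le (hw k) (isEvenBump_mollifier hθ (hε k)) ht),
    sqNormOn_lt_top fun _ ht => ae_restrict_of_ae (hv.ae_abs_slope_le ht),
    tendsto_sqNormOn fun _ hη =>
      eventually_ae_abs_conv_slope_sub_le hw hv h0 hθ hε hε0 isCompact_Icc hη⟩

theorem tendstoInLTwoOn_conv_slope_cube
    (hw : ∀ k, IsBoundedCurve T C (w₀ k) (w₁ k) (w₂ k)) (hv : IsBoundedCurve T C v₀ v₁ v₂)
    (h0 : ∀ t ∈ Icc 0 T, WeakTendsto (fun k => w₀ k t) (v₀ t)) {θ : ℝ → ℝ} (hθ : IsEvenBump θ)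
    {ε : ℕ → ℝ} (hε : ∀ k, 0 < ε k) (hε0 : Tendsto ε atTop (𝓝 0)) (a b : ℝ) :
    TendstoInLTwoOn T a b (fun k t x => conv (w₁ k t) (mollifier θ (ε k)) x ^ 3)
      (fun t x => v₁ t x ^ 3) := by
  refine ⟨fun k => sqNormOn_lt_top (η := (2 * C) ^ 3) fun t ht => Eventually.of_forall fun x => ?_,
    sqNormOn_lt_top (η := (2 * C) ^ 3) fun t ht => ?_, tendsto_sqNormOn fun η hη => ?_⟩
  · rw [abs_pow]
    gcongr
    exact abs_conv_slope_le (hw k) (isEvenBump_mollifier hθ (hε k)) ht x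
  · filter_upwards [ae_restrict_of_ae (hv.ae_abs_slope_le ht)] with x hx
    rw [abs_pow]
    gcongr
  · set δ := η / (3 * (2 * C) ^ 2 + 1) with hδ
    have hδ0 : 0 < δ := by positivity
    filter_upwards [eventually_ae_abs_conv_slope_sub_le hw hv h0 hθ hε hε0
      (isCompact_Icc (a := a) (b := b)) hδ0] with k hk t ht
    filter_upwards [hk t ht, ae_restrict_of_ae (hv.ae_abs_slope_le ht)] with x hx hx'
    calc _ ≤ 3 * (2 * C) ^ 2 * |conv (w₁ k t) (mollifier θ (ε k)) x - v₁ t x| :=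
          abs_cube_sub_cube_le
            (abs_conv_slope_le (hw k) (isEvenBump_mollifier hθ (hε k)) ht x) hx'
      _ ≤ (3 * (2 * C) ^ 2 + 1) * δ := by gcongr; linarith
      _ = η := by rw [hδ]; field_simp

end Convergence

/-! ### Measurability of curves in `H^m` -/

theorem isClosed_isWeakDeriv (j : ℕ) : IsClosed {q : LTwo × LTwo | IsWeakDeriv j q.1 q.2} := by
  have e : {q : LTwo × LTwo | IsWeakDeriv j q.1 q.2} = ⋂ (φ : ℝ → ℝ) (hφ : ContDiff ℝ ∞ φ)
      (hc : HasCompactSupport φ), {q : LTwo × LTwo |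
        inner ℝ q.1 ((memLp_iteratedDeriv hφ hc j).toLp _) =
          (-1) ^ j * inner ℝ q.2 ((hφ.continuous.memLp_of_hasCompactSupport hc).toLp φ)} := by
    ext q
    simp only [mem_iInter, mem_ofPred_eq, ← integral_mul_eq_inner]
    rfl
  rw [e]
  refine isClosed_iInter fun φ => isClosed_iInter fun hφ => isClosed_iInter fun hc =>
    isClosed_eq ?_ ?_ <;> fun_prop

theorem isClosed_sobolevH (m : ℕ) :
    IsClosed (SobolevH m : Set (PiLp 2 (fun _ : Fin (m + 1) => LTwo))) := by
  have e : (SobolevH m : Set (PiLp 2 (fun _ : Fin (m + 1) => LTwo))) =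
      ⋂ j : Fin (m + 1), (fun F => (F 0, F j)) ⁻¹' {q : LTwo × LTwo | IsWeakDeriv j q.1 q.2} := by
    ext F
    simp only [mem_iInter, mem_preimage, mem_ofPred_eq]
    rfl
  rw [e]
  exact isClosed_iInter fun j => (isClosed_isWeakDeriv j).preimage (by fun_prop)

instance (m : ℕ) : CompleteSpace (SobolevH m) := (isClosed_sobolevH m).completeSpace_coe

instance (m : ℕ) : SecondCountableTopology (PiLp 2 (fun _ : Fin (m + 1) => LTwo)) :=
  (PiLp.homeomorph 2 (fun _ : Fin (m + 1) => LTwo)).secondCountableTopology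

theorem injective_dx_zero (m : ℕ) : Function.Injective (dx 0 : SobolevH m → LTwo) := by
  intro u v h
  refine Subtype.ext (PiLp.ext fun j => ?_)
  exact (isWeakDeriv_dx j u).unique (by rw [h]; exact isWeakDeriv_dx j v)

theorem memLp_of_continuousOn_dx_zero {T M : ℝ} {m : ℕ} {u : ℝ → SobolevH m}
    (hc : ContinuousOn (fun t => dx 0 (u t)) (Icc 0 T)) (hM : ∀ t ∈ Icc 0 T, ‖u t‖ ≤ M) :
    MemLp u 2 (volume.restrict (Icc 0 T)) := by
  borelize LTwo
  let _ : MeasurableSpace (SobolevH m) := borel _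
  have : BorelSpace (SobolevH m) := ⟨rfl⟩
  have he : MeasurableEmbedding (dx 0 : SobolevH m → LTwo) :=
    (dxL 0).continuous.measurableEmbedding (injective_dx_zero m)
  have hm : AEMeasurable u (volume.restrict (Icc 0 T)) :=
    (he.aemeasurable_comp_iff).1 (hc.aemeasurable measurableSet_Icc)
  exact MemLp.of_bound hm.aestronglyMeasurable M
    (ae_restrict_of_forall_mem measurableSet_Icc hM)

/-! ### Weak convergence in `L²(0,T; L²(ℝ))` -/

theorem memLp_of_continuousOn {T : ℝ} {w : ℝ → LTwo} (hw : ContinuousOn w (Icc 0 T)) :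
    MemLp w 2 (volume.restrict (Icc 0 T)) := by
  obtain ⟨C, hC⟩ := isCompact_Icc.exists_bound_of_continuousOn hw
  exact MemLp.of_bound (hw.aestronglyMeasurable measurableSet_Icc) C
    (ae_restrict_of_forall_mem measurableSet_Icc hC)

theorem exists_subseq_tendstoWeakly {T C : ℝ} {w : ℕ → ℝ → LTwo}
    (hw : ∀ k, ContinuousOn (w k) (Icc 0 T)) (hC : ∀ k, ∀ t ∈ Icc 0 T, ‖w k t‖ ≤ C) :
    ∃ φ : ℕ → ℕ, StrictMono φ ∧ ∃ w', TendstoWeakly T (fun k => w (φ k)) w' := by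
  have hm := fun k => memLp_of_continuousOn (hw k)
  obtain ⟨φ, hφ, y, hy⟩ := exists_subseq_weakTendsto (x := fun k => (hm k).toLp (w k))
    (fun k => Lp.norm_le_of_ae_bound (C := |C|) (abs_nonneg C) (by
      filter_upwards [(hm k).coeFn_toLp, ae_restrict_mem measurableSet_Icc] with t h1 h2
      rw [h1]
      exact (hC k t h2).trans (le_abs_self C)))
  refine ⟨φ, hφ, y, fun k => hm _, Lp.memLp y, fun g hg => ?_⟩
  have e : ∀ (z : Lp LTwo 2 (volume.restrict (Icc 0 T))) (w₀ : ℝ → LTwo),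
      z =ᵐ[volume.restrict (Icc 0 T)] w₀ →
      inner ℝ z (hg.toLp g) = ∫ t in Icc 0 T, inner ℝ (w₀ t) (g t) := fun z w₀ hz => by
    rw [L2.inner_def (μ := volume.restrict (Icc 0 T))]
    refine integral_congr_ae ?_
    filter_upwards [hz, hg.coeFn_toLp] with t h1 h2
    rw [h1, h2]
  have h := hy (hg.toLp g)
  rw [e y y EventuallyEq.rfl] at h
  exact h.congr fun k => e _ _ (hm (φ k)).coeFn_toLp

theorem tendstoWeakly_of_weakTendsto {T C : ℝ} {w : ℕ → ℝ → LTwo} {v : ℝ → LTwo}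
    (hw : ∀ k, ContinuousOn (w k) (Icc 0 T)) (hC : ∀ k, ∀ t ∈ Icc 0 T, ‖w k t‖ ≤ C)
    (hv : MemLp v 2 (volume.restrict (Icc 0 T)))
    (h : ∀ t ∈ Icc 0 T, WeakTendsto (fun k => w k t) (v t)) : TendstoWeakly T w v := by
  refine ⟨fun k => memLp_of_continuousOn (hw k), hv, fun g hg => ?_⟩
  refine tendsto_integral_of_dominated_convergence (fun t => C * ‖g t‖) (fun k => ?_)
    ((hg.integrable (by norm_num)).norm.const_mul C) (fun k => ?_) ?_
  · exact ((hw k).aestronglyMeasurable measurableSet_Icc).inner hg.1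
  · filter_upwards [ae_restrict_mem measurableSet_Icc] with t ht
    refine (norm_inner_le_norm _ _).trans ?_
    gcongr
    exact hC k t ht
  · filter_upwards [ae_restrict_mem measurableSet_Icc] with t ht
    exact h t ht (g t)

theorem integral_inner_smul_test {T : ℝ} (hT : 0 < T) {w w' : ℝ → LTwo}
    (hw : ∀ t ∈ Icc 0 T, HasDerivWithinAt w (w' t) (Icc 0 T) t)
    (hc : ContinuousOn w' (Icc 0 T)) {φ : ℝ → ℝ} (hφ : ContDiff ℝ ∞ φ)
    (hsupp : tsupport φ ⊆ Ioo 0 T) (z : LTwo) :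
    ∫ t in Icc 0 T, inner ℝ (w t) (deriv φ t • z)
      = -∫ t in Icc 0 T, inner ℝ (w' t) (φ t • z) := by
  have hwc : ContinuousOn w (Icc 0 T) := fun t ht => (hw t ht).continuousWithinAt
  have hφ' := (contDiff_deriv_top hφ).continuous
  have c1 : ContinuousOn (fun t => inner ℝ (w t) (deriv φ t • z)) (Icc 0 T) :=
    hwc.inner (hφ'.smul continuous_const).continuousOn
  have c2 : ContinuousOn (fun t => inner ℝ (w' t) (φ t • z)) (Icc 0 T) :=
    hc.inner (hφ.continuous.smul continuous_const).continuousOn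
  have h0 : ∀ t, t ∉ Ioo 0 T → φ t = 0 := fun t ht =>
    image_eq_zero_of_notMem_tsupport fun h => ht (hsupp h)
  have hd : ∀ t ∈ Ioo 0 T, HasDerivAt (fun t => inner ℝ (w t) (φ t • z))
      (inner ℝ (w t) (deriv φ t • z) + inner ℝ (w' t) (φ t • z)) t := fun t ht => by
    have h1 : HasDerivAt w (w' t) t := (hw t (Ioo_subset_Icc_self ht)).hasDerivAt
      (Icc_mem_nhds ht.1 ht.2)
    have h2 : HasDerivAt φ (deriv φ t) t :=
      ((hφ.differentiable (by norm_num)) t).hasDerivAt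
    exact h1.inner ℝ (h2.smul_const z)
  have hF := intervalIntegral.integral_eq_sub_of_hasDerivAt_of_le hT.le
    (hwc.inner (hφ.continuous.smul continuous_const).continuousOn) hd
    (ContinuousOn.intervalIntegrable_of_Icc hT.le (c1.add c2))
  rw [h0 0 (by simp), h0 T (by simp), zero_smul, inner_zero_right, inner_zero_right, sub_zero,
    intervalIntegral.integral_of_le hT.le, ← integral_Icc_eq_integral_Ioc,
    integral_add (c1.integrableOn_Icc) (c2.integrableOn_Icc)] at hF
  linarith

theorem isWeakTimeDeriv_of_tendstoWeakly {T : ℝ} (hT : 0 < T) {w w' : ℕ → ℝ → LTwo}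
    {v v' : ℝ → LTwo}
    (hw : ∀ k, ∀ t ∈ Icc 0 T, HasDerivWithinAt (w k) (w' k t) (Icc 0 T) t)
    (hc : ∀ k, ContinuousOn (w' k) (Icc 0 T)) (h : TendstoWeakly T w v)
    (h' : TendstoWeakly T w' v') : IsWeakTimeDeriv T v v' := by
  intro φ hφ hφc hsupp
  have key : ∀ {ψ : ℝ → ℝ} (_ : Continuous ψ) (_ : HasCompactSupport ψ) {y : ℝ → LTwo}
      (_ : MemLp y 2 (volume.restrict (Icc 0 T))) (z : LTwo),
      MemLp (fun t => ψ t • z) 2 (volume.restrict (Icc 0 T)) ∧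
      inner ℝ z (∫ t in Icc 0 T, ψ t • y t) = ∫ t in Icc 0 T, inner ℝ (y t) (ψ t • z) := by
    intro ψ hψ hψc y hy z
    refine ⟨((hψ.smul continuous_const).memLp_of_hasCompactSupport hψc.smul_right).restrict _, ?_⟩
    obtain ⟨B, hB⟩ := hψ.bounded_above_of_compact_support hψc
    have hi : Integrable (fun t => ψ t • y t) (volume.restrict (Icc 0 T)) :=
      (hy.integrable (by norm_num)).bdd_smul B hψ.aestronglyMeasurable (Eventually.of_forall hB)
    rw [← integral_inner (𝕜 := ℝ) hi z]
    refine integral_congr_ae (Eventually.of_forall fun t => ?_)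
    simp only [inner_smul_right, real_inner_comm]
  have hφ' := (contDiff_deriv_top hφ).continuous
  refine ext_inner_left ℝ fun z => ?_
  rw [inner_neg_right, (key hφ' hφc.deriv h.2.1 z).2, (key hφ.continuous hφc h'.2.1 z).2]
  refine tendsto_nhds_unique (h.2.2 _ (key hφ' hφc.deriv h.2.1 z).1) ?_
  simp only [integral_inner_smul_test hT (hw _) (hc _) hφ hsupp z]
  exact (h'.2.2 _ (key hφ.continuous hφc h.2.1 z).1).neg

/-! ### The limit of the mollified problems -/

theorem isBoundedCurve_of_memEZero {T C : ℝ} (hT : 0 < T) {U : ℝ → SobolevH 4}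
    (h : MemEZero T U) (hC : ∀ t ∈ Icc 0 T, ‖dt T 1 U t‖ ≤ C ∧ ‖dx 0 (U t)‖ ≤ C ∧
      ‖dx 1 (U t)‖ ≤ C ∧ ‖dx 2 (U t)‖ ≤ C) :
    IsBoundedCurve T C (fun t => dx 0 (U t)) (fun t => dx 1 (U t)) (fun t => dx 2 (U t)) where
  deriv_one t _ := isWeakDeriv_dx_succ 0 (U t)
  deriv_two t _ := isWeakDeriv_dx_succ 1 (U t)
  norm_zero t ht := (hC t ht).2.1
  norm_one t ht := (hC t ht).2.2.1
  norm_two t ht := (hC t ht).2.2.2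
  lipschitz s hs t ht := by
    obtain ⟨-, V, hV⟩ := h.exists_deriv hT
    exact (convex_Icc 0 T).norm_image_sub_le_of_norm_hasDerivWithin_le
      (fun r hr => (hV r hr).2.1) (fun r hr => (hC r hr).1) hs ht

theorem exists_sobolevH_weakTendsto {x₀ x₁ x₂ : ℕ → LTwo} {C : ℝ} {y : LTwo}
    (h1 : ∀ k, IsWeakDeriv 1 (x₀ k) (x₁ k)) (h2 : ∀ k, IsWeakDeriv 1 (x₁ k) (x₂ k))
    (hC1 : ∀ k, ‖x₁ k‖ ≤ C) (hC2 : ∀ k, ‖x₂ k‖ ≤ C) (hy : WeakTendsto x₀ y) :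
    ∃ u : SobolevH 2, WeakTendsto x₀ (dx 0 u) ∧ WeakTendsto x₁ (dx 1 u) ∧
      WeakTendsto x₂ (dx 2 u) := by
  obtain ⟨y₁, hy1, hw1⟩ := exists_isWeakDeriv_weakTendsto h1 hC1 hy
  obtain ⟨y₂, hy2, hw2⟩ := exists_isWeakDeriv_weakTendsto h2 hC2 hw1
  refine ⟨⟨WithLp.toLp 2 ![y, y₁, y₂], fun j => ?_⟩, hy, hw1, hw2⟩
  fin_cases j
  · exact isWeakDeriv_zero y
  · exact hy1
  · exact hy1.succ hy2

theorem norm_sobolevH_two_le {u : SobolevH 2} {C : ℝ} (h0 : ‖dx 0 u‖ ≤ C) (h1 : ‖dx 1 u‖ ≤ C)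
    (h2 : ‖dx 2 u‖ ≤ C) : ‖u‖ ≤ 3 * C := by
  have hC : 0 ≤ C := (norm_nonneg _).trans h0
  have e : ‖u‖ ^ 2 = ‖dx 0 u‖ ^ 2 + ‖dx 1 u‖ ^ 2 + ‖dx 2 u‖ ^ 2 := by
    have := PiLp.norm_sq_eq_of_L2 (fun _ : Fin 3 => LTwo) (u : PiLp 2 (fun _ : Fin 3 => LTwo))
    rw [Fin.sum_univ_three] at this
    exact this
  refine le_of_sq_le_sq ?_ (by positivity)
  calc ‖u‖ ^ 2 = _ := e
    _ ≤ C ^ 2 + C ^ 2 + C ^ 2 := by gcongr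
    _ ≤ (3 * C) ^ 2 := by nlinarith

theorem exists_limit_curve {T C : ℝ} (hT : 0 < T) {w₀ w₁ w₂ : ℕ → ℝ → LTwo}
    (hw : ∀ k, IsBoundedCurve T C (w₀ k) (w₁ k) (w₂ k)) :
    ∃ φ : ℕ → ℕ, StrictMono φ ∧ ∃ u : ℝ → SobolevH 2,
      IsBoundedCurve T C (fun t => dx 0 (u t)) (fun t => dx 1 (u t)) (fun t => dx 2 (u t)) ∧
      MemLp u 2 (volume.restrict (Icc 0 T)) ∧
      ∀ t ∈ Icc 0 T, WeakTendsto (fun k => w₀ (φ k) t) (dx 0 (u t)) ∧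
        WeakTendsto (fun k => w₂ (φ k) t) (dx 2 (u t)) := by
  obtain ⟨φ, hφ, hlim⟩ := exists_subseq_weakTendsto_of_lipschitz hT.le
    (fun k => (hw k).norm_zero) (fun k => (hw k).lipschitz)
  have hex : ∀ t ∈ Icc 0 T, ∃ u : SobolevH 2, WeakTendsto (fun k => w₀ (φ k) t) (dx 0 u) ∧
      WeakTendsto (fun k => w₁ (φ k) t) (dx 1 u) ∧
      WeakTendsto (fun k => w₂ (φ k) t) (dx 2 u) := fun t ht => by
    obtain ⟨y, hy⟩ := hlim t ht
    exact exists_sobolevH_weakTendsto (fun k => (hw _).deriv_one t ht)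
      (fun k => (hw _).deriv_two t ht) (fun k => (hw _).norm_one t ht)
      (fun k => (hw _).norm_two t ht) hy
  choose! u hu using hex
  have hb : IsBoundedCurve T C (fun t => dx 0 (u t)) (fun t => dx 1 (u t))
      (fun t => dx 2 (u t)) :=
    { deriv_one := fun t _ => isWeakDeriv_dx_succ 0 (u t)
      deriv_two := fun t _ => isWeakDeriv_dx_succ 1 (u t)
      norm_zero := fun t ht => (hu t ht).1.norm_le fun k => (hw _).norm_zero t ht
      norm_one := fun t ht => (hu t ht).2.1.norm_le fun k => (hw _).norm_one t ht
      norm_two := fun t ht => (hu t ht).2.2.norm_le fun k => (hw _).norm_two t ht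
      lipschitz := fun s hs t ht => ((hu t ht).1.sub (hu s hs).1).norm_le fun k =>
        (hw _).lipschitz s hs t ht }
  exact ⟨φ, hφ, u, hb, memLp_of_continuousOn_dx_zero hb.continuousOn fun t ht =>
    norm_sobolevH_two_le (hb.norm_zero t ht) (hb.norm_one t ht) (hb.norm_two t ht),
    fun t ht => ⟨(hu t ht).1, (hu t ht).2.2⟩⟩

theorem corollary2 (T ν : ℝ) (hT : 0 < T)
    (ζ P θ : ℝ → ℝ) (f p : ℝ → SobolevH 2) (u₀ : SobolevH 2) (u₁ : LTwo)
    (hζ : ContDiffOn ℝ 2 ζ (Icc 0 T)) (hP : ContDiffOn ℝ 2 P (Icc 0 T))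
    (hf : ContinuousOn f (Icc 0 T)) (hp : ContinuousOn p (Icc 0 T))
    (hθ : IsEvenBump θ) (hu₁ : MemLp u₁ ⊤ volume)
    -- the family of solutions of the mollified problems
    (uε : ℝ → ℝ → SobolevH 4)
    (huε : ∀ ε : ℝ, 0 < ε → IsMollifiedSolution T ν ζ P θ f p u₀ u₁ ε (uε ε))
    -- any sequence of positive parameters that tends to zero
    (e : ℕ → ℝ) (he : ∀ n, 0 < e n) (he0 : Tendsto e atTop (𝓝 0)) :
    -- has a subsequence `ε k = e (σ k)` along which the solutions converge to some `u`
    ∃ σ : ℕ → ℕ, StrictMono σ ∧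
    ∃ (u : ℝ → SobolevH 2) (ut : ℝ → LTwo),
      MemLp u 2 (volume.restrict (Icc 0 T)) ∧
      IsWeakTimeDeriv T (fun t => dx 0 (u t)) ut ∧
      -- (i)
      (TendstoWeakly T (fun k t => dx 0 (uε (e (σ k)) t)) (fun t => dx 0 (u t)) ∧
        TendstoWeakly T (fun k t => dt T 1 (uε (e (σ k))) t) ut ∧
        TendstoWeakly T (fun k t => dx 2 (uε (e (σ k)) t)) (fun t => dx 2 (u t))) ∧
      -- (ii)
      (∀ α : ℝ, 0 < α → α ≤ 2 → ∀ K : Set ℝ, IsCompact K →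
        TendstoInCHs T (2 - α) K (fun k t => dx 0 (uε (e (σ k)) t)) (fun t => dx 0 (u t))) ∧
      (∀ K : Set ℝ, IsCompact K →
        TendstoInLinfty T K (fun k t => dx 1 (uε (e (σ k)) t)) (fun t => dx 1 (u t))) ∧
      -- (iii)
      (∀ a b : ℝ, a < b →
        TendstoInLTwoOn T a b
          (fun k t => conv (dx 1 (uε (e (σ k)) t)) (mollifier θ (e (σ k))))
          (fun t => dx 1 (u t)) ∧
        TendstoInLTwoOn T a b
          (fun k t x => conv (dx 1 (uε (e (σ k)) t)) (mollifier θ (e (σ k))) x ^ 3)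
          (fun t x => dx 1 (u t) x ^ 3)) := by
  obtain ⟨C, hC⟩ := exists_uniform_bound hT hζ hP.continuousOn hf hp hθ hu₁
  have hreg : ∀ n, MemEZero T (uε (e n)) := fun n => (huε (e n) (he n)).regular
  have hbd := fun n => hC (e n) (he n) (uε (e n)) (huε (e n) (he n))
  have hw := fun n => isBoundedCurve_of_memEZero hT (hreg n) (hbd n)
  obtain ⟨φ, hφ, u, hu, huL, hlim⟩ := exists_limit_curve hT hw
  obtain ⟨ψ, hψ, ut, hut⟩ := exists_subseq_tendstoWeakly
    (w := fun k t => dt T 1 (uε (e (φ k))) t) (fun k => ((hreg _).exists_deriv hT).1)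
    (fun k t ht => (hbd _ t ht).1)
  have hw' := fun k => hw (φ (ψ k))
  have h0 : ∀ t ∈ Icc 0 T, WeakTendsto (fun k => dx 0 (uε (e (φ (ψ k))) t)) (dx 0 (u t)) :=
    fun t ht => (hlim t ht).1.comp hψ
  have hε : ∀ k, 0 < e (φ (ψ k)) := fun k => he _
  have hε0 : Tendsto (fun k => e (φ (ψ k))) atTop (𝓝 0) :=
    he0.comp (hφ.comp hψ).tendsto_atTop
  have hi0 : TendstoWeakly T (fun k t => dx 0 (uε (e (φ (ψ k))) t)) (fun t => dx 0 (u t)) :=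
    tendstoWeakly_of_weakTendsto (fun k => (hw' k).continuousOn) (fun k => (hw' k).norm_zero)
      ((dxL 0).comp_memLp' huL) h0
  have hi2 : TendstoWeakly T (fun k t => dx 2 (uε (e (φ (ψ k))) t)) (fun t => dx 2 (u t)) :=
    tendstoWeakly_of_weakTendsto
      (fun k => (dxL 2).continuous.comp_continuousOn (hreg (φ (ψ k))).1)
      (fun k => (hw' k).norm_two) ((dxL 2).comp_memLp' huL) fun t ht => (hlim t ht).2.comp hψ
  refine ⟨φ ∘ ψ, hφ.comp hψ, u, ut, huL, isWeakTimeDeriv_of_tendstoWeakly hT (fun k t ht => ?_)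
    (fun k => ((hreg (φ (ψ k))).exists_deriv hT).1) hi0 hut, ⟨hi0, hut, hi2⟩,
    fun α hα hα2 K hK => tendstoInCHs_of_weakTendsto hw' hu h0 (by linarith) (by linarith) hK,
    fun K hK => tendstoInLinfty_of_weakTendsto hw' hu h0 hK, fun a b _ =>
    ⟨tendstoInLTwoOn_conv_slope hw' hu h0 hθ hε hε0 a b,
      tendstoInLTwoOn_conv_slope_cube hw' hu h0 hθ hε hε0 a b⟩⟩
  obtain ⟨-, V, hV⟩ := (hreg (φ (ψ k))).exists_deriv hT
  exact (hV t ht).2.1
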